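/- Let $X^\pm$ be $C^2$ vector fields on $\mathbb{R}^2$, $X^\pm=(X^\pm_1,X^\pm_2)$, and let $Z$ be the Filippov system equal to $X^+$ for $y>0$ and to $X^-$ for $y<0$, with switching line $\Sigma=\{y=0\}$. Assume that the origin is a generic visible fold-regular point: $X^+_2(0,0)=0$, $X^+_1(0,0)>0$, $\partial_xX^+_2(0,0)\neq 0$, $X^+_2(x,0)<0$ for $x<0$, $X^+_2(x,0)>0$ for $x>0$, and $X^-_2(0,0)>0$. Let $\varphi:\mathbb{R}\to\mathbb{R}$ be Lipschitz, equal to $-1$ on $(-\infty,-1]$, equal to $1$ on $[1,\infty)$ and strictly increasing on $[-1,1]$ (this includes the piecewise linear transition function and those of class $C^{p-1}$, $p\ge 2$), and put $$Z_\varepsilon(x,y)=\frac{X^++X^-}{2}(x,y)+\varphi\Big(\frac{y}{\varepsilon}\Big)\frac{X^+-X^-}{2}(x,y),\qquad \varepsilon>0 .$$ The interior (exterior) of a closed curve is the union of the bounded (unbounded) components of its complement. Suppose that $X^+$ has a center $p\in\{y>0\}$ surrounded by periodic orbits some of which intersect $\Sigma$; that is, there is an open set $A\ni p$ meeting $\Sigma$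 such that $X^+(p)=0$ and every point of $A\setminus\{p\}$ lies on a non-constant periodic orbit of $X^+$ that surrounds $p$ and is contained, together with its interior, in $A$. Then there are points $(x_\varepsilon,\varepsilon)$, with $x_\varepsilon\to0$ as $\varepsilon\to0^+$, such that: 1. For every $R>0$ and all small enough $\varepsilon>0$, $(x_\varepsilon,\varepsilon)$ is the only point of the line $y=\varepsilon$ with $|x|\le R$ at which $X^+$ is tangent to this line, i.e. $X^+_2(x,\varepsilon)=0$. 2. For all small enough $\varepsilon>0$ the orbit $\Gamma_\varepsilon$ of $X^+$ through $(x_\varepsilon,\varepsilon)$ is periodic, it is also a periodic orbit of $Z_\varepsilon$, and its interior is foliated by periodic orbits of $Z_\varepsilon$: it contains $p$, $Z_\varepsilon(p)=0$, and every other point of it lies on a non-constant periodic orbit of $Z_\varepsilon$ that is contained in the interior of $\Gamma_\varepsilon$ and surrounds $p$. 3. $\Gamma_\varepsilon$ attracts all exterior orbits near it and in the regularization strip, in the following sense. Let $M,N\ge0$ be such that $X^-_2(x,0)>0$ for $-M\le x\le N$; $(X^+_1X^-_2-X^-_1X^+_2)(x,0)>0$ for $-M\le x\le0$ (so the sliding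 motion on $[-M,0)$ is to the right); and, for $0\le x\le N$, the forward $X^+$-orbit of $(x,0)$ stays in $\{y\ge0\}$ until it arrives at a point $(s,0)$ with $-M\le s\le0$. (These conditions hold for $M=N=0$.) Then there is an open set $U\supset[-M,N]\times\{0\}$, independent of $\varepsilon$, such that for all small enough $\varepsilon>0$: $\Gamma_\varepsilon\subset U$, and for every point $q\in U$ in the exterior of $\Gamma_\varepsilon$ the forward $Z_\varepsilon$-orbit of $q$ exists for all times $t\ge0$ and its distance to $\Gamma_\varepsilon$ tends to $0$ as $t\to\infty$. So $\Gamma_\varepsilon$ is a semistable periodic orbit of $Z_\varepsilon$. -/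

import Mathlib

open Filter Topology Set

/-- `γ` is a non-constant periodic solution, defined for all times, of the planar autonomous
system `q' = X q`.  Its orbit is `Set.range γ`. -/
def IsPeriodicSol (X : ℝ × ℝ → ℝ × ℝ) (γ : ℝ → ℝ × ℝ) : Prop :=
  (∀ t, HasDerivAt γ (X (γ t)) t) ∧ (∃ T : ℝ, 0 < T ∧ Function.Periodic γ T) ∧
    ∃ t, γ t ≠ γ 0

/-- The interior of a closed curve `Γ`: the points off `Γ` whose connected component in the
complement of `Γ` is bounded. -/
def curveInterior (Γ : Set (ℝ × ℝ)) : Set (ℝ × ℝ) :=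
  {q | q ∉ Γ ∧ Bornology.IsBounded (connectedComponentIn Γᶜ q)}

/-- The exterior of a closed curve `Γ`: the points off `Γ` whose connected component in the
complement of `Γ` is unbounded. -/
def curveExterior (Γ : Set (ℝ × ℝ)) : Set (ℝ × ℝ) :=
  {q | q ∉ Γ ∧ ¬ Bornology.IsBounded (connectedComponentIn Γᶜ q)}

/-- `p` is a center of `X`, and the open set `A` is filled, except for the equilibrium `p`, by
periodic orbits of `X` that surround `p`.  (The largest such `A` is the period annulus together
with `p`.) -/
structure IsCenter (X : ℝ × ℝ → ℝ × ℝ) (p : ℝ × ℝ) (A : Set (ℝ × ℝ)) : Prop where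
  isOpen : IsOpen A
  mem : p ∈ A
  equilibrium : X p = 0
  periodic : ∀ q ∈ A, q ≠ p → ∃ γ : ℝ → ℝ × ℝ, IsPeriodicSol X γ ∧ q ∈ range γ ∧
    range γ ⊆ A ∧ p ∈ curveInterior (range γ) ∧ curveInterior (range γ) ⊆ A

/-- The vector fields `Xp` (for `y > 0`) and `Xm` (for `y < 0`) form a planar Filippov system with
switching line `y = 0` and a generic visible fold-regular point at the origin. -/
structure IsVisibleFold (Xp Xm : ℝ × ℝ → ℝ × ℝ) : Prop where
  contDiff_plus : ContDiff ℝ 2 Xp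
  contDiff_minus : ContDiff ℝ 2 Xm
  tangent : (Xp (0, 0)).2 = 0
  rightward : 0 < (Xp (0, 0)).1
  generic : deriv (fun x : ℝ => (Xp (x, 0)).2) 0 ≠ 0
  down : ∀ x : ℝ, x < 0 → (Xp (x, 0)).2 < 0
  up : ∀ x : ℝ, 0 < x → 0 < (Xp (x, 0)).2
  minus_up : 0 < (Xm (0, 0)).2

/-- Transition functions of the regularization: Lipschitz, equal to `-1` on `v ≤ -1` and to `1` on
`v ≥ 1`, and strictly increasing in between.  This covers both the piecewise linear transition
function and the increasing ones of class `C ^ (p - 1)`, `p ≥ 2`. -/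
structure IsTransition (φ : ℝ → ℝ) : Prop where
  lipschitz : ∃ K : NNReal, LipschitzWith K φ
  left : ∀ v : ℝ, v ≤ -1 → φ v = -1
  right : ∀ v : ℝ, 1 ≤ v → φ v = 1
  strictMono : StrictMonoOn φ (Icc (-1) 1)

/-- The Sotomayor-Teixeira regularization
`Z_ε = (X⁺ + X⁻) / 2 + φ (y / ε) (X⁺ - X⁻) / 2`. -/
noncomputable def regularized (Xp Xm : ℝ × ℝ → ℝ × ℝ) (φ : ℝ → ℝ) (ε : ℝ) (q : ℝ × ℝ) : ℝ × ℝ :=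
  (1 / 2 : ℝ) • (Xp q + Xm q) + (φ (q.2 / ε) / 2) • (Xp q - Xm q)

/-- The forward orbit of `q` under `Z` exists for all positive times and tends to `Γ`. -/
def IsAttracted (Z : ℝ × ℝ → ℝ × ℝ) (q : ℝ × ℝ) (Γ : Set (ℝ × ℝ)) : Prop :=
  ∃ γ : ℝ → ℝ × ℝ, γ 0 = q ∧ (∀ t ∈ Ici (0 : ℝ), HasDerivWithinAt γ (Z (γ t)) (Ici 0) t) ∧
    Tendsto (fun t => Metric.infDist (γ t) Γ) atTop (𝓝 0)

/-- At `(x, 0)` the lower field points up, and the determinant `X⁺₁ X⁻₂ - X⁻₁ X⁺₂` is positive.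
For `x < 0` this says that `(x, 0)` is a sliding point at which the Filippov sliding field
`(X⁺₁ X⁻₂ - X⁻₁ X⁺₂) / (X⁻₂ - X⁺₂)` moves to the right, towards the fold. -/
def SlidesRight (Xp Xm : ℝ × ℝ → ℝ × ℝ) (x : ℝ) : Prop :=
  0 < (Xm (x, 0)).2 ∧
    0 < (Xp (x, 0)).1 * (Xm (x, 0)).2 - (Xm (x, 0)).1 * (Xp (x, 0)).2

/-- The forward orbit of `(x, 0)` under `X` stays in `y ≥ 0` until it arrives at a point `(s, 0)`
with `-M ≤ s ≤ 0`. -/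
def ReturnsTo (X : ℝ × ℝ → ℝ × ℝ) (x M : ℝ) : Prop :=
  ∃ (τ : ℝ) (γ : ℝ → ℝ × ℝ), 0 ≤ τ ∧ γ 0 = (x, 0) ∧
    (∀ t ∈ Icc 0 τ, HasDerivWithinAt γ (X (γ t)) (Icc 0 τ) t ∧ 0 ≤ (γ t).2) ∧
    (γ τ).2 = 0 ∧ -M ≤ (γ τ).1 ∧ (γ τ).1 ≤ 0

/-!
The periodic orbits of `X⁺` around `p` are nested, and each is labelled by its height, the least
`y` on it, which is continuous. At its lowest point an orbit of height `m` near `0` is tangent to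
the line `y = m`, so it is the orbit through the tangency `(ξ m, m)`. The orbit of height `ε` and
everything inside it lie in `y ≥ ε`, where `Z_ε = X⁺`, which gives the periodic orbits of `Z_ε`.

Outside that orbit the height never decreases along `Z_ε`: it is constant above `y = ε`, and below
`y = ε` near the fold `X⁻` points to the upper side of `X⁺`, so that `Z_ε` crosses the orbits of
`X⁺` upwards. No orbit of `X⁺` of height below `ε` stays in `y ≥ ε`, so by LaSalle's principle the
heights along `Z_ε` converge to `ε`.

An orbit that starts near the segment `[-M, N] × {0}` reaches a neighbourhood of the origin. Near
`[-M, 0]` a function `L` that increases along both `X⁺` and `X⁻`, hence along their convex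
combination `Z_ε`, funnels it to the right. Near `(0, N]` it rises above `y = ε` and follows a
returning orbit of `X⁺` back to that funnel.
-/

/-! ### Locally Lipschitz autonomous equations -/

section LocallyLipschitz

variable {α : Type*} [PseudoEMetricSpace α]

theorem locallyLipschitz_smul {E : Type*} [NormedAddCommGroup E] [NormedSpace ℝ E] {f : α → ℝ}
    {g : α → E} (hf : LocallyLipschitz f) (hg : LocallyLipschitz g) :
    LocallyLipschitz fun q => f q • g q :=
  (contDiff_smul : ContDiff ℝ 1 fun q : ℝ × E => q.1 • q.2).locallyLipschitz.comp (hf.prodMk hg)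

theorem locallyLipschitz_inv_of_ne_zero {f : α → ℝ} (hf : LocallyLipschitz f) (h : ∀ q, f q ≠ 0) :
    LocallyLipschitz fun q => (f q)⁻¹ := by
  intro q
  obtain ⟨K, t, ht, hK⟩ := hf q
  obtain ⟨L, u, hu, hL⟩ := (contDiffAt_inv ℝ (h q) : ContDiffAt ℝ 1 _ _).exists_lipschitzOnWith
  exact ⟨L * K, t ∩ f ⁻¹' u, inter_mem ht (hf.continuous.continuousAt hu),
    hL.comp (hK.mono inter_subset_left) fun _ hx => hx.2⟩

theorem lipschitzWith_smul_of_eq_zero {α E : Type*} [PseudoMetricSpace α]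
    [NormedAddCommGroup E] [NormedSpace ℝ E] {χ : α → ℝ} {f : α → E} {s : Set α} {K L C : NNReal}
    (hχ : LipschitzWith L χ) (hχ_le : ∀ x, |χ x| ≤ 1) (hχ_zero : ∀ x ∉ s, χ x = 0)
    (hf : LipschitzOnWith K f s) (hC : ∀ x ∈ s, ‖f x‖ ≤ C) :
    LipschitzWith (L * C + K) fun x => χ x • f x := by
  have hlip : ∀ x ∈ s, ∀ y, dist (χ x • f x) (χ y • f y) ≤ (L * C + K : NNReal) * dist x y := by
    intro x hx y
    have hfst : ‖(χ x - χ y) • f x‖ ≤ L * C * dist x y := by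
      rw [norm_smul, ← dist_eq_norm, mul_right_comm]
      exact mul_le_mul (hχ.dist_le_mul x y) (hC x hx) (norm_nonneg _) (by positivity)
    have hsnd : ‖χ y • (f x - f y)‖ ≤ K * dist x y := by
      by_cases hy : y ∈ s
      · rw [norm_smul, ← dist_eq_norm]
        exact (mul_le_of_le_one_left dist_nonneg (hχ_le y)).trans (hf.dist_le_mul x hx y hy)
      · rw [hχ_zero y hy, zero_smul, norm_zero]
        positivity
    calc dist (χ x • f x) (χ y • f y) = ‖(χ x - χ y) • f x + χ y • (f x - f y)‖ := by
          rw [dist_eq_norm]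
          congr 1
          module
      _ ≤ (L * C + K : NNReal) * dist x y := by
          rw [NNReal.coe_add, NNReal.coe_mul, add_mul]
          exact (norm_add_le _ _).trans (add_le_add hfst hsnd)
  refine .of_dist_le_mul fun x y => ?_
  by_cases hx : x ∈ s
  · exact hlip x hx y
  by_cases hy : y ∈ s
  · rw [dist_comm, dist_comm x]
    exact hlip y hy x
  · rw [hχ_zero x hx, hχ_zero y hy, zero_smul, zero_smul, dist_self]
    positivity

end LocallyLipschitz

/-- `v` solves the autonomous system `v' = Z v` on the time set `s`. -/
abbrev IsSolOn {E : Type*} [NormedAddCommGroup E] [NormedSpace ℝ E] (Z : E → E) (v : ℝ → E)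
    (s : Set ℝ) : Prop :=
  IsIntegralCurveOn v (fun _ => Z) s

/-- `v` is continuous and solves `v' = Z v` as long as it is in the ball of radius `R`.  Unlike a
solution of `v' = Z v`, such a curve is defined for all times whenever `Z` is locally Lipschitz. -/
structure IsCurveIn {E : Type*} [NormedAddCommGroup E] [NormedSpace ℝ E] (Z : E → E) (R : ℝ)
    (v : ℝ → E) : Prop where
  continuous : Continuous v
  hasDerivAt : ∀ t, v t ∈ Metric.closedBall (0 : E) R → HasDerivAt v (Z (v t)) t

section AutonomousODE

variable {E : Type*} [NormedAddCommGroup E] [NormedSpace ℝ E] {Z Z' : E → E} {v w u : ℝ → E}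
  {s s' : Set ℝ} {a b c R T : ℝ}

namespace IsSolOn

theorem congr_field (h : IsSolOn Z v s) (hs : ∀ t ∈ s, Z (v t) = Z' (v t)) : IsSolOn Z' v s :=
  fun t ht => (h t ht).congr_deriv (hs t ht)

theorem shift (h : IsSolOn Z v s) (c : ℝ) (hs : MapsTo (fun t => t + c) s' s) :
    IsSolOn Z (fun t => v (t + c)) s' := fun t ht => by
  have hderiv := (h (t + c) (hs ht)).scomp t ((hasDerivAt_id t).add_const c).hasDerivWithinAt hs
  rwa [one_smul] at hderiv

theorem hasDerivWithinAt_Ici (h : IsSolOn Z v (Icc a b)) {t : ℝ} (ht : t ∈ Ico a b) :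
    HasDerivWithinAt v (Z (v t)) (Ici t) t :=
  (h t (Ico_subset_Icc_self ht)).mono_of_mem_nhdsWithin (Icc_mem_nhdsGE_of_mem ht)

theorem hasDerivWithinAt_Iic (h : IsSolOn Z v (Icc a b)) {t : ℝ} (ht : t ∈ Ioc a b) :
    HasDerivWithinAt v (Z (v t)) (Iic t) t :=
  (h t (Ioc_subset_Icc_self ht)).mono_of_mem_nhdsWithin (Icc_mem_nhdsLE_of_mem ht)

theorem exists_lipschitzOnWith (hZ : LocallyLipschitz Z) (hv : IsSolOn Z v (Icc a b))
    (hw : IsSolOn Z w (Icc a b)) :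
    ∃ K, LipschitzOnWith K Z (v '' Icc a b ∪ w '' Icc a b) :=
  hZ.locallyLipschitzOn.exists_lipschitzOnWith_of_compact <|
    (isCompact_Icc.image_of_continuousOn hv.continuousOn).union
      (isCompact_Icc.image_of_continuousOn hw.continuousOn)

theorem eqOn_right (hZ : LocallyLipschitz Z) (hv : IsSolOn Z v (Icc a b))
    (hw : IsSolOn Z w (Icc a b)) (h : v a = w a) : EqOn v w (Icc a b) := by
  obtain ⟨K, hK⟩ := exists_lipschitzOnWith hZ hv hw
  exact ODE_solution_unique_of_mem_Icc_right (v := fun _ => Z)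
    (s := fun _ => v '' Icc a b ∪ w '' Icc a b) (fun _ _ => hK)
    hv.continuousOn (fun _ => hv.hasDerivWithinAt_Ici)
    (fun t ht => .inl ⟨t, Ico_subset_Icc_self ht, rfl⟩)
    hw.continuousOn (fun _ => hw.hasDerivWithinAt_Ici)
    (fun t ht => .inr ⟨t, Ico_subset_Icc_self ht, rfl⟩) h

theorem eqOn_left (hZ : LocallyLipschitz Z) (hv : IsSolOn Z v (Icc a b))
    (hw : IsSolOn Z w (Icc a b)) (h : v b = w b) : EqOn v w (Icc a b) := by
  obtain ⟨K, hK⟩ := exists_lipschitzOnWith hZ hv hw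
  exact ODE_solution_unique_of_mem_Icc_left (v := fun _ => Z)
    (s := fun _ => v '' Icc a b ∪ w '' Icc a b) (fun _ _ => hK)
    hv.continuousOn (fun _ => hv.hasDerivWithinAt_Iic)
    (fun t ht => .inl ⟨t, Ioc_subset_Icc_self ht, rfl⟩)
    hw.continuousOn (fun _ => hw.hasDerivWithinAt_Iic)
    (fun t ht => .inr ⟨t, Ioc_subset_Icc_self ht, rfl⟩) h

theorem eqOn_of_mem (hZ : LocallyLipschitz Z) (hv : IsSolOn Z v (Icc a b))
    (hw : IsSolOn Z w (Icc a b)) (hc : c ∈ Icc a b) (h : v c = w c) : EqOn v w (Icc a b) := by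
  intro t ht
  rcases le_total t c with htc | htc
  · exact eqOn_left hZ (hv.mono (Icc_subset_Icc_right hc.2))
      (hw.mono (Icc_subset_Icc_right hc.2)) h ⟨ht.1, htc⟩
  · exact eqOn_right hZ (hv.mono (Icc_subset_Icc_left hc.1))
      (hw.mono (Icc_subset_Icc_left hc.1)) h ⟨htc, ht.2⟩

theorem union_of_isClosed (h : IsSolOn Z v s) (h' : IsSolOn Z v s') (hs : IsClosed s)
    (hs' : IsClosed s') : IsSolOn Z v (s ∪ s') := by
  have hasDerivWithinAt_of_isClosed {s : Set ℝ} (hs : IsClosed s) (h : IsSolOn Z v s) (t : ℝ) :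
      HasDerivWithinAt v (Z (v t)) s t := by
    by_cases ht : t ∈ s
    · exact h t ht
    · exact HasFDerivWithinAt.of_notMem_closure (by rwa [hs.closure_eq])
  exact fun t _ =>
    (hasDerivWithinAt_of_isClosed hs h t).union (hasDerivWithinAt_of_isClosed hs' h' t)

theorem exists_concat (hT : 0 ≤ T) (hv : IsSolOn Z v (Icc 0 T)) (hs : IsClosed s)
    (hs0 : s ⊆ Ici 0) (hu : IsSolOn Z u s) (h : u 0 = v T) : ∃ w : ℝ → E, w 0 = v 0 ∧
      (∀ t, T ≤ t → w t = u (t - T)) ∧ IsSolOn Z w (Icc 0 T ∪ (fun t => t - T) ⁻¹' s) := by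
  set w : ℝ → E := fun t => if t ≤ T then v t else u (t - T)
  have hwv : ∀ t, t ≤ T → w t = v t := fun t ht => if_pos ht
  have hwu : ∀ t, T ≤ t → w t = u (t - T) := by
    intro t ht
    rcases ht.eq_or_lt with rfl | hlt
    · rw [hwv _ le_rfl, sub_self, h]
    · exact if_neg (not_le.2 hlt)
  refine ⟨w, hwv 0 hT, hwu, union_of_isClosed ?_ ?_ isClosed_Icc (hs.preimage (by fun_prop))⟩
  · intro t ht
    rw [hwv t ht.2]
    exact (hv t ht).congr (fun x hx => hwv x hx.2) (hwv t ht.2)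
  · have hT_le : ∀ t ∈ (fun t => t - T) ⁻¹' s, T ≤ t := fun t ht => by simpa using hs0 ht
    have hu' : IsSolOn Z (fun t => u (t + -T)) ((fun t => t - T) ⁻¹' s) :=
      hu.shift (-T) fun t ht => by simpa [sub_eq_add_neg] using ht
    intro t ht
    rw [hwu t (hT_le t ht)]
    exact (hu' t ht).congr (fun x hx => hwu x (hT_le x hx)) (hwu t (hT_le t ht))

theorem eventually_dist_lt_of_lipschitzWith {K : NNReal} (hK : LipschitzWith K Z)
    (hv : IsSolOn Z v (Icc 0 T)) {δ : ℝ} (hδ : 0 < δ) :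
    ∀ᶠ q in 𝓝 (v 0), ∀ w, w 0 = q → IsSolOn Z w (Icc 0 T) →
      ∀ t ∈ Icc 0 T, dist (w t) (v t) < δ := by
  filter_upwards [Metric.ball_mem_nhds (v 0)
    (show 0 < δ * (Real.exp (K * T))⁻¹ by positivity)] with q hq w hw0 hw t ht
  calc dist (w t) (v t) ≤ dist q (v 0) * Real.exp (K * (t - 0)) :=
        dist_le_of_trajectories_ODE (v := fun _ => Z) (fun _ => hK) hw.continuousOn
          (fun _ => hw.hasDerivWithinAt_Ici) hv.continuousOn (fun _ => hv.hasDerivWithinAt_Ici)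
          (by rw [hw0]) t ht
    _ ≤ dist q (v 0) * Real.exp (K * T) := by
        rw [sub_zero]
        gcongr
        exact ht.2
    _ < δ := by
        rwa [← lt_div_iff₀ (Real.exp_pos _), div_eq_mul_inv]

end IsSolOn

theorem isSolOn_of_hasDerivAt (h : ∀ t, HasDerivAt v (Z (v t)) t) (s : Set ℝ) : IsSolOn Z v s :=
  IsIntegralCurve.isIntegralCurveOn h s

theorem eq_of_hasDerivAt_of_locallyLipschitz (hZ : LocallyLipschitz Z)
    (hv : ∀ t, HasDerivAt v (Z (v t)) t) (hw : ∀ t, HasDerivAt w (Z (w t)) t) (h : v 0 = w 0) :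
    v = w := by
  funext t
  exact IsSolOn.eqOn_of_mem hZ (isSolOn_of_hasDerivAt hv (Icc (-|t|) |t|))
    (isSolOn_of_hasDerivAt hw _) ⟨by simp, by simp⟩ h ⟨neg_abs_le t, le_abs_self t⟩

theorem exists_solution_Icc [CompleteSpace E] {K C : NNReal} (hK : LipschitzWith K Z)
    (hC : ∀ q, ‖Z q‖ ≤ C) (q : E) (n : ℕ) :
    ∃ v : ℝ → E, v 0 = q ∧ IsSolOn Z v (Icc (-(n + 1 : ℝ)) (n + 1)) := by
  have h0 : (0 : ℝ) ∈ Icc (-(n + 1 : ℝ)) (n + 1) := by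
    constructor <;> linarith [(Nat.cast_nonneg n : (0 : ℝ) ≤ n)]
  have hZ : IsPicardLindelof (fun _ => Z) ⟨0, h0⟩ q (C * (n + 1)) 0 C K :=
    { lipschitzOnWith := fun t _ => hK.lipschitzOnWith
      continuousOn := fun x _ => continuousOn_const
      norm_le := fun t _ x _ => hC x
      mul_max_le := by simp }
  exact hZ.exists_eq_forall_mem_Icc_hasDerivWithinAt₀

theorem exists_global_solution [CompleteSpace E] {K C : NNReal} (hK : LipschitzWith K Z)
    (hC : ∀ q, ‖Z q‖ ≤ C) (q : E) : ∃ v : ℝ → E, v 0 = q ∧ ∀ t, HasDerivAt v (Z (v t)) t := by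
  choose v hv0 hv using exists_solution_Icc hK hC q
  have heq : ∀ n m : ℕ, n ≤ m → EqOn (v n) (v m) (Icc (-(n + 1 : ℝ)) (n + 1)) := by
    intro n m hnm
    refine IsSolOn.eqOn_of_mem hK.locallyLipschitz (hv n) ((hv m).mono ?_) (c := 0) ?_
      ((hv0 n).trans (hv0 m).symm)
    · gcongr
    · constructor <;> linarith [(Nat.cast_nonneg n : (0 : ℝ) ≤ n)]
  have hmem : ∀ s : ℝ, s ∈ Ioo (-((⌈|s|⌉₊ : ℝ) + 1)) (⌈|s|⌉₊ + 1) := fun s => by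
    rw [mem_Ioo, ← abs_lt]
    linarith [Nat.le_ceil |s|]
  refine ⟨fun t => v ⌈|t|⌉₊ t, by simp [hv0], fun t => ?_⟩
  have hd : HasDerivAt (v ⌈|t|⌉₊) (Z (v ⌈|t|⌉₊ t)) t :=
    (hv _ t (Ioo_subset_Icc_self (hmem t))).hasDerivAt (Icc_mem_nhds (hmem t).1 (hmem t).2)
  refine hd.congr_of_eventuallyEq ?_
  filter_upwards [isOpen_Ioo.mem_nhds (hmem t)] with s hs
  rcases le_total ⌈|t|⌉₊ ⌈|s|⌉₊ with h | h
  · exact (heq _ _ h (Ioo_subset_Icc_self hs)).symm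
  · exact heq _ _ h (Ioo_subset_Icc_self (hmem s))

theorem exists_lipschitzWith_eqOn_closedBall [ProperSpace E] (hZ : LocallyLipschitz Z) (R : ℝ) :
    ∃ (Z' : E → E) (K C : NNReal), LipschitzWith K Z' ∧ (∀ q, ‖Z' q‖ ≤ C) ∧
      EqOn Z' Z (Metric.closedBall 0 R) := by
  have hB : IsCompact (Metric.closedBall (0 : E) (R + 1)) := isCompact_closedBall 0 _
  obtain ⟨K, hK⟩ := hZ.locallyLipschitzOn.exists_lipschitzOnWith_of_compact hB
  obtain ⟨C, hC⟩ := hB.exists_bound_of_continuousOn hZ.continuous.continuousOn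
  replace hC : ∀ q ∈ Metric.closedBall (0 : E) (R + 1), ‖Z q‖ ≤ C.toNNReal :=
    fun q hq => (hC q hq).trans C.le_coe_toNNReal
  set χ : E → ℝ := fun q => max 0 (min 1 (R + 1 - ‖q‖))
  have hχ : LipschitzWith 1 χ := by
    have h := (((LipschitzWith.const (R + 1)).sub (lipschitzWith_one_norm (E := E))).const_min
      1).const_max 0
    simpa only [zero_add] using h
  have hχ_le : ∀ q, |χ q| ≤ 1 := fun q => by
    rw [abs_of_nonneg (le_max_left _ _)]
    exact max_le zero_le_one (min_le_left _ _)
  have hχ_zero : ∀ q ∉ Metric.closedBall (0 : E) (R + 1), χ q = 0 := fun q hq => by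
    rw [mem_closedBall_zero_iff, not_le] at hq
    exact max_eq_left ((min_le_right _ _).trans (by linarith))
  refine ⟨fun q => χ q • Z q, 1 * C.toNNReal + K, C.toNNReal,
    lipschitzWith_smul_of_eq_zero hχ hχ_le hχ_zero hK hC, fun q => ?_, fun q hq => ?_⟩
  · by_cases hq : q ∈ Metric.closedBall (0 : E) (R + 1)
    · rw [norm_smul]
      exact (mul_le_of_le_one_left (norm_nonneg _) (hχ_le q)).trans (hC q hq)
    · simp [hχ_zero q hq]
  · rw [mem_closedBall_zero_iff] at hq
    simp [χ, show 1 ≤ R + 1 - ‖q‖ by linarith]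

end AutonomousODE

section AutonomousODE

variable {E : Type*} [NormedAddCommGroup E] [NormedSpace ℝ E] {Z : E → E} {v : ℝ → E}
  {s : Set ℝ} {R T : ℝ}

theorem IsSolOn.eventually_exists_dist_lt [ProperSpace E] (hZ : LocallyLipschitz Z)
    (hv : IsSolOn Z v (Icc 0 T)) {δ : ℝ} (hδ : 0 < δ) :
    ∀ᶠ q in 𝓝 (v 0), ∃ w : ℝ → E, w 0 = q ∧ IsSolOn Z w (Icc 0 T) ∧
      ∀ t ∈ Icc 0 T, dist (w t) (v t) < δ := by
  obtain ⟨R, hR⟩ := (isCompact_Icc.image_of_continuousOn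
    hv.continuousOn).isBounded.subset_closedBall (0 : E)
  obtain ⟨Z', K, C, hK, hC, hZ'⟩ := exists_lipschitzWith_eqOn_closedBall hZ (R + δ)
  have hvR : ∀ t ∈ Icc 0 T, dist (v t) 0 ≤ R := fun t ht => hR (mem_image_of_mem v ht)
  have hv' : IsSolOn Z' v (Icc 0 T) :=
    hv.congr_field fun t ht => (hZ' ((hvR t ht).trans (by linarith))).symm
  filter_upwards [hv'.eventually_dist_lt_of_lipschitzWith hK hδ] with q hq
  obtain ⟨w, hw0, hw⟩ := exists_global_solution hK hC q
  have hwT := isSolOn_of_hasDerivAt hw (Icc 0 T)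
  have hdist := hq w hw0 hwT
  refine ⟨w, hw0, hwT.congr_field fun t ht => hZ' ?_, hdist⟩
  calc dist (w t) 0 ≤ dist (w t) (v t) + dist (v t) 0 := dist_triangle _ _ _
    _ ≤ R + δ := by linarith [hdist t ht, hvR t ht]

namespace IsCurveIn

theorem shift (h : IsCurveIn Z R v) (c : ℝ) : IsCurveIn Z R fun t => v (t + c) :=
  ⟨h.continuous.comp (by fun_prop), fun t ht => (h.hasDerivAt (t + c) ht).comp_add_const t c⟩

theorem isSolOn (h : IsCurveIn Z R v) (hs : MapsTo v s (Metric.closedBall 0 R)) :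
    IsSolOn Z v s :=
  fun t ht => (h.hasDerivAt t (hs ht)).hasDerivWithinAt

end IsCurveIn

theorem exists_isCurveIn [ProperSpace E] (hZ : LocallyLipschitz Z) (R : ℝ) (q : E) :
    ∃ v, v 0 = q ∧ IsCurveIn Z R v := by
  obtain ⟨Z', K, C, hK, hC, hZ'⟩ := exists_lipschitzWith_eqOn_closedBall hZ R
  obtain ⟨v, hv0, hv⟩ := exists_global_solution hK hC q
  exact ⟨v, hv0, continuous_iff_continuousAt.2 fun t => (hv t).continuousAt,
    fun t ht => hZ' ht ▸ hv t⟩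

end AutonomousODE

section RealTime

theorem exists_exit_time {α : Type*} [TopologicalSpace α] {v : ℝ → α} (hv : Continuous v)
    {S : Set α} (hS : IsClosed S) (h0 : v 0 ∈ S) (hex : ∃ t, 0 ≤ t ∧ v t ∉ S) :
    ∃ T, 0 ≤ T ∧ (∀ t ∈ Icc 0 T, v t ∈ S) ∧ ∃ᶠ t in 𝓝[>] T, v t ∉ S := by
  set N := {t | 0 ≤ t ∧ v t ∉ S}
  have hN : BddBelow N := ⟨0, fun t ht => ht.1⟩
  have hT : 0 ≤ sInf N := le_csInf hex fun t ht => ht.1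
  have hlt : ∀ t ∈ Ico 0 (sInf N), v t ∈ S := fun t ht => by
    by_contra htS
    exact (csInf_le hN ⟨ht.1, htS⟩).not_gt ht.2
  have hmem : ∀ t ∈ Icc 0 (sInf N), v t ∈ S := by
    rcases hT.eq_or_lt with hT0 | hT0
    · simpa [← hT0] using h0
    · rw [← closure_Ico hT0.ne]
      exact closure_minimal hlt (hS.preimage hv)
  refine ⟨sInf N, hT, hmem, (nhdsGT_basis _).frequently_iff.2 fun u hu => ?_⟩
  obtain ⟨t, ht, htu⟩ := exists_lt_of_csInf_lt hex hu
  refine ⟨t, ⟨(csInf_le hN ht).lt_of_ne fun h => ht.2 ?_, htu⟩, ht.2⟩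
  exact h ▸ hmem _ (right_mem_Icc.2 hT)

theorem mem_closedBall_of_norm_deriv_le {E : Type*} [NormedAddCommGroup E] [NormedSpace ℝ E]
    {v v' : ℝ → E} {ρ C T : ℝ} (hC : 0 ≤ C) (hρ : 0 ≤ ρ) (hv : Continuous v)
    (hd : ∀ t, v t ∈ Metric.closedBall (v 0) ρ → HasDerivAt v (v' t) t ∧ ‖v' t‖ ≤ C)
    (hCT : C * T < ρ) : ∀ t ∈ Icc 0 T, v t ∈ Metric.closedBall (v 0) ρ := by
  by_contra! hcon
  obtain ⟨t₁, ht₁, hex⟩ := hcon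
  obtain ⟨T', hT'0, hT', hexit⟩ := exists_exit_time hv Metric.isClosed_closedBall
    (Metric.mem_closedBall_self hρ) ⟨t₁, ht₁.1, hex⟩
  have hlt : T' < t₁ := lt_of_not_ge fun hle => hex (hT' t₁ ⟨ht₁.1, hle⟩)
  have hmem : v T' ∈ Metric.ball (v 0) ρ := by
    rw [mem_ball_iff_norm]
    calc ‖v T' - v 0‖ ≤ C * (T' - 0) :=
          norm_image_sub_le_of_norm_deriv_le_segment'
            (fun t ht => (hd t (hT' t ht)).1.hasDerivWithinAt)
            (fun t ht => (hd t (hT' t (Ico_subset_Icc_self ht))).2) T' (right_mem_Icc.2 hT'0)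
      _ ≤ C * T := mul_le_mul_of_nonneg_left (by linarith [ht₁.2]) hC
      _ < ρ := hCT
  refine hexit (mem_nhdsWithin_of_mem_nhds ?_)
  filter_upwards [hv.continuousAt (Metric.isOpen_ball.mem_nhds hmem)] with t ht
  exact not_not.2 (Metric.ball_subset_closedBall ht)

theorem not_bddAbove_image_Ici_of_le_deriv {f f' : ℝ → ℝ} {c : ℝ} (hc : 0 < c)
    (hf : ∀ t, 0 ≤ t → HasDerivAt f (f' t) t) (hf' : ∀ t, 0 ≤ t → c ≤ f' t) :
    ¬ BddAbove (f '' Ici 0) := by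
  rintro ⟨B, hB⟩
  have hgrowth : ∀ t, 0 ≤ t → c * (t - 0) ≤ f t - f 0 := fun t ht =>
    (convex_Ici 0).mul_sub_le_image_sub_of_le_deriv
      (fun t ht => (hf t ht).continuousAt.continuousWithinAt)
      (fun t ht => (hf t (interior_subset ht)).differentiableAt.differentiableWithinAt)
      (fun t ht => (hf t (interior_subset ht)).deriv ▸ hf' t (interior_subset ht))
      0 self_mem_Ici t ht ht
  have ht : 0 ≤ (|B - f 0| + 1) / c := by positivity
  have hle := hgrowth _ ht
  rw [sub_zero, mul_div_cancel₀ _ hc.ne'] at hle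
  linarith [le_abs_self (B - f 0), hB (mem_image_of_mem f ht)]

theorem nonneg_of_deriv_ge_neg_mul_abs {d d' : ℝ → ℝ} {a b K : ℝ} (hd : ContinuousOn d (Icc a b))
    (hd' : ∀ x ∈ Ico a b, HasDerivWithinAt d (d' x) (Ici x) x) (ha : 0 ≤ d a)
    (hK : ∀ x ∈ Ico a b, -(K * |d x|) ≤ d' x) : ∀ x ∈ Icc a b, 0 ≤ d x := by
  intro x hx
  have hexp : ∀ η > 0, -d x ≤ η * Real.exp ((|K| + 1) * (x - a)) := by
    intro η hη
    refine image_le_of_deriv_right_lt_deriv_boundary' (f := fun x => -d x) (f' := fun x => -d' x)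
      (B := fun x => η * Real.exp ((|K| + 1) * (x - a)))
      (B' := fun x => η * (Real.exp ((|K| + 1) * (x - a)) * (|K| + 1)))
      hd.neg (fun x hx => (hd' x hx).neg) (by simp; linarith) (by fun_prop) ?_ ?_ hx
    · intro y _
      have hlin : HasDerivAt (fun x : ℝ => (|K| + 1) * (x - a)) (|K| + 1) y := by
        simpa using ((hasDerivAt_id y).sub_const a).const_mul (|K| + 1)
      exact (hlin.exp.const_mul η).hasDerivWithinAt
    · intro y hy he
      have hpos : 0 < η * Real.exp ((|K| + 1) * (y - a)) := by positivity
      have habs : |d y| = η * Real.exp ((|K| + 1) * (y - a)) := by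
        rw [← he, abs_of_neg (by linarith)]
      have := hK y hy
      rw [habs] at this
      nlinarith [le_abs_self K]
  refine neg_nonpos.1 (le_of_forall_pos_le_add fun e he => ?_)
  have := hexp (e / Real.exp ((|K| + 1) * (x - a))) (by positivity)
  rwa [div_mul_cancel₀ _ (Real.exp_ne_zero _), ← zero_add e] at this

theorem eventually_lt_of_hasDerivWithinAt_neg {f : ℝ → ℝ} {f' t₀ : ℝ}
    (h : HasDerivWithinAt f f' (Ioi t₀) t₀) (hf : f' < 0) : ∀ᶠ t in 𝓝[>] t₀, f t < f t₀ := by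
  have hslope := (hasDerivWithinAt_iff_tendsto_slope' self_notMem_Ioi).1 h
  filter_upwards [hslope.eventually_lt_const hf, self_mem_nhdsWithin] with t ht htt
  rw [slope_def_field, div_lt_iff₀ (sub_pos.2 htt), zero_mul] at ht
  exact sub_neg.1 ht

theorem eventually_gt_of_hasDerivWithinAt_pos {f : ℝ → ℝ} {f' t₀ : ℝ}
    (h : HasDerivWithinAt f f' (Ioi t₀) t₀) (hf : 0 < f') : ∀ᶠ t in 𝓝[>] t₀, f t₀ < f t := by
  filter_upwards [eventually_lt_of_hasDerivWithinAt_neg h.neg (neg_lt_zero.2 hf)] with t ht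
  exact neg_lt_neg_iff.1 ht

end RealTime

theorem exists_strip_subset {a b : ℝ} {O : Set (ℝ × ℝ)} (hO : IsOpen O) (hab : a ≤ b)
    (h : ∀ x ∈ Icc a b, (x, (0 : ℝ)) ∈ O) :
    ∃ η > 0, Icc (a - η) (b + η) ×ˢ Icc (-η) η ⊆ O := by
  have hcompact : IsCompact (Icc a b ×ˢ ({0} : Set ℝ)) := isCompact_Icc.prod isCompact_singleton
  obtain ⟨η, hη, hsub⟩ := hcompact.exists_cthickening_subset_open hO <| by
    rintro ⟨x, y⟩ ⟨hx, rfl⟩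
    exact h x hx
  refine ⟨η, hη, fun q hq => hsub ?_⟩
  refine Metric.mem_cthickening_of_dist_le q (max a (min q.1 b), 0) η _
    ⟨⟨le_max_left _ _, max_le hab (min_le_right _ _)⟩, rfl⟩ ?_
  rw [Prod.dist_eq, max_le_iff, Real.dist_eq, Real.dist_eq, sub_zero]
  refine ⟨?_, abs_le.2 hq.2⟩
  have := hq.1.1
  have := hq.1.2
  rw [abs_le]
  constructor <;> grind

section Reachability

variable {Z : ℝ × ℝ → ℝ × ℝ} {q : ℝ × ℝ} {B B' Γ : Set (ℝ × ℝ)}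

/-- Some forward orbit segment of `Z` leads from `q` to `B`: the forward orbits near the
regularized switching line are followed from one section to the next through this relation. -/
def Reaches (Z : ℝ × ℝ → ℝ × ℝ) (q : ℝ × ℝ) (B : Set (ℝ × ℝ)) : Prop :=
  ∃ (T : ℝ) (v : ℝ → ℝ × ℝ), 0 ≤ T ∧ v 0 = q ∧ IsSolOn Z v (Icc 0 T) ∧ v T ∈ B

namespace Reaches

theorem of_mem (h : q ∈ B) : Reaches Z q B := by
  refine ⟨0, fun _ => q, le_rfl, rfl, fun t _ => ?_, h⟩
  rw [Icc_self]
  exact HasFDerivWithinAt.of_finite (finite_singleton _)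

theorem trans (h : Reaches Z q B) (h' : ∀ w ∈ B, Reaches Z w B') : Reaches Z q B' := by
  obtain ⟨T, v, hT, hv0, hv, hvT⟩ := h
  obtain ⟨T', u, hT', hu0, hu, huT⟩ := h' _ hvT
  obtain ⟨w, hw0, hwT, hw⟩ := hv.exists_concat hT isClosed_Icc (fun t ht => ht.1) hu hu0
  refine ⟨T + T', w, by linarith, hw0.trans hv0, hw.mono fun t ht => ?_, ?_⟩
  · rcases le_total t T with hle | hle
    · exact .inl ⟨ht.1, hle⟩
    · exact .inr ⟨by linarith, by linarith [ht.2]⟩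
  · rwa [hwT _ (by linarith), add_sub_cancel_left]

theorem isAttracted (h : Reaches Z q B) (h' : ∀ w ∈ B, IsAttracted Z w Γ) :
    IsAttracted Z q Γ := by
  obtain ⟨T, v, hT, hv0, hv, hvT⟩ := h
  obtain ⟨u, hu0, hu, hlim⟩ := h' _ hvT
  obtain ⟨w, hw0, hwT, hw⟩ := hv.exists_concat hT isClosed_Ici subset_rfl hu hu0
  refine ⟨w, hw0.trans hv0, hw.mono fun t ht => ?_, ?_⟩
  · rcases le_total t T with hle | hle
    · exact .inl ⟨ht, hle⟩
    · exact .inr (by simpa using hle)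
  · refine (hlim.comp (tendsto_atTop_add_const_right _ (-T) tendsto_id)).congr' ?_
    filter_upwards [eventually_ge_atTop T] with t ht
    simp [hwT t ht, sub_eq_add_neg]

end Reaches

end Reachability

/-! ### Nested families of closed curves -/

section NestedFoliation

variable {E : Type*} [NormedAddCommGroup E]

/-- The part of the complement of `Γ` that is enclosed by `Γ` together with the point `p`: the
component of `p`.  It is empty if `p ∈ Γ`. -/
abbrev inside (p : E) (Γ : Set E) : Set E := connectedComponentIn Γᶜ p

/-- `Γ` together with its inside: the closed disc bounded by `Γ` when `Γ` is a closed curve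
around `p`. -/
abbrev hull (p : E) (Γ : Set E) : Set E := inside p Γ ∪ Γ

theorem mem_hull (p : E) (Γ : Set E) : p ∈ hull p Γ :=
  or_iff_not_imp_right.2 fun hp => mem_connectedComponentIn hp

/-- `A` is partitioned into `{p}` and compact connected leaves `O q`, the leaf of `q`, around `p`.
For the periodic orbits around a center `p` the leaf `O p` is the point `p` itself. -/
structure IsNestedFoliation (p : E) (A : Set E) (O : E → Set E) : Prop where
  center_mem : p ∈ A
  leaf_center : O p = {p}
  self_mem : ∀ q ∈ A, q ∈ O q
  isCompact : ∀ q ∈ A, IsCompact (O q)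
  isPreconnected : ∀ q ∈ A, IsPreconnected (O q)
  subset : ∀ q ∈ A, O q ⊆ A
  eq_of_mem : ∀ q ∈ A, ∀ w ∈ O q, O w = O q
  isBounded_inside : ∀ q ∈ A, Bornology.IsBounded (inside p (O q))
  inside_subset : ∀ q ∈ A, inside p (O q) ⊆ A

theorem not_isClosed_of_isOpen_of_isBounded [NormedSpace ℝ E] [Nontrivial E] {U : Set E}
    (ho : IsOpen U) (hne : U.Nonempty) (hb : Bornology.IsBounded U) : ¬ IsClosed U := fun hc =>
  NormedSpace.unbounded_univ ℝ E ((isClopen_iff.1 ⟨hc, ho⟩).resolve_left hne.ne_empty ▸ hb)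

namespace IsNestedFoliation

variable {p q w z : E} {A : Set E} {O : E → Set E}

theorem center_notMem (h : IsNestedFoliation p A O) (hq : q ∈ A) (hqp : q ≠ p) : p ∉ O q :=
  fun hp => hqp <| by
    simpa only [← h.eq_of_mem q hq p hp, h.leaf_center, mem_singleton_iff] using h.self_mem q hq

theorem center_mem_inside (h : IsNestedFoliation p A O) (hq : q ∈ A) (hqp : q ≠ p) :
    p ∈ inside p (O q) :=
  mem_connectedComponentIn (h.center_notMem hq hqp)

theorem hull_subset (h : IsNestedFoliation p A O) (hq : q ∈ A) : hull p (O q) ⊆ A :=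
  union_subset (h.inside_subset q hq) (h.subset q hq)

theorem leaf_eq_of_mem_of_mem (h : IsNestedFoliation p A O) (hq : q ∈ A) (hw : w ∈ A)
    (hzq : z ∈ O q) (hzw : z ∈ O w) : O w = O q :=
  (h.eq_of_mem w hw z hzw).symm.trans (h.eq_of_mem q hq z hzq)

theorem leaf_subset_inside (h : IsNestedFoliation p A O) (hq : q ∈ A) (hw : w ∈ A)
    (hzw : z ∈ O w) (hzq : z ∈ inside p (O q)) : O w ⊆ inside p (O q) := by
  have hdisj : O w ⊆ (O q)ᶜ := fun x hxw hxq =>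
    connectedComponentIn_subset _ _ hzq (h.leaf_eq_of_mem_of_mem hq hw hxq hxw ▸ hzw)
  rw [inside, connectedComponentIn_eq hzq]
  exact (h.isPreconnected w hw).subset_connectedComponentIn hzw hdisj

theorem leaf_subset_inside_of_mem (h : IsNestedFoliation p A O) (hq : q ∈ A)
    (hw : w ∈ inside p (O q)) : O w ⊆ inside p (O q) :=
  have hwA := h.inside_subset q hq hw
  h.leaf_subset_inside hq hwA (h.self_mem w hwA) hw

theorem leaf_subset_hull (h : IsNestedFoliation p A O) (hq : q ∈ A) (hw : w ∈ hull p (O q)) :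
    O w ⊆ hull p (O q) := by
  rcases hw with hw | hw
  · exact (h.leaf_subset_inside_of_mem hq hw).trans subset_union_left
  · exact h.eq_of_mem q hq w hw ▸ subset_union_right

theorem inside_subset_inside (h : IsNestedFoliation p A O) (hq : q ∈ A) (hw : w ∈ A)
    (hqw : ¬ O q ⊆ inside p (O w)) : inside p (O w) ⊆ inside p (O q) := by
  by_cases hp : p ∈ (O w)ᶜ
  · exact isPreconnected_connectedComponentIn.subset_connectedComponentIn
      (mem_connectedComponentIn hp) fun x hxw hxq => hqw (h.leaf_subset_inside hw hq hxq hxw)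
  · rw [inside, connectedComponentIn_eq_empty hp]
    exact empty_subset _

variable [NormedSpace ℝ E]

theorem isOpen_inside (h : IsNestedFoliation p A O) (hq : q ∈ A) : IsOpen (inside p (O q)) :=
  (h.isCompact q hq).isClosed.isOpen_compl.connectedComponentIn

theorem closure_inside_subset (h : IsNestedFoliation p A O) (hq : q ∈ A) :
    closure (inside p (O q)) ⊆ hull p (O q) := by
  intro z hz
  by_contra! hcon
  rw [mem_union, not_or] at hcon
  have hmem : z ∈ connectedComponentIn (O q)ᶜ z := mem_connectedComponentIn hcon.2
  obtain ⟨x, hxz, hxp⟩ := mem_closure_iff.1 hz _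
    (h.isCompact q hq).isClosed.isOpen_compl.connectedComponentIn hmem
  rw [connectedComponentIn_eq hxz, ← connectedComponentIn_eq hxp] at hmem
  exact hcon.1 hmem

theorem isCompact_hull [ProperSpace E] (h : IsNestedFoliation p A O) (hq : q ∈ A) :
    IsCompact (hull p (O q)) := by
  refine Metric.isCompact_of_isClosed_isBounded (isClosed_of_closure_subset ?_)
    ((h.isBounded_inside q hq).union (h.isCompact q hq).isBounded)
  rw [closure_union, (h.isCompact q hq).isClosed.closure_eq]
  exact union_subset (h.closure_inside_subset hq) subset_union_right

variable [Nontrivial E]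

theorem isPreconnected_hull (h : IsNestedFoliation p A O) (hq : q ∈ A) :
    IsPreconnected (hull p (O q)) := by
  rcases (inside p (O q)).eq_empty_or_nonempty with hempty | hne
  · rw [hull, hempty, empty_union]
    exact h.isPreconnected q hq
  obtain ⟨z, hz, hzn⟩ := not_subset.1 fun hsub => not_isClosed_of_isOpen_of_isBounded
    (h.isOpen_inside hq) hne (h.isBounded_inside q hq) (isClosed_of_closure_subset hsub)
  have hzO : z ∈ O q := (h.closure_inside_subset hq hz).resolve_left hzn
  have hhull : hull p (O q) = closure (inside p (O q)) ∪ O q :=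
    (union_subset_union_left _ subset_closure).antisymm
      (union_subset (h.closure_inside_subset hq) subset_union_right)
  rw [hhull]
  exact isPreconnected_connectedComponentIn.closure.union z hz hzO (h.isPreconnected q hq)

theorem leaf_subset_inside_or (h : IsNestedFoliation p A O) (hq : q ∈ A) (hw : w ∈ A)
    (hne : O w ≠ O q) : O w ⊆ inside p (O q) ∨ O q ⊆ inside p (O w) := by
  by_cases hqp : q = p
  · subst hqp
    rw [h.leaf_center, singleton_subset_iff]
    exact .inr (h.center_mem_inside hw fun e => hne (e ▸ rfl))
  by_cases hwp : w = p
  · subst hwp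
    rw [h.leaf_center, singleton_subset_iff]
    exact .inl (h.center_mem_inside hq hqp)
  by_contra! hcon
  have heq : inside p (O q) = inside p (O w) :=
    (h.inside_subset_inside hw hq hcon.1).antisymm (h.inside_subset_inside hq hw hcon.2)
  refine not_isClosed_of_isOpen_of_isBounded (h.isOpen_inside hq)
    ⟨p, h.center_mem_inside hq hqp⟩ (h.isBounded_inside q hq)
    (isClosed_of_closure_subset fun x hx => ?_)
  rcases h.closure_inside_subset hq hx with hxq | hxq
  · exact hxq
  rcases h.closure_inside_subset hw (heq ▸ hx) with hxw | hxw
  · exact heq ▸ hxw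
  · exact absurd (h.leaf_eq_of_mem_of_mem hq hw hxq hxw) hne

theorem not_leaf_subset_inside (h : IsNestedFoliation p A O) (hq : q ∈ A) (hw : w ∈ A)
    (hwq : O w ⊆ inside p (O q)) : ¬ O q ⊆ inside p (O w) := by
  intro hqw
  refine not_isClosed_of_isOpen_of_isBounded ((h.isOpen_inside hq).union (h.isOpen_inside hw))
    ⟨w, .inl (hwq (h.self_mem w hw))⟩ ((h.isBounded_inside q hq).union (h.isBounded_inside w hw))
    (isClosed_of_closure_subset ?_)
  rw [closure_union]
  refine union_subset ((h.closure_inside_subset hq).trans (union_subset subset_union_left ?_))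
    ((h.closure_inside_subset hw).trans (union_subset subset_union_right ?_))
  · exact hqw.trans subset_union_right
  · exact hwq.trans subset_union_left

theorem hull_subset_inside (h : IsNestedFoliation p A O) (hq : q ∈ A) (hw : w ∈ A)
    (hwq : O w ⊆ inside p (O q)) : hull p (O w) ⊆ inside p (O q) :=
  union_subset (h.inside_subset_inside hq hw (h.not_leaf_subset_inside hq hw hwq)) hwq

theorem exists_leaf_between [ProperSpace E] (h : IsNestedFoliation p A O) (hq : q ∈ A) (hw : w ∈ A)
    (hwq : O w ⊆ inside p (O q)) : ∃ u ∈ inside p (O q), O w ⊆ inside p (O u) := by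
  have hproper : ¬ inside p (O q) ⊆ hull p (O w) := fun hsub =>
    not_isClosed_of_isOpen_of_isBounded (h.isOpen_inside hq) ⟨w, hwq (h.self_mem w hw)⟩
      (h.isBounded_inside q hq)
      (hsub.antisymm (h.hull_subset_inside hq hw hwq) ▸ (h.isCompact_hull hw).isClosed)
  obtain ⟨u, hu, hun⟩ := not_subset.1 hproper
  have huA := h.inside_subset q hq hu
  refine ⟨u, hu, (h.leaf_subset_inside_or huA hw fun e => ?_).resolve_right fun hs => ?_⟩
  · exact hun (.inr (e ▸ h.self_mem u huA))
  · exact hun (.inl (hs (h.self_mem u huA)))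

theorem exists_leaf_separating [ProperSpace E] (h : IsNestedFoliation p A O) (hq : q ∈ A)
    (hw : w ∈ A) (hwq : O w ⊆ inside p (O q)) :
    ∃ u ∈ A, w ∈ inside p (O u) ∧ q ∉ hull p (O u) := by
  obtain ⟨u, hu, hwu⟩ := h.exists_leaf_between hq hw hwq
  have huA := h.inside_subset q hq hu
  refine ⟨u, huA, hwu (h.self_mem w hw), fun hqu => ?_⟩
  have hqq := h.hull_subset_inside hq huA (h.leaf_subset_inside_of_mem hq hu) hqu
  exact connectedComponentIn_subset _ _ hqq (h.self_mem q hq)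

theorem exists_nhds_notMem_leaf [ProperSpace E] (h : IsNestedFoliation p A O) (hq : q ∈ A)
    (hw : w ∈ A) (hwq : w ∉ O q) :
    ∃ U ∈ 𝓝 q, ∃ V ∈ 𝓝 w, ∀ z ∈ U, z ∈ A → ∀ x ∈ V, x ∉ O z := by
  rcases h.leaf_subset_inside_or hq hw fun e => hwq (e ▸ h.self_mem w hw) with hs | hs
  · obtain ⟨u, huA, hwu, hqu⟩ := h.exists_leaf_separating hq hw hs
    refine ⟨(hull p (O u))ᶜ, (h.isCompact_hull huA).isClosed.isOpen_compl.mem_nhds hqu,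
      inside p (O u), (h.isOpen_inside huA).mem_nhds hwu, fun z hz hzA x hx hxz => ?_⟩
    exact hz (.inl (h.leaf_subset_inside huA hzA hxz hx (h.self_mem z hzA)))
  · obtain ⟨u, huA, hqu, hwu⟩ := h.exists_leaf_separating hw hq hs
    refine ⟨inside p (O u), (h.isOpen_inside huA).mem_nhds hqu,
      (hull p (O u))ᶜ, (h.isCompact_hull huA).isClosed.isOpen_compl.mem_nhds hwu,
      fun z hz _ x hx hxz => ?_⟩
    exact hx (.inl (h.leaf_subset_inside_of_mem huA hz hxz))

end IsNestedFoliation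

end NestedFoliation

/-! ### The height of the orbits around a center -/

/-- The orbit through `q` of the complete flow lines of `X`, i.e. of the solutions defined for all
times. -/
def orbit {E : Type*} [NormedAddCommGroup E] [NormedSpace ℝ E] (X : E → E) (q : E) : Set E :=
  {w | ∃ γ : ℝ → E, (∀ t, HasDerivAt γ (X (γ t)) t) ∧ q ∈ range γ ∧ w ∈ range γ}

section Orbit

variable {E : Type*} [NormedAddCommGroup E] [NormedSpace ℝ E] {X : E → E} {γ : ℝ → E} {q : E}

theorem orbit_eq_range (hX : LocallyLipschitz X) (hγ : ∀ t, HasDerivAt γ (X (γ t)) t)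
    (hq : q ∈ range γ) : orbit X q = range γ := by
  refine Subset.antisymm ?_ fun w hw => ⟨γ, hγ, hq, hw⟩
  rintro _ ⟨η, hη, ⟨b, hb⟩, t, rfl⟩
  obtain ⟨a, rfl⟩ := hq
  have heq := eq_of_hasDerivAt_of_locallyLipschitz hX (fun s => (hη (s + b)).comp_add_const s b)
    (fun s => (hγ (s + a)).comp_add_const s a) (by simpa only [zero_add] using hb)
  exact ⟨t - b + a, by simpa only [sub_add_cancel] using (congrFun heq (t - b)).symm⟩

theorem orbit_eq_singleton (hX : LocallyLipschitz X) (hq : X q = 0) : orbit X q = {q} := by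
  rw [orbit_eq_range hX (γ := fun _ => q) (fun t => hq ▸ hasDerivAt_const t q) ⟨0, rfl⟩,
    range_const]

theorem exists_rescaled_solution [CompleteSpace E] (hX : LocallyLipschitz X)
    (hγ : ∀ t, HasDerivAt γ (X (γ t)) t) (hc : IsCompact (range γ)) {l : E → ℝ}
    (hl : LocallyLipschitz l) :
    ∃ c : ℝ → E, c 0 = γ 0 ∧ range c ⊆ range γ ∧ ∀ t, HasDerivAt c (l (c t) • X (c t)) t := by
  obtain ⟨K, hK⟩ := (hl.locallyLipschitzOn (s := range γ)).exists_lipschitzOnWith_of_compact hc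
  obtain ⟨B, hB⟩ := hc.exists_bound_of_continuousOn hl.continuous.continuousOn
  obtain ⟨D, hD⟩ := hc.exists_bound_of_continuousOn hX.continuous.continuousOn
  have hγ_lip : LipschitzWith D.toNNReal γ := by
    refine lipschitzWith_of_nnnorm_deriv_le (fun t => (hγ t).differentiableAt) fun t => ?_
    rw [(hγ t).deriv, ← NNReal.coe_le_coe, coe_nnnorm]
    exact (hD _ ⟨t, rfl⟩).trans (Real.le_coe_toNNReal D)
  have hl_lip : LipschitzWith (K * D.toNNReal) (l ∘ γ) :=
    lipschitzOnWith_univ.1 (hK.comp hγ_lip.lipschitzOnWith fun t _ => ⟨t, rfl⟩)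
  obtain ⟨τ, hτ0, hτ⟩ := exists_global_solution (C := B.toNNReal) hl_lip
    (fun t => (hB _ ⟨t, rfl⟩).trans (Real.le_coe_toNNReal B)) 0
  exact ⟨γ ∘ τ, by rw [Function.comp_apply, hτ0], range_comp_subset_range _ _,
    fun t => (hγ (τ t)).scomp t (hτ t)⟩

end Orbit

namespace IsPeriodicSol

variable {X : ℝ × ℝ → ℝ × ℝ} {γ : ℝ → ℝ × ℝ}

theorem continuous (h : IsPeriodicSol X γ) : Continuous γ :=
  continuous_iff_continuousAt.2 fun t => (h.1 t).continuousAt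

theorem range_shift (γ : ℝ → ℝ × ℝ) (c : ℝ) : range (fun t => γ (t + c)) = range γ :=
  (Equiv.addRight c).surjective.range_comp γ

theorem shift (h : IsPeriodicSol X γ) (c : ℝ) : IsPeriodicSol X fun t => γ (t + c) := by
  obtain ⟨hγ, ⟨T, hT, hper⟩, t, ht⟩ := h
  refine ⟨fun t => (hγ (t + c)).comp_add_const t c, ⟨T, hT, hper.add_const c⟩, ?_⟩
  by_contra! hconst
  have hzero : ∀ s, γ s = γ (0 + c) := fun s => by
    simpa only [sub_add_cancel] using hconst (s - c)
  exact ht ((hzero t).trans (hzero 0).symm)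

theorem image_Ici (h : IsPeriodicSol X γ) : γ '' Ici 0 = range γ := by
  obtain ⟨T, hT, hper⟩ := h.2.1
  refine (image_subset_range _ _).antisymm ?_
  rw [← hper.image_Ioc hT 0]
  exact image_mono fun t ht => ht.1.le

end IsPeriodicSol

/-- The least height `y` on the orbit of `q`. -/
noncomputable def height (X : ℝ × ℝ → ℝ × ℝ) (q : ℝ × ℝ) : ℝ := sInf (Prod.snd '' orbit X q)

namespace IsCenter

variable {X : ℝ × ℝ → ℝ × ℝ} {p q w : ℝ × ℝ} {A : Set (ℝ × ℝ)} {x m : ℝ}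

theorem exists_periodic (h : IsCenter X p A) (hX : LocallyLipschitz X) (hq : q ∈ A) (hqp : q ≠ p) :
    ∃ γ, IsPeriodicSol X γ ∧ γ 0 = q ∧ orbit X q = range γ ∧ range γ ⊆ A ∧
      p ∈ curveInterior (range γ) ∧ curveInterior (range γ) ⊆ A := by
  obtain ⟨γ, hγ, ⟨t, rfl⟩, hA⟩ := h.periodic q hq hqp
  exact ⟨fun s => γ (s + t), hγ.shift t, congrArg γ (zero_add t),
    (orbit_eq_range hX hγ.1 ⟨t, rfl⟩).trans (IsPeriodicSol.range_shift γ t).symm,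
    by rwa [IsPeriodicSol.range_shift]⟩

theorem exists_solution (h : IsCenter X p A) (hX : LocallyLipschitz X) (hq : q ∈ A) :
    ∃ γ : ℝ → ℝ × ℝ, γ 0 = q ∧ (∀ t, HasDerivAt γ (X (γ t)) t) ∧ orbit X q = γ '' Ici 0 := by
  by_cases hqp : q = p
  · subst hqp
    refine ⟨fun _ => q, rfl, fun t => h.equilibrium ▸ hasDerivAt_const t q, ?_⟩
    rw [orbit_eq_singleton hX h.equilibrium, nonempty_Ici.image_const]
  · obtain ⟨γ, hγ, h0, horb, -⟩ := h.exists_periodic hX hq hqp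
    exact ⟨γ, h0, hγ.1, horb.trans hγ.image_Ici.symm⟩

theorem isNestedFoliation (h : IsCenter X p A) (hX : LocallyLipschitz X) :
    IsNestedFoliation p A (orbit X) := by
  have hp := orbit_eq_singleton hX h.equilibrium
  have hinside : inside p (orbit X p) = ∅ :=
    connectedComponentIn_eq_empty fun hpc => hpc (hp.symm.subset rfl)
  refine ⟨h.mem, hp, fun q hq => ?_, fun q hq => ?_, fun q hq => ?_, fun q hq => ?_,
    fun q _ w hw => ?_, fun q hq => ?_, fun q hq => ?_⟩
  · obtain ⟨γ, h0, hγ, -⟩ := h.exists_solution hX hq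
    exact ⟨γ, hγ, ⟨0, h0⟩, ⟨0, h0⟩⟩
  · by_cases hqp : q = p
    · exact hqp ▸ hp ▸ isCompact_singleton
    obtain ⟨γ, hγ, -, horb, -⟩ := h.exists_periodic hX hq hqp
    obtain ⟨T, hT, hper⟩ := hγ.2.1
    exact horb ▸ hper.compact_of_continuous hT.ne' hγ.continuous
  · obtain ⟨γ, -, hγ, horb⟩ := h.exists_solution hX hq
    exact horb ▸ isPreconnected_Ici.image γ fun t _ => (hγ t).continuousAt.continuousWithinAt
  · by_cases hqp : q = p
    · exact hqp ▸ hp ▸ singleton_subset_iff.2 h.mem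
    obtain ⟨γ, -, -, horb, hA, -⟩ := h.exists_periodic hX hq hqp
    exact horb ▸ hA
  · obtain ⟨γ, hγ, hqγ, hwγ⟩ := hw
    rw [orbit_eq_range hX hγ hqγ, orbit_eq_range hX hγ hwγ]
  · by_cases hqp : q = p
    · exact hqp.symm ▸ hinside.symm ▸ Bornology.isBounded_empty
    obtain ⟨γ, -, -, horb, -, hpγ, -⟩ := h.exists_periodic hX hq hqp
    exact horb ▸ hpγ.2
  · by_cases hqp : q = p
    · exact hqp.symm ▸ hinside.symm ▸ empty_subset A
    obtain ⟨γ, -, -, horb, -, hpγ, hint⟩ := h.exists_periodic hX hq hqp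
    rw [horb]
    exact fun z hz => hint ⟨connectedComponentIn_subset _ _ hz, connectedComponentIn_eq hz ▸ hpγ.2⟩

theorem mem_orbit_of_isSolOn (h : IsCenter X p A) (hX : LocallyLipschitz X) {v : ℝ → ℝ × ℝ}
    {a b t : ℝ} (hv : IsSolOn X v (Icc a b)) (hA : v a ∈ A) (ht : t ∈ Icc a b) :
    v t ∈ orbit X (v a) := by
  obtain ⟨γ, h0, hγ, -⟩ := h.exists_solution hX hA
  have hshift : ∀ s, HasDerivAt (fun s => γ (s - a)) (X (γ (s - a))) s :=
    fun s => (hγ (s - a)).comp_sub_const s a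
  have hvγ := IsSolOn.eqOn_right hX hv (isSolOn_of_hasDerivAt hshift _) (by simp [h0]) ht
  exact ⟨γ, hγ, ⟨0, h0⟩, ⟨t - a, hvγ.symm⟩⟩

theorem exists_height_eq (h : IsCenter X p A) (hX : LocallyLipschitz X) (hq : q ∈ A) :
    ∃ w ∈ orbit X q, w.2 = height X q :=
  (((h.isNestedFoliation hX).isCompact q hq).image continuous_snd).sInf_mem
    ⟨_, mem_image_of_mem _ ((h.isNestedFoliation hX).self_mem q hq)⟩

theorem height_le (h : IsCenter X p A) (hX : LocallyLipschitz X) (hq : q ∈ A)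
    (hw : w ∈ orbit X q) : height X q ≤ w.2 :=
  csInf_le (((h.isNestedFoliation hX).isCompact q hq).image continuous_snd).bddBelow ⟨w, hw, rfl⟩

theorem height_le_self (h : IsCenter X p A) (hX : LocallyLipschitz X) (hq : q ∈ A) :
    height X q ≤ q.2 := h.height_le hX hq ((h.isNestedFoliation hX).self_mem q hq)

theorem height_eq_of_mem (h : IsCenter X p A) (hX : LocallyLipschitz X) (hq : q ∈ A)
    (hw : w ∈ orbit X q) : height X w = height X q := by
  rw [height, height, (h.isNestedFoliation hX).eq_of_mem q hq w hw]

theorem height_center (h : IsCenter X p A) (hX : LocallyLipschitz X) : height X p = p.2 := by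
  rw [height, orbit_eq_singleton hX h.equilibrium, image_singleton, csInf_singleton]

theorem eventually_height_lt (h : IsCenter X p A) (hX : LocallyLipschitz X) (hq : q ∈ A) {a : ℝ}
    (ha : height X q < a) : ∀ᶠ z in 𝓝 q, height X z < a := by
  obtain ⟨w, hw, hwq⟩ := h.exists_height_eq hX hq
  obtain ⟨γ, rfl, hγ, horb⟩ := h.exists_solution hX hq
  obtain ⟨T, hT, rfl⟩ := horb ▸ hw
  filter_upwards [h.isOpen.mem_nhds hq, IsSolOn.eventually_exists_dist_lt hX
    (isSolOn_of_hasDerivAt hγ (Icc 0 T)) (sub_pos.2 ha)] with z hzA ⟨v, hv0, hv, hvγ⟩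
  have hT_mem := right_mem_Icc.2 (mem_Ici.1 hT)
  have hdist : |(v T).2 - (γ T).2| < a - height X (γ 0) :=
    (le_max_right _ _).trans_lt (hvγ T hT_mem)
  have hle : height X z ≤ (v T).2 :=
    h.height_le hX hzA (hv0 ▸ h.mem_orbit_of_isSolOn hX hv (hv0 ▸ hzA) hT_mem)
  linarith [(abs_lt.1 hdist).2]

theorem eventually_lt_height (h : IsCenter X p A) (hX : LocallyLipschitz X) {q₁ : ℝ × ℝ}
    (hq₁ : q₁ ∈ A) (hq : q ∈ hull p (orbit X q₁)) {a : ℝ} (ha : a < height X q) :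
    ∀ᶠ z in 𝓝[hull p (orbit X q₁)] q, a < height X z := by
  have hF := h.isNestedFoliation hX
  have hKA := hF.hull_subset hq₁
  have hlow : IsCompact (hull p (orbit X q₁) ∩ {w | w.2 ≤ a}) :=
    (hF.isCompact_hull hq₁).inter_right (isClosed_le continuous_snd continuous_const)
  have havoid : ∀ᶠ z in 𝓝 q, ∀ w ∈ hull p (orbit X q₁) ∩ {w | w.2 ≤ a}, z ∈ A → w ∉ orbit X z := by
    refine hlow.eventually_forall_of_forall_eventually fun w ⟨hwK, hwa⟩ => ?_
    obtain ⟨U, hU, V, hV, hUV⟩ := hF.exists_nhds_notMem_leaf (hKA hq) (hKA hwK)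
      fun hwq => (ha.trans_le (h.height_le hX (hKA hq) hwq)).not_ge hwa
    rw [nhds_prod_eq]
    filter_upwards [prod_mem_prod hU hV] with ⟨z, x⟩ ⟨hz, hx⟩ hzA
    exact hUV z hz hzA x hx
  filter_upwards [mem_nhdsWithin_of_mem_nhds havoid, self_mem_nhdsWithin] with z hz hzK
  obtain ⟨w, hw, hwz⟩ := h.exists_height_eq hX (hKA hzK)
  by_contra! hcon
  exact hz w ⟨hF.leaf_subset_hull hq₁ hzK hw, hwz.trans_le hcon⟩ (hKA hzK) hw

theorem continuousOn_height (h : IsCenter X p A) (hX : LocallyLipschitz X) (hq : q ∈ A) :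
    ContinuousOn (height X) (hull p (orbit X q)) := fun _ hz =>
  tendsto_order.2 ⟨fun _ ha => h.eventually_lt_height hX hq hz ha, fun _ ha =>
    mem_nhdsWithin_of_mem_nhds
      (h.eventually_height_lt hX ((h.isNestedFoliation hX).hull_subset hq hz) ha)⟩

theorem snd_field_eq_zero (h : IsCenter X p A) (hX : LocallyLipschitz X) (hq : q ∈ A)
    (hw : w ∈ orbit X q) (hwq : w.2 = height X q) : (X w).2 = 0 := by
  obtain ⟨γ, hγ, hqγ, t, rfl⟩ := hw
  refine IsLocalMin.hasDerivAt_eq_zero (Eventually.of_forall fun s => ?_) (hγ t).snd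
  rw [hwq]
  exact h.height_le hX hq ⟨γ, hγ, hqγ, s, rfl⟩

theorem tangency_mem_orbit (h : IsCenter X p A) (hX : LocallyLipschitz X) (hq : q ∈ A)
    (huniq : ∀ w ∈ hull p (orbit X q), w.2 = m → (X w).2 = 0 → w = (x, m))
    (hw : w ∈ hull p (orbit X q)) (hwm : height X w = m) : (x, m) ∈ orbit X w := by
  have hF := h.isNestedFoliation hX
  have hwA := hF.hull_subset hq hw
  obtain ⟨z, hz, hzw⟩ := h.exists_height_eq hX hwA
  rwa [← huniq z (hF.leaf_subset_hull hq hw hz) (hzw.trans hwm) (h.snd_field_eq_zero hX hwA hz hzw)]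

theorem tangency_mem_hull (h : IsCenter X p A) (hX : LocallyLipschitz X) (hq : q ∈ A)
    (huniq : ∀ w ∈ hull p (orbit X q), w.2 = m → (X w).2 = 0 → w = (x, m))
    (hm : height X q ≤ m) (hmp : m ≤ p.2) :
    (x, m) ∈ hull p (orbit X q) ∧ height X (x, m) = m := by
  have hF := h.isNestedFoliation hX
  obtain ⟨w, hw, hwm⟩ := (hF.isPreconnected_hull hq).intermediate_value
    (.inr (hF.self_mem q hq)) (mem_hull _ _) (h.continuousOn_height hX hq)
    ⟨hm, hmp.trans_eq (h.height_center hX).symm⟩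
  have hxm := h.tangency_mem_orbit hX hq huniq hw hwm
  exact ⟨hF.leaf_subset_hull hq hw hxm,
    (h.height_eq_of_mem hX (hF.hull_subset hq hw) hxm).trans hwm⟩

end IsCenter

/-! ### Regularization and tangencies -/

/-- A transition function that need not be monotone: it may take any values in `[-1, 1)` between
`-1` and `1`. -/
structure IsWeakTransition (φ : ℝ → ℝ) : Prop where
  locallyLipschitz : LocallyLipschitz φ
  mem_Icc : ∀ v, φ v ∈ Icc (-1 : ℝ) 1
  left : ∀ v ≤ -1, φ v = -1
  right : ∀ v, 1 ≤ v → φ v = 1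
  lt_one : ∀ ⦃v⦄, v < 1 → φ v < 1

theorem IsTransition.isWeakTransition {φ : ℝ → ℝ} (h : IsTransition φ) : IsWeakTransition φ where
  locallyLipschitz := h.lipschitz.choose_spec.locallyLipschitz
  mem_Icc v := by
    rcases le_total v (-1) with hv | hv
    · norm_num [h.left v hv]
    rcases le_total 1 v with hv' | hv'
    · norm_num [h.right v hv']
    have hmaps := h.strictMono.monotoneOn.mapsTo_Icc ⟨hv, hv'⟩
    rwa [h.left (-1) le_rfl, h.right 1 le_rfl] at hmaps
  left := h.left
  right := h.right
  lt_one v hv := by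
    rcases le_total v (-1) with hv' | hv'
    · norm_num [h.left v hv']
    · simpa only [h.right 1 le_rfl] using
        h.strictMono ⟨hv', hv.le⟩ (right_mem_Icc.2 (by norm_num)) hv

section Regularized

variable {Xp Xm : ℝ × ℝ → ℝ × ℝ} {φ : ℝ → ℝ} {ε : ℝ} {q : ℝ × ℝ}

theorem locallyLipschitz_regularized (hp : LocallyLipschitz Xp) (hm : LocallyLipschitz Xm)
    (hφ : IsWeakTransition φ) (ε : ℝ) : LocallyLipschitz (regularized Xp Xm φ ε) := by
  have hdiv : LocallyLipschitz fun q : ℝ × ℝ => q.2 / ε :=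
    ContDiff.locallyLipschitz (𝕂 := ℝ) (by fun_prop)
  have hhalf : LocallyLipschitz fun u : ℝ => u / 2 :=
    ContDiff.locallyLipschitz (𝕂 := ℝ) (by fun_prop)
  exact (locallyLipschitz_smul (.const _) (hp.add hm)).add
    (locallyLipschitz_smul (hhalf.comp (hφ.locallyLipschitz.comp hdiv)) (hp.sub hm))

theorem regularized_eq (Xp Xm : ℝ × ℝ → ℝ × ℝ) (φ : ℝ → ℝ) (ε : ℝ) (q : ℝ × ℝ) :
    regularized Xp Xm φ ε q =
      ((1 + φ (q.2 / ε)) / 2) • Xp q + ((1 - φ (q.2 / ε)) / 2) • Xm q := by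
  unfold regularized
  module

theorem regularized_of_ge (hφ : IsWeakTransition φ) (hε : 0 < ε) (hq : ε ≤ q.2) :
    regularized Xp Xm φ ε q = Xp q := by
  rw [regularized_eq, hφ.right _ ((one_le_div hε).2 hq)]
  module

theorem regularized_of_le (hφ : IsWeakTransition φ) (hε : 0 < ε) (hq : q.2 ≤ -ε) :
    regularized Xp Xm φ ε q = Xm q := by
  rw [regularized_eq, hφ.left _ ((div_le_iff₀ hε).2 (by linarith))]
  module

theorem regularized_mem_segment (hφ : IsWeakTransition φ) :
    regularized Xp Xm φ ε q ∈ segment ℝ (Xp q) (Xm q) := by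
  obtain ⟨hge, hle⟩ := hφ.mem_Icc (q.2 / ε)
  rw [regularized_eq]
  exact ⟨_, _, by linarith, by linarith, by ring, rfl⟩

theorem le_regularized (hφ : IsWeakTransition φ) {a b c : ℝ} (hp : c ≤ a * (Xp q).1 + b * (Xp q).2)
    (hm : c ≤ a * (Xm q).1 + b * (Xm q).2) :
    c ≤ a * (regularized Xp Xm φ ε q).1 + b * (regularized Xp Xm φ ε q).2 :=
  (convex_halfSpace_ge (a • LinearMap.fst ℝ ℝ ℝ + b • LinearMap.snd ℝ ℝ ℝ).isLinear c
    ).segment_subset hp hm (regularized_mem_segment hφ)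

theorem norm_regularized_le (hφ : IsWeakTransition φ) {c : ℝ} (hp : ‖Xp q‖ ≤ c) (hm : ‖Xm q‖ ≤ c) :
    ‖regularized Xp Xm φ ε q‖ ≤ c :=
  mem_closedBall_zero_iff.1 <| (convex_closedBall (0 : ℝ × ℝ) c).segment_subset
    (mem_closedBall_zero_iff.2 hp) (mem_closedBall_zero_iff.2 hm) (regularized_mem_segment hφ)

theorem cross_regularized (Xp Xm : ℝ × ℝ → ℝ × ℝ) (φ : ℝ → ℝ) (ε : ℝ) (q : ℝ × ℝ) :
    (Xp q).1 * (regularized Xp Xm φ ε q).2 - (Xp q).2 * (regularized Xp Xm φ ε q).1 =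
      (1 - φ (q.2 / ε)) / 2 * ((Xp q).1 * (Xm q).2 - (Xm q).1 * (Xp q).2) := by
  rw [regularized_eq]
  simp only [Prod.fst_add, Prod.snd_add, Prod.smul_fst, Prod.smul_snd, smul_eq_mul]
  ring

end Regularized

theorem mem_closedBall_zero_prod {q : ℝ × ℝ} {r : ℝ} :
    q ∈ Metric.closedBall (0 : ℝ × ℝ) r ↔ |q.1| ≤ r ∧ |q.2| ≤ r := by
  rw [mem_closedBall_zero_iff, Prod.norm_def, max_le_iff, Real.norm_eq_abs, Real.norm_eq_abs]

section ZeroCurve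

variable {α : Type*} [TopologicalSpace α] {y₀ : α} {f : ℝ × α → ℝ}

theorem eventually_exists_zero (hf : Continuous f) (hneg : ∀ x < 0, f (x, y₀) < 0)
    (hpos : ∀ x > 0, 0 < f (x, y₀)) {s : ℝ} (hs : 0 < s) :
    ∀ᶠ y in 𝓝 y₀, ∃ x, |x| < s ∧ f (x, y) = 0 := by
  have hline : ∀ x, Continuous fun y => f (x, y) := fun x => by fun_prop
  filter_upwards [((hline (-s)).tendsto y₀).eventually_lt_const (hneg _ (neg_lt_zero.2 hs)),
    ((hline s).tendsto y₀).eventually_const_lt (hpos s hs)] with y hneg_y hpos_y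
  have hcont : ContinuousOn (fun x => f (x, y)) (Icc (-s) s) := by fun_prop
  obtain ⟨x, hx, hx0⟩ := intermediate_value_Ioo (by linarith) hcont ⟨hneg_y, hpos_y⟩
  exact ⟨x, abs_lt.2 hx, hx0⟩

theorem eventually_abs_lt_of_eq_zero (hf : Continuous f) (hzero : ∀ x, f (x, y₀) = 0 → x = 0)
    (R : ℝ) {s : ℝ} (hs : 0 < s) :
    ∀ᶠ y in 𝓝 y₀, ∀ x ∈ Icc (-R) R, f (x, y) = 0 → |x| < s := by
  have hc : IsCompact (Icc (-R) R ∩ {x | s ≤ |x|}) :=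
    isCompact_Icc.inter_right (isClosed_le continuous_const continuous_abs)
  have hne : ∀ᶠ y in 𝓝 y₀, ∀ x ∈ Icc (-R) R ∩ {x | s ≤ |x|}, f (x, y) ≠ 0 := by
    refine hc.eventually_forall_of_forall_eventually fun x ⟨_, hxs⟩ => ?_
    have hcont : Continuous fun z : α × ℝ => f (z.2, z.1) := by fun_prop
    exact hcont.continuousAt.eventually_ne fun hx0 => abs_pos.1 (hs.trans_le hxs) (hzero x hx0)
  filter_upwards [hne] with y hy x hx hx0
  by_contra! hsx
  exact hy x ⟨hx, hsx⟩ hx0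

theorem exists_zero_curve (hf : Continuous f) (hneg : ∀ x < 0, f (x, y₀) < 0)
    (hpos : ∀ x > 0, 0 < f (x, y₀)) {r : ℝ} (hr : 0 < r)
    (hinj : ∀ᶠ y in 𝓝 y₀, InjOn (fun x => f (x, y)) (Icc (-r) r)) :
    ∃ ξ : α → ℝ, Tendsto ξ (𝓝 y₀) (𝓝 0) ∧
      ∀ R : ℝ, ∀ᶠ y in 𝓝 y₀, ∀ x ∈ Icc (-R) R, f (x, y) = 0 ↔ x = ξ y := by
  have hzero : ∀ x, f (x, y₀) = 0 → x = 0 := fun x hx => by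
    rcases lt_trichotomy x 0 with hlt | heq | hgt
    exacts [absurd hx (hneg x hlt).ne, heq, absurd hx (hpos x hgt).ne']
  obtain ⟨ξ, hξ⟩ := (eventually_exists_zero hf hneg hpos hr).choice
  have hξ_mem : ∀ᶠ y in 𝓝 y₀, ξ y ∈ Icc (-r) r := hξ.mono fun y hy => abs_le.1 hy.1.le
  refine ⟨ξ, Metric.tendsto_nhds.2 fun s hs => ?_, fun R => ?_⟩
  · filter_upwards [hξ, hξ_mem, eventually_abs_lt_of_eq_zero hf hzero r hs] with y hy hmem hlt
    rw [Real.dist_0_eq_abs]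
    exact hlt _ hmem hy.2
  · filter_upwards [hξ, hξ_mem, hinj, eventually_abs_lt_of_eq_zero hf hzero R hr]
      with y hy hmem hinj_y hlt x hx
    refine ⟨fun hx0 => hinj_y (abs_le.1 (hlt x hx hx0).le) hmem (hx0.trans hy.2.symm), ?_⟩
    rintro rfl
    exact hy.2

end ZeroCurve

/-- A visible fold-regular point at the origin, as in `IsVisibleFold`, of vector fields that are
only of class `C¹`. -/
structure IsC1VisibleFold (Xp Xm : ℝ × ℝ → ℝ × ℝ) : Prop where
  contDiff_plus : ContDiff ℝ 1 Xp
  contDiff_minus : ContDiff ℝ 1 Xm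
  tangent : (Xp (0, 0)).2 = 0
  rightward : 0 < (Xp (0, 0)).1
  generic : deriv (fun x : ℝ => (Xp (x, 0)).2) 0 ≠ 0
  down : ∀ x : ℝ, x < 0 → (Xp (x, 0)).2 < 0
  up : ∀ x : ℝ, 0 < x → 0 < (Xp (x, 0)).2
  minus_up : 0 < (Xm (0, 0)).2

theorem IsVisibleFold.isC1VisibleFold {Xp Xm : ℝ × ℝ → ℝ × ℝ} (h : IsVisibleFold Xp Xm) :
    IsC1VisibleFold Xp Xm where
  contDiff_plus := h.contDiff_plus.of_le (by norm_num)
  contDiff_minus := h.contDiff_minus.of_le (by norm_num)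
  __ := h

namespace IsC1VisibleFold

variable {Xp Xm : ℝ × ℝ → ℝ × ℝ}

theorem locallyLipschitz_plus (h : IsC1VisibleFold Xp Xm) : LocallyLipschitz Xp :=
  h.contDiff_plus.locallyLipschitz

theorem locallyLipschitz_minus (h : IsC1VisibleFold Xp Xm) : LocallyLipschitz Xm :=
  h.contDiff_minus.locallyLipschitz

theorem contDiff_plus_snd (h : IsC1VisibleFold Xp Xm) : ContDiff ℝ 1 (fun q => (Xp q).2) :=
  contDiff_snd.comp h.contDiff_plus

theorem hasDerivAt_plus_snd (h : IsC1VisibleFold Xp Xm) (x y : ℝ) :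
    HasDerivAt (fun x => (Xp (x, y)).2) (fderiv ℝ (fun q => (Xp q).2) (x, y) (1, 0)) x :=
  ((h.contDiff_plus_snd.differentiable one_ne_zero (x, y)).hasFDerivAt).comp_hasDerivAt
    (f := fun x : ℝ => (x, y)) x ((hasDerivAt_id x).prodMk (hasDerivAt_const x y))

theorem continuous_fderiv_plus_snd (h : IsC1VisibleFold Xp Xm) :
    Continuous (fun q => fderiv ℝ (fun q => (Xp q).2) q) :=
  h.contDiff_plus_snd.continuous_fderiv one_ne_zero

theorem fderiv_plus_snd_pos (h : IsC1VisibleFold Xp Xm) :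
    0 < fderiv ℝ (fun q => (Xp q).2) (0, 0) (1, 0) := by
  have hderiv := h.hasDerivAt_plus_snd 0 0
  have hslope := hderiv.hasDerivWithinAt (s := Ioi 0)
  rw [hasDerivWithinAt_iff_tendsto_slope' self_notMem_Ioi] at hslope
  refine lt_of_le_of_ne (ge_of_tendsto hslope ?_) (hderiv.deriv ▸ h.generic).symm
  filter_upwards [self_mem_nhdsWithin] with x (hx : 0 < x)
  rw [slope_def_field, h.tangent, sub_zero, sub_zero]
  exact (div_pos (h.up x hx) hx).le

theorem exists_tangency (h : IsC1VisibleFold Xp Xm) : ∃ ξ : ℝ → ℝ, Tendsto ξ (𝓝 0) (𝓝 0) ∧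
    ∀ R : ℝ, ∀ᶠ m in 𝓝 (0 : ℝ), ∀ x ∈ Icc (-R) R, (Xp (x, m)).2 = 0 ↔ x = ξ m := by
  have hcont : Continuous fun q => fderiv ℝ (fun q => (Xp q).2) q (1, 0) :=
    h.continuous_fderiv_plus_snd.clm_apply continuous_const
  obtain ⟨r, hr, hpos⟩ := Metric.nhds_basis_closedBall.mem_iff.1
    ((hcont.tendsto (0, 0)).eventually_const_lt h.fderiv_plus_snd_pos)
  refine exists_zero_curve h.contDiff_plus_snd.continuous h.down h.up hr ?_
  filter_upwards [Icc_mem_nhds (neg_lt_zero.2 hr) hr] with y hy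
  refine (strictMonoOn_of_deriv_pos (f := fun x => (Xp (x, y)).2) (convex_Icc _ _)
    (h.contDiff_plus_snd.continuous.comp (by fun_prop)).continuousOn fun x hx => ?_).injOn
  rw [interior_Icc] at hx
  rw [(h.hasDerivAt_plus_snd x y).deriv]
  exact hpos (mem_closedBall_zero_prod.2 ⟨abs_le.2 ⟨hx.1.le, hx.2.le⟩, abs_le.2 hy⟩)

end IsC1VisibleFold

/-! ### Orbits near the fold -/

/-- `c` is the graph of a solution of `y' = Y₂ / Y₁` over `[-ρ, ρ]`, inside the square `‖q‖ ≤ r`. -/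
structure IsGraph (Y : ℝ × ℝ → ℝ × ℝ) (ρ r : ℝ) (c : ℝ → ℝ × ℝ) : Prop where
  hasDerivAt : ∀ x, HasDerivAt c (Y (c x)) x
  fst_eq : ∀ x ∈ Icc (-ρ) ρ, (c x).1 = x
  mem : ∀ x ∈ Icc (-ρ) ρ, c x ∈ Metric.closedBall (0 : ℝ × ℝ) r

namespace IsGraph

variable {Y : ℝ × ℝ → ℝ × ℝ} {ρ r : ℝ} {c c₁ : ℝ → ℝ × ℝ}

theorem continuous (hc : IsGraph Y ρ r c) : Continuous c :=
  continuous_iff_continuousAt.2 fun t => (hc.hasDerivAt t).continuousAt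

theorem lt_of_lt (hY : LocallyLipschitz Y) (hc : IsGraph Y ρ r c) (hc₁ : IsGraph Y ρ r c₁) {x z : ℝ}
    (hx : x ∈ Icc (-ρ) ρ) (hz : z ∈ Icc (-ρ) ρ) (h : (c x).2 < (c₁ x).2) : (c z).2 < (c₁ z).2 := by
  by_contra! hle
  have hcont : Continuous fun x => (c₁ x).2 - (c x).2 :=
    (continuous_snd.comp hc₁.continuous).sub (continuous_snd.comp hc.continuous)
  obtain ⟨u, hu, hu_zero⟩ : (0 : ℝ) ∈ (fun x => (c₁ x).2 - (c x).2) '' uIcc x z :=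
    intermediate_value_uIcc hcont.continuousOn
      (mem_uIcc.2 (.inr ⟨sub_nonpos.2 hle, (sub_pos.2 h).le⟩))
  have hu_mem := ordConnected_Icc.uIcc_subset hx hz hu
  have hmeet : c u = c₁ u := Prod.ext ((hc.fst_eq u hu_mem).trans (hc₁.fst_eq u hu_mem).symm)
    (sub_eq_zero.1 hu_zero).symm
  have heq := IsSolOn.eqOn_of_mem hY (isSolOn_of_hasDerivAt hc.hasDerivAt (Icc (-ρ) ρ))
    (isSolOn_of_hasDerivAt hc₁.hasDerivAt _) hu_mem hmeet hx
  exact (heq ▸ h).false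

theorem le_of_le (hY : LocallyLipschitz Y) (hc : IsGraph Y ρ r c) (hc₁ : IsGraph Y ρ r c₁) {x z : ℝ}
    (hx : x ∈ Icc (-ρ) ρ) (hz : z ∈ Icc (-ρ) ρ) (h : (c x).2 ≤ (c₁ x).2) : (c z).2 ≤ (c₁ z).2 := by
  by_contra! hlt
  exact (lt_of_lt hY hc₁ hc hz hx hlt).not_ge h

theorem hasDerivWithinAt_sub (hc : IsGraph Y ρ r c) {v : ℝ → ℝ × ℝ} {w : ℝ × ℝ} {s : Set ℝ} {t : ℝ}
    (hv : HasDerivWithinAt v w s t) :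
    HasDerivWithinAt (fun t => (v t).2 - (c (v t).1).2) (w.2 - w.1 * (Y (c (v t).1)).2) s t := by
  have hfst : HasDerivWithinAt (fun t => (v t).1) w.1 s t := hv.fst
  have hgraph : HasDerivAt (fun x => (c x).2) (Y (c (v t).1)).2 (v t).1 := (hc.hasDerivAt _).snd
  have hcomp := hgraph.scomp_hasDerivWithinAt t hfst
  exact HasDerivWithinAt.sub (f := fun t => (v t).2) hv.snd hcomp

theorem neg_mul_abs_le_of_cross_nonneg (hc : IsGraph Y ρ r c) {K : NNReal}
    (hK : LipschitzOnWith K Y (Metric.closedBall 0 r)) {q w : ℝ × ℝ} {B : ℝ}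
    (hq : q ∈ Metric.closedBall (0 : ℝ × ℝ) r) (hqρ : q.1 ∈ Icc (-ρ) ρ)
    (hcross : (Y q).2 * w.1 ≤ w.2) (hw : ‖w‖ ≤ B) :
    -(K * B * |q.2 - (c q.1).2|) ≤ w.2 - w.1 * (Y (c q.1)).2 := by
  have hdist : dist q (c q.1) = |q.2 - (c q.1).2| := by
    rw [Prod.dist_eq, hc.fst_eq _ hqρ, dist_self, Real.dist_eq, max_eq_right (abs_nonneg _)]
  have hY : |(Y q).2 - (Y (c q.1)).2| ≤ K * |q.2 - (c q.1).2| :=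
    (le_max_right _ _).trans (hdist ▸ hK.dist_le_mul _ hq _ (hc.mem _ hqρ))
  have hprod : |((Y q).2 - (Y (c q.1)).2) * w.1| ≤ K * |q.2 - (c q.1).2| * B := by
    rw [abs_mul]
    exact mul_le_mul hY ((norm_fst_le w).trans hw) (abs_nonneg _) (by positivity)
  linarith [(abs_le.1 hprod).1]

theorem le_of_cross_nonneg (hY : LocallyLipschitz Y) (hc : IsGraph Y ρ r c)
    {Z : ℝ × ℝ → ℝ × ℝ} (hZ : Continuous Z)
    (hcross : ∀ q ∈ Metric.closedBall (0 : ℝ × ℝ) r, (Y q).2 * (Z q).1 ≤ (Z q).2)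
    {v : ℝ → ℝ × ℝ} {a b : ℝ} (hv : IsSolOn Z v (Icc a b))
    (hvr : ∀ t ∈ Icc a b, v t ∈ Metric.closedBall (0 : ℝ × ℝ) r)
    (hvρ : ∀ t ∈ Icc a b, (v t).1 ∈ Icc (-ρ) ρ) (ha : (c (v a).1).2 ≤ (v a).2) :
    ∀ t ∈ Icc a b, (c (v t).1).2 ≤ (v t).2 := by
  have hcomp : IsCompact (Metric.closedBall (0 : ℝ × ℝ) r) := isCompact_closedBall 0 r
  obtain ⟨K, hK⟩ := (hY.locallyLipschitzOn (s := Metric.closedBall (0 : ℝ × ℝ) r)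
    ).exists_lipschitzOnWith_of_compact hcomp
  obtain ⟨B, hB⟩ := hcomp.exists_bound_of_continuousOn hZ.continuousOn
  have hnonneg := nonneg_of_deriv_ge_neg_mul_abs
    (fun t ht => (hc.hasDerivWithinAt_sub (hv t ht)).continuousWithinAt)
    (fun t ht => (hc.hasDerivWithinAt_sub (hv t (Ico_subset_Icc_self ht))).mono_of_mem_nhdsWithin
      (Icc_mem_nhdsGE_of_mem ht))
    (sub_nonneg.2 ha) fun t ht => hc.neg_mul_abs_le_of_cross_nonneg hK
      (hvr t (Ico_subset_Icc_self ht)) (hvρ t (Ico_subset_Icc_self ht))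
      (hcross _ (hvr t (Ico_subset_Icc_self ht))) (hB _ (hvr t (Ico_subset_Icc_self ht)))
  exact fun t ht => sub_nonneg.1 (hnonneg t ht)

end IsGraph

theorem mem_closedBall_of_norm_field_le {E : Type*} [NormedAddCommGroup E] [NormedSpace ℝ E]
    {Y : E → E} {c : ℝ → E} {R t : ℝ} (hc : ∀ t, HasDerivAt c (Y (c t)) t)
    (hY : ∀ q ∈ Metric.closedBall (c 0) R, ‖Y q‖ ≤ 1) (ht : |t| < R) :
    c t ∈ Metric.closedBall (c 0) R := by
  have hR : 0 ≤ R := (abs_nonneg t).trans ht.le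
  have hcont : Continuous c := continuous_iff_continuousAt.2 fun t => (hc t).continuousAt
  have hT : 1 * |t| < R := by rwa [one_mul]
  rcases abs_cases t with ⟨habs, hsign⟩ | ⟨habs, hsign⟩
  · exact mem_closedBall_of_norm_deriv_le zero_le_one hR hcont
      (fun s hs => ⟨hc s, hY _ hs⟩) hT t ⟨hsign, habs.ge⟩
  · have hback := mem_closedBall_of_norm_deriv_le (v := fun s => c (-s))
      (v' := fun s => (-1 : ℝ) • Y (c (-s))) zero_le_one hR (by fun_prop)
      (fun s hs => ⟨(hc (-s)).scomp s (hasDerivAt_neg s), by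
        rw [neg_one_smul, norm_neg]
        exact hY _ (by simpa only [neg_zero] using hs)⟩) hT (-t) ⟨by linarith, habs.ge⟩
    simpa only [neg_neg, neg_zero] using hback

theorem isGraph_of_hasDerivAt {Y : ℝ × ℝ → ℝ × ℝ} {c : ℝ → ℝ × ℝ} {r : ℝ} (hr : 0 < r)
    (hc : ∀ t, HasDerivAt c (Y (c t)) t)
    (hfst : ∀ q ∈ Metric.closedBall (0 : ℝ × ℝ) r, (Y q).1 = 1)
    (hsnd : ∀ q ∈ Metric.closedBall (0 : ℝ × ℝ) r, |(Y q).2| ≤ 1)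
    (hz : c 0 ∈ Metric.closedBall (0 : ℝ × ℝ) (r / 8)) :
    IsGraph Y (r / 2) r fun x => c (x - (c 0).1) := by
  have hz_fst := abs_le.1 (mem_closedBall_zero_prod.1 hz).1
  have hball : Metric.closedBall (c 0) (3 * r / 4) ⊆ Metric.closedBall (0 : ℝ × ℝ) r :=
    Metric.closedBall_subset_closedBall' (by linarith [Metric.mem_closedBall.1 hz])
  have hderiv : ∀ x, HasDerivAt (fun x => c (x - (c 0).1)) (Y (c (x - (c 0).1))) x :=
    fun x => (hc _).comp_sub_const x _
  have hmem : ∀ x ∈ Icc (-(r / 2)) (r / 2), c (x - (c 0).1) ∈ Metric.closedBall (0 : ℝ × ℝ) r :=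
    fun x hx => hball <| mem_closedBall_of_norm_field_le hc
      (fun q hq => max_le (by simp [hfst q (hball hq)]) (hsnd q (hball hq)))
      (abs_lt.2 ⟨by linarith [hx.1], by linarith [hx.2]⟩)
  refine ⟨hderiv, fun x hx => ?_, hmem⟩
  have hsub : ∀ y, HasDerivAt (fun y => (c (y - (c 0).1)).1 - y) ((Y (c (y - (c 0).1))).1 - 1) y :=
    fun y => HasDerivAt.sub (f := fun y => (c (y - (c 0).1)).1) (hderiv y).fst (hasDerivAt_id y)
  have hconst := (convex_Icc (-(r / 2)) (r / 2)).norm_image_sub_le_of_norm_hasDerivWithin_le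
    (C := 0) (fun y _ => (hsub y).hasDerivWithinAt) (fun y hy => by simp [hfst _ (hmem y hy)])
    (⟨by linarith, by linarith⟩ : (c 0).1 ∈ Icc (-(r / 2)) (r / 2)) hx
  simpa [sub_eq_zero] using hconst

theorem exists_zero_of_le_deriv {f f' : ℝ → ℝ} {κ ρ x₀ : ℝ} (hκ : 0 ≤ κ)
    (hf : ∀ x ∈ Icc (-ρ) ρ, HasDerivAt f (f' x) x) (hf' : ∀ x ∈ Icc (-ρ) ρ, κ ≤ f' x)
    (hx₀ : |x₀| ≤ ρ / 2) (hfx₀ : |f x₀| ≤ κ * (ρ / 2)) : ∃ x ∈ Icc (-ρ) ρ, f x = 0 := by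
  obtain ⟨hx₀_ge, hx₀_le⟩ := abs_le.1 hx₀
  obtain ⟨hf_ge, hf_le⟩ := abs_le.1 hfx₀
  have hcont : ContinuousOn f (Icc (-ρ) ρ) := fun x hx => (hf x hx).continuousAt.continuousWithinAt
  have hgrow : ∀ x ∈ Icc (-ρ) ρ, ∀ y ∈ Icc (-ρ) ρ, x ≤ y → κ * (y - x) ≤ f y - f x :=
    (convex_Icc (-ρ) ρ).mul_sub_le_image_sub_of_le_deriv hcont
      (fun x hx => (hf x (interior_subset hx)).differentiableAt.differentiableWithinAt)
      fun x hx => (hf x (interior_subset hx)).deriv ▸ hf' x (interior_subset hx)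
  have hmem : x₀ ∈ Icc (-ρ) ρ := ⟨by linarith, by linarith⟩
  have hleft := hgrow (-ρ) (left_mem_Icc.2 (by linarith)) x₀ hmem hmem.1
  have hright := hgrow x₀ hmem ρ (right_mem_Icc.2 (by linarith)) hmem.2
  exact intermediate_value_Icc (by linarith) hcont ⟨by nlinarith, by nlinarith⟩

/-- Near the fold `g • Xp` is `Xp` rescaled to unit horizontal speed.  On the square `‖q‖ ≤ r` the
second component of `Xp` grows at rate at least `κ` along it, and `Xm` points to the upper side of
`Xp`.  The square `‖q‖ ≤ s` is so small that the orbits of `Xp` through it are graphs over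
`[-r / 2, r / 2]` which contain a point of tangency with the horizontal direction. -/
structure IsFlowBox (Xp Xm : ℝ × ℝ → ℝ × ℝ) (g : ℝ × ℝ → ℝ) (κ r s : ℝ) : Prop where
  differentiable : Differentiable ℝ fun q => (Xp q).2
  locallyLipschitz : LocallyLipschitz g
  rate_pos : 0 < κ
  pos : 0 < s
  le_div : s ≤ r / 8
  scale_pos : ∀ q ∈ Metric.closedBall (0 : ℝ × ℝ) r, 0 < g q
  fst_eq : ∀ q ∈ Metric.closedBall (0 : ℝ × ℝ) r, (g q • Xp q).1 = 1
  abs_snd_le : ∀ q ∈ Metric.closedBall (0 : ℝ × ℝ) r, |(g q • Xp q).2| ≤ 1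
  cross_pos : ∀ q ∈ Metric.closedBall (0 : ℝ × ℝ) r, 0 < (Xp q).1 * (Xm q).2 - (Xm q).1 * (Xp q).2
  le_fderiv : ∀ q ∈ Metric.closedBall (0 : ℝ × ℝ) r,
    κ ≤ fderiv ℝ (fun q => (Xp q).2) q (g q • Xp q)
  abs_plus_snd_le : ∀ q ∈ Metric.closedBall (0 : ℝ × ℝ) s, |(Xp q).2| ≤ κ * (r / 2 / 2)

namespace IsC1VisibleFold

variable {Xp Xm : ℝ × ℝ → ℝ × ℝ}

theorem eventually_cross_pos (hf : IsC1VisibleFold Xp Xm) :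
    ∀ᶠ q in 𝓝 (0 : ℝ × ℝ), 0 < (Xp q).1 * (Xm q).2 - (Xm q).1 * (Xp q).2 := by
  have hXp := hf.contDiff_plus.continuous
  have hXm := hf.contDiff_minus.continuous
  have hcont : Continuous fun q => (Xp q).1 * (Xm q).2 - (Xm q).1 * (Xp q).2 := by fun_prop
  refine (hcont.tendsto (0, 0)).eventually_const_lt ?_
  rw [hf.tangent, mul_zero, sub_zero]
  exact mul_pos hf.rightward hf.minus_up

theorem exists_unit_speed_scale (hf : IsC1VisibleFold Xp Xm) : ∃ g : ℝ × ℝ → ℝ,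
    LocallyLipschitz g ∧ (∀ q, 0 < g q) ∧ (∀ᶠ q in 𝓝 (0 : ℝ × ℝ), g q * (Xp q).1 = 1) := by
  have hfst : LocallyLipschitz fun q => (Xp q).1 :=
    LipschitzWith.prod_fst.locallyLipschitz.comp hf.locallyLipschitz_plus
  have hpos : ∀ q, 0 < max (Xp q).1 ((Xp (0, 0)).1 / 2) := fun q =>
    lt_max_of_lt_right (half_pos hf.rightward)
  refine ⟨fun q => (max (Xp q).1 ((Xp (0, 0)).1 / 2))⁻¹,
    locallyLipschitz_inv_of_ne_zero (hfst.max_const _) fun q => (hpos q).ne',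
    fun q => inv_pos.2 (hpos q), ?_⟩
  filter_upwards [(hfst.continuous.tendsto (0, 0)).eventually_const_lt
    (half_lt_self hf.rightward)] with q hq
  rw [max_eq_left hq.le, inv_mul_cancel₀ ((half_pos hf.rightward).trans hq).ne']

theorem exists_isFlowBox (hf : IsC1VisibleFold Xp Xm) {r₀ : ℝ} (hr₀ : 0 < r₀) :
    ∃ g κ r s, IsFlowBox Xp Xm g κ r s ∧ r ≤ r₀ := by
  obtain ⟨g, hg, hg_pos, hg_fst⟩ := hf.exists_unit_speed_scale
  have hY := (locallyLipschitz_smul hg hf.locallyLipschitz_plus).continuous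
  have hY_zero : g (0, 0) • Xp (0, 0) = (1, 0) :=
    Prod.ext hg_fst.self_of_nhds (by simp [hf.tangent])
  have hderiv : Continuous fun q => fderiv ℝ (fun q => (Xp q).2) q (g q • Xp q) :=
    hf.continuous_fderiv_plus_snd.clm_apply hY
  obtain ⟨κ, hκ, hκ_lt⟩ := exists_between hf.fderiv_plus_snd_pos
  rw [← hY_zero] at hκ_lt
  have hsnd : ∀ᶠ q in 𝓝 (0 : ℝ × ℝ), |(g q • Xp q).2| < 1 :=
    ((continuous_snd.comp hY).abs.tendsto (0, 0)).eventually_lt_const (by simp [hf.tangent])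
  obtain ⟨r₁, hr₁, hball⟩ := Metric.nhds_basis_closedBall.mem_iff.1
    (((hderiv.tendsto (0, 0)).eventually_const_lt hκ_lt).and
      (hf.eventually_cross_pos.and (hg_fst.and hsnd)))
  have hbox := (Metric.closedBall_subset_closedBall (min_le_left r₁ r₀)).trans hball
  have hsmall : ∀ᶠ q in 𝓝 (0 : ℝ × ℝ), |(Xp q).2| < κ * (min r₁ r₀ / 2 / 2) :=
    (hf.contDiff_plus_snd.continuous.abs.tendsto (0, 0)).eventually_lt_const
      (by rw [hf.tangent, abs_zero]; exact mul_pos hκ (by positivity))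
  obtain ⟨s₁, hs₁, hball₁⟩ := Metric.nhds_basis_closedBall.mem_iff.1 hsmall
  exact ⟨g, κ, min r₁ r₀, min s₁ (min r₁ r₀ / 8),
    { differentiable := hf.contDiff_plus_snd.differentiable one_ne_zero
      locallyLipschitz := hg
      rate_pos := hκ
      pos := lt_min hs₁ (by positivity)
      le_div := min_le_right _ _
      scale_pos := fun q _ => hg_pos q
      fst_eq := fun q hq => (hbox hq).2.2.1
      abs_snd_le := fun q hq => (hbox hq).2.2.2.le
      cross_pos := fun q hq => (hbox hq).2.1
      le_fderiv := fun q hq => (hbox hq).1.le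
      abs_plus_snd_le := fun q hq =>
        (hball₁ (Metric.closedBall_subset_closedBall (min_le_left _ _) hq)).le },
    min_le_right _ _⟩

end IsC1VisibleFold

namespace IsFlowBox

variable {Xp Xm : ℝ × ℝ → ℝ × ℝ} {g : ℝ × ℝ → ℝ} {κ r s : ℝ}

theorem lt (hb : IsFlowBox Xp Xm g κ r s) : s < r := by
  linarith [hb.pos, hb.le_div]

theorem closedBall_subset (hb : IsFlowBox Xp Xm g κ r s) :
    Metric.closedBall (0 : ℝ × ℝ) s ⊆ Metric.closedBall 0 r :=
  Metric.closedBall_subset_closedBall hb.lt.le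

theorem fst_mem_Icc (hb : IsFlowBox Xp Xm g κ r s) {q : ℝ × ℝ}
    (hq : q ∈ Metric.closedBall (0 : ℝ × ℝ) s) : q.1 ∈ Icc (-(r / 2)) (r / 2) :=
  abs_le.1 ((mem_closedBall_zero_prod.1 hq).1.trans (by linarith [hb.pos, hb.le_div]))

theorem exists_snd_eq_zero (hb : IsFlowBox Xp Xm g κ r s) {c : ℝ → ℝ × ℝ} {z : ℝ × ℝ}
    (hc : IsGraph (fun q => g q • Xp q) (r / 2) r c) (hz : z ∈ Metric.closedBall (0 : ℝ × ℝ) s)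
    (hcz : c z.1 = z) : ∃ x ∈ Icc (-(r / 2)) (r / 2), (Xp (c x)).2 = 0 :=
  exists_zero_of_le_deriv hb.rate_pos.le
    (fun x _ => (hb.differentiable (c x)).hasFDerivAt.comp_hasDerivAt x (hc.hasDerivAt x))
    (fun x hx => hb.le_fderiv _ (hc.mem x hx))
    ((mem_closedBall_zero_prod.1 hz).1.trans (by linarith [hb.pos, hb.le_div]))
    (by rw [hcz]; exact hb.abs_plus_snd_le z hz)

theorem regularized_snd_sub (hb : IsFlowBox Xp Xm g κ r s) (φ : ℝ → ℝ) (ε : ℝ) {q : ℝ × ℝ}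
    (hq : q ∈ Metric.closedBall (0 : ℝ × ℝ) r) :
    (regularized Xp Xm φ ε q).2 - (regularized Xp Xm φ ε q).1 * (g q • Xp q).2 =
      g q * ((1 - φ (q.2 / ε)) / 2 * ((Xp q).1 * (Xm q).2 - (Xm q).1 * (Xp q).2)) := by
  have hfst := hb.fst_eq q hq
  rw [Prod.smul_fst, smul_eq_mul] at hfst
  rw [← cross_regularized, Prod.smul_snd, smul_eq_mul]
  linear_combination -(regularized Xp Xm φ ε q).2 * hfst

end IsFlowBox

/-- The setting in which the orbits of `X` around `p` are followed near the fold: the orbit of `q₁`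
encloses the square `‖q‖ ≤ r₀` and reaches below it, and `(ξ m, m)` is the only point enclosed by it
at which `X` is tangent to the line `y = m`. -/
structure IsFoldWindow (X : ℝ × ℝ → ℝ × ℝ) (p : ℝ × ℝ) (A : Set (ℝ × ℝ)) (q₁ : ℝ × ℝ) (ξ : ℝ → ℝ)
    (r₀ : ℝ) : Prop where
  isCenter : IsCenter X p A
  locallyLipschitz : LocallyLipschitz X
  pos : 0 < r₀
  mem : q₁ ∈ A
  ball_subset : Metric.closedBall (0 : ℝ × ℝ) r₀ ⊆ hull p (orbit X q₁)
  height_lt : height X q₁ < -r₀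
  lt_center : r₀ < p.2
  unique : ∀ m ∈ Icc (-r₀) r₀, ∀ w ∈ hull p (orbit X q₁), w.2 = m → (X w).2 = 0 → w = (ξ m, m)

namespace IsCenter

variable {X : ℝ × ℝ → ℝ × ℝ} {p q w : ℝ × ℝ} {A : Set (ℝ × ℝ)} {ξ : ℝ → ℝ}

theorem mem_inside_of_height_lt (h : IsCenter X p A) (hX : LocallyLipschitz X) (hq : q ∈ A)
    (hw : w ∈ hull p (orbit X q)) (hlt : height X q < height X w) : w ∈ inside p (orbit X q) :=
  hw.resolve_right fun hwq => hlt.ne' (h.height_eq_of_mem hX hq hwq)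

theorem exists_height_neg (h : IsCenter X p A) (hX : LocallyLipschitz X)
    (hcross : ∃ q ∈ A, q.2 = 0) : ∃ q ∈ A, height X q < 0 := by
  obtain ⟨q, hq, hq_snd⟩ := hcross
  have hline : Tendsto (fun s : ℝ => (q.1, -s)) (𝓝[>] 0) (𝓝 q) := by
    have hcont : Continuous fun s : ℝ => (q.1, -s) := by fun_prop
    convert (hcont.tendsto 0).mono_left nhdsWithin_le_nhds using 2
    rw [neg_zero, ← hq_snd]
  obtain ⟨s, hsA, hs⟩ :=
    ((hline.eventually (h.isOpen.mem_nhds hq)).and self_mem_nhdsWithin).exists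
  exact ⟨_, hsA, (h.height_le_self hX hsA).trans_lt (neg_lt_zero.2 hs)⟩

theorem exists_foldWindow (h : IsCenter X p A) (hX : LocallyLipschitz X) (hp : 0 < p.2)
    (hcross : ∃ q ∈ A, q.2 = 0) (hX0 : (X (0, 0)).2 = 0)
    (hξ : ∀ R : ℝ, ∀ᶠ m in 𝓝 (0 : ℝ), ∀ x ∈ Icc (-R) R, (X (x, m)).2 = 0 ↔ x = ξ m) :
    ∃ q₁ r₀, IsFoldWindow X p A q₁ ξ r₀ := by
  obtain ⟨q₁, hq₁, hneg⟩ := h.exists_height_neg hX hcross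
  have hF := h.isNestedFoliation hX
  obtain ⟨R, hR⟩ := (hF.isCompact_hull hq₁).isBounded.subset_closedBall (0 : ℝ × ℝ)
  obtain ⟨m₁, hm₁, hξR⟩ := Metric.nhds_basis_closedBall.mem_iff.1 (hξ R)
  have hunique : ∀ m ∈ Icc (-m₁) m₁, ∀ w ∈ hull p (orbit X q₁), w.2 = m → (X w).2 = 0 →
      w = (ξ m, m) := by
    rintro m hm w hw rfl hw0
    have hm' : w.2 ∈ Metric.closedBall 0 m₁ := mem_closedBall_zero_iff.2 (abs_le.2 hm)
    exact Prod.ext ((hξR hm' w.1 (abs_le.1 (mem_closedBall_zero_prod.1 (hR hw)).1)).1 hw0) rfl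
  have hξ_zero : 0 = ξ 0 := ((hξ 0).self_of_nhds 0 (by simp)).1 hX0
  obtain ⟨hmem, hheight⟩ := h.tangency_mem_hull hX hq₁
    (hunique 0 ⟨neg_nonpos.2 hm₁.le, hm₁.le⟩) hneg.le hp.le
  rw [← hξ_zero] at hmem hheight
  obtain ⟨r, hr, hball⟩ := Metric.nhds_basis_closedBall.mem_iff.1 ((hF.isOpen_inside hq₁).mem_nhds
    (h.mem_inside_of_height_lt hX hq₁ hmem (hneg.trans_eq hheight.symm)))
  obtain ⟨r₀, hr₀, hr₀_lt⟩ : ∃ r₀, 0 < r₀ ∧ r₀ < min (min r m₁) (min p.2 (-height X q₁)) :=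
    exists_between (by simp [hr, hm₁, hp, hneg])
  simp only [lt_min_iff] at hr₀_lt
  obtain ⟨⟨hr₀r, hr₀m⟩, hr₀p, hr₀h⟩ := hr₀_lt
  exact ⟨q₁, r₀, h, hX, hr₀, hq₁,
    ((Metric.closedBall_subset_closedBall hr₀r.le).trans hball).trans subset_union_left,
    by linarith, hr₀p, fun m hm => hunique m ⟨by linarith [hm.1], by linarith [hm.2]⟩⟩

end IsCenter

/-- Along the solutions of `Z` in the square `‖q‖ ≤ s` the height of the orbits of `X` does not
decrease, and it increases below the line `y = ε`. -/
structure IsHeightIncreasing (X Z : ℝ × ℝ → ℝ × ℝ) (ε s : ℝ) : Prop where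
  le : ∀ (v : ℝ → ℝ × ℝ) (a b : ℝ), a ≤ b → IsSolOn Z v (Icc a b) →
    (∀ t ∈ Icc a b, v t ∈ Metric.closedBall (0 : ℝ × ℝ) s) → height X (v a) ≤ height X (v b)
  lt : ∀ (v : ℝ → ℝ × ℝ) (a b : ℝ), a < b → IsSolOn Z v (Icc a b) →
    (∀ t ∈ Icc a b, v t ∈ Metric.closedBall (0 : ℝ × ℝ) s) → (v a).2 < ε →
    height X (v a) < height X (v b)

namespace IsFoldWindow

variable {Xp Xm Z : ℝ × ℝ → ℝ × ℝ} {p q₁ z : ℝ × ℝ} {A : Set (ℝ × ℝ)} {ξ : ℝ → ℝ} {r₀ m : ℝ}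

theorem isNestedFoliation (hw : IsFoldWindow Xp p A q₁ ξ r₀) : IsNestedFoliation p A (orbit Xp) :=
  hw.isCenter.isNestedFoliation hw.locallyLipschitz

theorem hull_subset (hw : IsFoldWindow Xp p A q₁ ξ r₀) : hull p (orbit Xp q₁) ⊆ A :=
  hw.isNestedFoliation.hull_subset hw.mem

theorem tangency (hw : IsFoldWindow Xp p A q₁ ξ r₀) (hm : m ∈ Icc (-r₀) r₀) :
    (ξ m, m) ∈ hull p (orbit Xp q₁) ∧ height Xp (ξ m, m) = m :=
  hw.isCenter.tangency_mem_hull hw.locallyLipschitz hw.mem (hw.unique m hm)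
    (by linarith [hw.height_lt, hm.1]) (by linarith [hw.lt_center, hm.2])

theorem orbit_eq (hw : IsFoldWindow Xp p A q₁ ξ r₀) (hm : m ∈ Icc (-r₀) r₀)
    (hz : z ∈ hull p (orbit Xp q₁)) (hzm : height Xp z = m) : orbit Xp z = orbit Xp (ξ m, m) :=
  (hw.isNestedFoliation.eq_of_mem z (hw.hull_subset hz) _ (hw.isCenter.tangency_mem_orbit
    hw.locallyLipschitz hw.mem (hw.unique m hm) hz hzm)).symm

section FlowBox

variable {g : ℝ × ℝ → ℝ} {κ r s : ℝ} {c : ℝ → ℝ × ℝ}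

theorem closedBall_subset (hw : IsFoldWindow Xp p A q₁ ξ r₀) (hb : IsFlowBox Xp Xm g κ r s)
    (hr : r ≤ r₀) : Metric.closedBall (0 : ℝ × ℝ) s ⊆ A :=
  (Metric.closedBall_subset_closedBall (hb.lt.le.trans hr)).trans
    (hw.ball_subset.trans hw.hull_subset)

theorem exists_isGraph (hw : IsFoldWindow Xp p A q₁ ξ r₀) (hb : IsFlowBox Xp Xm g κ r s)
    (hr : r ≤ r₀) (hz : z ∈ Metric.closedBall (0 : ℝ × ℝ) s) :
    ∃ c, IsGraph (fun q => g q • Xp q) (r / 2) r c ∧ c z.1 = z ∧ range c ⊆ orbit Xp z := by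
  have hzA := hw.closedBall_subset hb hr hz
  obtain ⟨γ, rfl, hγ, -⟩ := hw.isCenter.exists_solution hw.locallyLipschitz hzA
  have horb := orbit_eq_range hw.locallyLipschitz hγ (mem_range_self 0)
  obtain ⟨c, hc0, hcγ, hc⟩ := exists_rescaled_solution hw.locallyLipschitz hγ
    (horb ▸ hw.isNestedFoliation.isCompact _ hzA) hb.locallyLipschitz
  refine ⟨fun x => c (x - (c 0).1), isGraph_of_hasDerivAt (by linarith [hb.pos, hb.lt]) hc
    hb.fst_eq hb.abs_snd_le (hc0 ▸ Metric.closedBall_subset_closedBall hb.le_div hz), ?_, ?_⟩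
  · simp only [hc0, sub_self]
  · rw [horb]
    exact (range_comp_subset_range (fun x => x - (c 0).1) c).trans hcγ

theorem exists_snd_eq_height (hw : IsFoldWindow Xp p A q₁ ξ r₀) (hb : IsFlowBox Xp Xm g κ r s)
    (hr : r ≤ r₀) (hz : z ∈ Metric.closedBall (0 : ℝ × ℝ) s)
    (hc : IsGraph (fun q => g q • Xp q) (r / 2) r c) (hcz : c z.1 = z)
    (hcorb : range c ⊆ orbit Xp z) : ∃ x ∈ Icc (-(r / 2)) (r / 2), (c x).2 = height Xp z := by
  obtain ⟨x, hx, hx0⟩ := hb.exists_snd_eq_zero hc hz hcz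
  have hcx := Metric.closedBall_subset_closedBall hr (hc.mem x hx)
  have hm := abs_le.1 (mem_closedBall_zero_prod.1 hcx).2
  have hheight := (hw.tangency hm).2
  rw [← hw.unique _ hm (c x) (hw.ball_subset hcx) rfl hx0, hw.isCenter.height_eq_of_mem
    hw.locallyLipschitz (hw.closedBall_subset hb hr hz) (hcorb (mem_range_self x))] at hheight
  exact ⟨x, hx, hheight.symm⟩

theorem height_le_of_graph_le (hw : IsFoldWindow Xp p A q₁ ξ r₀) (hb : IsFlowBox Xp Xm g κ r s)
    (hr : r ≤ r₀) {w : ℝ × ℝ} (hz : z ∈ A) (hc : IsGraph (fun q => g q • Xp q) (r / 2) r c)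
    (hcorb : range c ⊆ orbit Xp z) (hws : w ∈ Metric.closedBall (0 : ℝ × ℝ) s)
    (hle : (c w.1).2 ≤ w.2) : height Xp z ≤ height Xp w := by
  obtain ⟨d, hd, hdw, hdorb⟩ := hw.exists_isGraph hb hr hws
  obtain ⟨x, hx, hxw⟩ := hw.exists_snd_eq_height hb hr hws hd hdw hdorb
  have hcd : (c x).2 ≤ (d x).2 := IsGraph.le_of_le
    (locallyLipschitz_smul hb.locallyLipschitz hw.locallyLipschitz) hc hd (hb.fst_mem_Icc hws) hx
    (by rwa [hdw])
  exact (hw.isCenter.height_le hw.locallyLipschitz hz (hcorb (mem_range_self x))).trans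
    (hcd.trans_eq hxw)

theorem height_lt_of_graph_lt (hw : IsFoldWindow Xp p A q₁ ξ r₀) (hb : IsFlowBox Xp Xm g κ r s)
    (hr : r ≤ r₀) {w : ℝ × ℝ} (hz : z ∈ A) (hc : IsGraph (fun q => g q • Xp q) (r / 2) r c)
    (hcorb : range c ⊆ orbit Xp z) (hws : w ∈ Metric.closedBall (0 : ℝ × ℝ) s)
    (hlt : (c w.1).2 < w.2) : height Xp z < height Xp w := by
  obtain ⟨d, hd, hdw, hdorb⟩ := hw.exists_isGraph hb hr hws
  obtain ⟨x, hx, hxw⟩ := hw.exists_snd_eq_height hb hr hws hd hdw hdorb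
  have hcd : (c x).2 < (d x).2 := IsGraph.lt_of_lt
    (locallyLipschitz_smul hb.locallyLipschitz hw.locallyLipschitz) hc hd (hb.fst_mem_Icc hws) hx
    (by rwa [hdw])
  exact (hw.isCenter.height_le hw.locallyLipschitz hz (hcorb (mem_range_self x))).trans_lt
    (hcd.trans_eq hxw)

theorem height_le_of_cross_nonneg (hw : IsFoldWindow Xp p A q₁ ξ r₀)
    (hb : IsFlowBox Xp Xm g κ r s) (hr : r ≤ r₀) (hZ : Continuous Z)
    (hcross : ∀ q ∈ Metric.closedBall (0 : ℝ × ℝ) r, (g q • Xp q).2 * (Z q).1 ≤ (Z q).2)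
    {v : ℝ → ℝ × ℝ} {a b : ℝ} (hab : a ≤ b) (hv : IsSolOn Z v (Icc a b))
    (hvs : ∀ t ∈ Icc a b, v t ∈ Metric.closedBall (0 : ℝ × ℝ) s) :
    height Xp (v a) ≤ height Xp (v b) := by
  have ha := hvs a (left_mem_Icc.2 hab)
  have hb_mem := right_mem_Icc.2 hab
  obtain ⟨c, hc, hca, hcorb⟩ := hw.exists_isGraph hb hr ha
  refine hw.height_le_of_graph_le hb hr (hw.closedBall_subset hb hr ha) hc hcorb (hvs b hb_mem) ?_
  exact hc.le_of_cross_nonneg (locallyLipschitz_smul hb.locallyLipschitz hw.locallyLipschitz) hZ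
    hcross hv (fun t ht => hb.closedBall_subset (hvs t ht)) (fun t ht => hb.fst_mem_Icc (hvs t ht))
    (by rw [hca]) b hb_mem

theorem exists_height_lt_of_cross_pos (hw : IsFoldWindow Xp p A q₁ ξ r₀)
    (hb : IsFlowBox Xp Xm g κ r s) (hr : r ≤ r₀) {v : ℝ → ℝ × ℝ} {a b : ℝ} (hab : a < b)
    (hv : IsSolOn Z v (Icc a b)) (hvs : ∀ t ∈ Icc a b, v t ∈ Metric.closedBall (0 : ℝ × ℝ) s)
    (hcross : 0 < (Z (v a)).2 - (Z (v a)).1 * (g (v a) • Xp (v a)).2) :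
    ∃ t ∈ Ioo a b, height Xp (v a) < height Xp (v t) := by
  have ha := hvs a (left_mem_Icc.2 hab.le)
  obtain ⟨c, hc, hca, hcorb⟩ := hw.exists_isGraph hb hr ha
  have hderiv := (hc.hasDerivWithinAt_sub (hv a (left_mem_Icc.2 hab.le))).mono_of_mem_nhdsWithin
    (Icc_mem_nhdsGT hab)
  rw [hca, hasDerivWithinAt_iff_tendsto_slope' self_notMem_Ioi] at hderiv
  obtain ⟨t, ht_slope, ht⟩ :=
    ((hderiv.eventually_const_lt hcross).and (Ioo_mem_nhdsGT hab)).exists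
  rw [slope_def_field, hca, sub_self, sub_zero, div_pos_iff_of_pos_right (sub_pos.2 ht.1),
    sub_pos] at ht_slope
  exact ⟨t, ht, hw.height_lt_of_graph_lt hb hr (hw.closedBall_subset hb hr ha) hc hcorb
    (hvs t (Ioo_subset_Icc_self ht)) ht_slope⟩

end FlowBox

theorem exists_isHeightIncreasing (hw : IsFoldWindow Xp p A q₁ ξ r₀) (hf : IsC1VisibleFold Xp Xm)
    {φ : ℝ → ℝ} (hφ : IsWeakTransition φ) :
    ∃ s > 0, ∀ ε > 0, IsHeightIncreasing Xp (regularized Xp Xm φ ε) ε s := by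
  obtain ⟨g, κ, r, s, hb, hr⟩ := hf.exists_isFlowBox hw.pos
  refine ⟨s, hb.pos, fun ε hε => ?_⟩
  have hZ := (locallyLipschitz_regularized hw.locallyLipschitz hf.locallyLipschitz_minus hφ
    ε).continuous
  have hcross : ∀ q ∈ Metric.closedBall (0 : ℝ × ℝ) r,
      (g q • Xp q).2 * (regularized Xp Xm φ ε q).1 ≤ (regularized Xp Xm φ ε q).2 := fun q hq => by
    rw [mul_comm, ← sub_nonneg, hb.regularized_snd_sub φ ε hq]
    exact mul_nonneg (hb.scale_pos q hq).le
      (mul_nonneg (by linarith [(hφ.mem_Icc (q.2 / ε)).2]) (hb.cross_pos q hq).le)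
  have hle : ∀ v a b, a ≤ b → IsSolOn (regularized Xp Xm φ ε) v (Icc a b) →
      (∀ t ∈ Icc a b, v t ∈ Metric.closedBall (0 : ℝ × ℝ) s) →
      height Xp (v a) ≤ height Xp (v b) := fun _ _ _ =>
    hw.height_le_of_cross_nonneg hb hr hZ hcross
  refine ⟨hle, fun v a b hab hv hvs hva => ?_⟩
  have ha := hb.closedBall_subset (hvs a (left_mem_Icc.2 hab.le))
  obtain ⟨t, ht, hlt⟩ := hw.exists_height_lt_of_cross_pos hb hr hab hv hvs <| by
    rw [hb.regularized_snd_sub φ ε ha]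
    exact mul_pos (hb.scale_pos _ ha) (mul_pos
      (by linarith [hφ.lt_one ((div_lt_one hε).2 hva)]) (hb.cross_pos _ ha))
  have hsub := Icc_subset_Icc_left (b := b) ht.1.le
  exact hlt.trans_le (hle v t b ht.2.le (hv.mono hsub) fun u hu => hvs u (hsub hu))

end IsFoldWindow

/-! ### Convergence to the tangent orbit -/

section LaSalle

variable {E F : Type*} [TopologicalSpace F] [T2Space F]

theorem IsSolOn.exists_isSolOn_of_tendsto [NormedAddCommGroup E] [NormedSpace ℝ E] [ProperSpace E]
    {Z : E → E} (hZ : LocallyLipschitz Z) {K : Set E} (hK : IsCompact K) {v : ℝ → E}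
    (hv : IsSolOn Z v (Ici 0)) (hvK : ∀ t ≥ 0, v t ∈ K) {H : E → F} (hH : ContinuousOn H K)
    {l : F} (hl : Tendsto (fun t => H (v t)) atTop (𝓝 l)) :
    ∃ z, IsSolOn Z z (Ici 0) ∧ ∀ t ≥ 0, z t ∈ K ∧ H (z t) = l := by
  obtain ⟨R, hR⟩ := hK.isBounded.subset_closedBall (0 : E)
  obtain ⟨Z', L, C, hL, hC, hZ'⟩ := exists_lipschitzWith_eqOn_closedBall hZ R
  obtain ⟨w, -, ψ, hψ, hψw⟩ := hK.tendsto_subseq fun n : ℕ => hvK n n.cast_nonneg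
  obtain ⟨z, rfl, hz⟩ := exists_global_solution hL hC w
  have hlim : ∀ T ≥ 0, Tendsto (fun n => v (T + ψ n)) atTop (𝓝 (z T)) := fun T hT => by
    rw [Metric.tendsto_nhds]
    intro δ hδ
    filter_upwards [hψw.eventually (IsSolOn.eventually_dist_lt_of_lipschitzWith hL
      (isSolOn_of_hasDerivAt hz (Icc 0 T)) hδ)] with n hn
    have hshift : IsSolOn Z (fun t => v (t + ψ n)) (Icc 0 T) :=
      hv.shift _ fun t ht => add_nonneg ht.1 (ψ n).cast_nonneg
    exact hn (fun t => v (t + ψ n)) (congrArg v (zero_add _)) (hshift.congr_field fun t ht =>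
      (hZ' (hR (hvK _ (add_nonneg ht.1 (ψ n).cast_nonneg)))).symm) T (right_mem_Icc.2 hT)
  have hmem : ∀ T ≥ 0, ∀ n, v (T + ψ n) ∈ K := fun T hT n =>
    hvK _ (add_nonneg hT (ψ n).cast_nonneg)
  have hzK : ∀ T ≥ 0, z T ∈ K := fun T hT =>
    hK.isClosed.mem_of_tendsto (hlim T hT) (Eventually.of_forall (hmem T hT))
  refine ⟨z, (isSolOn_of_hasDerivAt hz _).congr_field fun t ht => hZ' (hR (hzK t ht)),
    fun T hT => ⟨hzK T hT, ?_⟩⟩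
  exact tendsto_nhds_unique
    ((hH _ (hzK T hT)).tendsto.comp
      (tendsto_nhdsWithin_iff.2 ⟨hlim T hT, Eventually.of_forall (hmem T hT)⟩))
    (hl.comp (tendsto_atTop_add_const_left _ T
      (tendsto_natCast_atTop_atTop.comp hψ.tendsto_atTop)))

theorem tendsto_infDist_of_tendsto [PseudoMetricSpace E] {ι : Type*} {𝓕 : Filter ι} {K Γ : Set E}
    (hK : IsCompact K) {H : E → F} (hH : ContinuousOn H K) {l : F}
    (hΓ : ∀ z ∈ K, H z = l → z ∈ Γ) {u : ι → E} (huK : ∀ᶠ i in 𝓕, u i ∈ K)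
    (hu : Tendsto (fun i => H (u i)) 𝓕 (𝓝 l)) :
    Tendsto (fun i => Metric.infDist (u i) Γ) 𝓕 (𝓝 0) := by
  rw [Metric.tendsto_nhds]
  intro η hη
  have hfar : IsCompact (H '' (K ∩ {z | η ≤ Metric.infDist z Γ})) :=
    (hK.inter_right (isClosed_le continuous_const
      (Metric.continuous_infDist_pt Γ))).image_of_continuousOn (hH.mono inter_subset_left)
  have hl : l ∉ H '' (K ∩ {z | η ≤ Metric.infDist z Γ}) := by
    rintro ⟨z, ⟨hzK, hz⟩, hzl⟩
    exact hη.not_ge (hz.trans_eq (Metric.infDist_zero_of_mem (hΓ z hzK hzl)))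
  filter_upwards [huK, hu.eventually_mem (hfar.isClosed.isOpen_compl.mem_nhds hl)] with i hi hHi
  rw [Real.dist_eq, sub_zero, abs_of_nonneg Metric.infDist_nonneg]
  by_contra! hcon
  exact hHi ⟨u i, ⟨hi, hcon⟩, rfl⟩

end LaSalle

namespace IsFoldWindow

variable {X Y : ℝ × ℝ → ℝ × ℝ} {p q₁ z : ℝ × ℝ} {A : Set (ℝ × ℝ)} {ξ φ : ℝ → ℝ} {r₀ m ε s : ℝ}

theorem zero_mem (hw : IsFoldWindow X p A q₁ ξ r₀) : (0 : ℝ) ∈ Icc (-r₀) r₀ :=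
  ⟨neg_nonpos.2 hw.pos.le, hw.pos.le⟩

theorem mem_Icc_of_mem_Ioc (hw : IsFoldWindow X p A q₁ ξ r₀) (hε : ε ∈ Ioc 0 r₀) :
    ε ∈ Icc (-r₀) r₀ :=
  ⟨hw.zero_mem.1.trans hε.1.le, hε.2⟩

theorem exists_height_gap (hw : IsFoldWindow X p A q₁ ξ r₀) (hX0 : (X (0, 0)).2 = 0)
    (hs : 0 < s) : ∃ μ > 0, ∀ q ∈ hull p (orbit X q₁), |height X q| < μ → q.2 < μ →
      q ∈ Metric.ball (0 : ℝ × ℝ) s := by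
  have hfar : IsCompact (hull p (orbit X q₁) \ Metric.ball (0 : ℝ × ℝ) s) :=
    (hw.isNestedFoliation.isCompact_hull hw.mem).diff Metric.isOpen_ball
  have hcont : ContinuousOn (fun q => max |height X q| q.2)
      (hull p (orbit X q₁) \ Metric.ball (0 : ℝ × ℝ) s) :=
    ((hw.isCenter.continuousOn_height hw.locallyLipschitz hw.mem).mono sdiff_subset).abs.sup
      continuous_snd.continuousOn
  have hpos : ∀ z ∈ hull p (orbit X q₁) \ Metric.ball (0 : ℝ × ℝ) s,
      0 < max |height X z| z.2 := by
    rintro z ⟨hz, hzs⟩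
    by_contra! hle
    have hzA := hw.hull_subset hz
    have hheight : height X z = 0 := abs_nonpos_iff.1 ((le_max_left _ _).trans hle)
    have hsnd : z.2 = 0 := le_antisymm ((le_max_right _ _).trans hle)
      (hheight ▸ hw.isCenter.height_le_self hw.locallyLipschitz hzA)
    have hzX := hw.isCenter.snd_field_eq_zero hw.locallyLipschitz hzA
      (hw.isNestedFoliation.self_mem z hzA) (hsnd.trans hheight.symm)
    have hz0 : z = (0, 0) := (hw.unique 0 hw.zero_mem z hz hsnd hzX).trans
      (hw.unique 0 hw.zero_mem _ (hw.ball_subset (Metric.mem_closedBall_self hw.pos.le)) rfl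
        hX0).symm
    exact hzs (hz0 ▸ Metric.mem_ball_self hs)
  obtain ⟨μ, hμ, hμ_le⟩ := hfar.exists_forall_le' hcont hpos
  exact ⟨μ, hμ, fun q hq hheight hsnd => by_contra fun hqs =>
    (max_lt hheight hsnd).not_ge (hμ_le q ⟨hq, hqs⟩)⟩

theorem exists_periodic (hw : IsFoldWindow X p A q₁ ξ r₀) (hφ : IsWeakTransition φ)
    (hε : ε ∈ Ioc 0 r₀) :
    ∃ γ, γ 0 = (ξ ε, ε) ∧ orbit X (ξ ε, ε) = range γ ∧ IsPeriodicSol X γ ∧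
      IsPeriodicSol (regularized X Y φ ε) γ ∧ p ∈ curveInterior (range γ) ∧
      curveInterior (range γ) ⊆ A := by
  obtain ⟨hmem, hheight⟩ := hw.tangency (hw.mem_Icc_of_mem_Ioc hε)
  have hne : (ξ ε, ε) ≠ p := fun h => (hε.2.trans_lt hw.lt_center).ne (congrArg Prod.snd h)
  obtain ⟨γ, hγ, h0, horb, -, hp, hA⟩ :=
    hw.isCenter.exists_periodic hw.locallyLipschitz (hw.hull_subset hmem) hne
  refine ⟨γ, h0, horb, hγ, ⟨fun t => ?_, hγ.2⟩, hp, hA⟩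
  have hle := hw.isCenter.height_le hw.locallyLipschitz (hw.hull_subset hmem)
    (horb ▸ mem_range_self t)
  rw [regularized_of_ge hφ hε.1 (hheight.symm.trans_le hle)]
  exact hγ.1 t

end IsFoldWindow

/-- The data that force the solutions of `Z` which start in the annulus of heights between `-μ`
and `ε` to climb to the periodic orbit of height `ε`: above the line `y = ε` the fields `X` and `Z`
agree, and the part of the annulus below it lies in a square where heights increase. -/
structure IsHeightTrap (X Z : ℝ × ℝ → ℝ × ℝ) (p : ℝ × ℝ) (A : Set (ℝ × ℝ)) (q₁ : ℝ × ℝ)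
    (ξ : ℝ → ℝ) (r₀ ε μ s : ℝ) : Prop where
  window : IsFoldWindow X p A q₁ ξ r₀
  locallyLipschitz : LocallyLipschitz Z
  eq_field : ∀ q : ℝ × ℝ, ε ≤ q.2 → Z q = X q
  increasing : IsHeightIncreasing X Z ε s
  gap : ∀ q ∈ hull p (orbit X q₁), |height X q| < μ → q.2 < μ → q ∈ Metric.ball (0 : ℝ × ℝ) s
  mem : ε ∈ Ioo 0 μ
  le : μ ≤ r₀

namespace IsHeightTrap

variable {X Z : ℝ × ℝ → ℝ × ℝ} {p q q₁ z : ℝ × ℝ} {A : Set (ℝ × ℝ)} {ξ : ℝ → ℝ}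
  {r₀ ε μ s R a b : ℝ} {v : ℝ → ℝ × ℝ}

theorem mem_Ioc (ht : IsHeightTrap X Z p A q₁ ξ r₀ ε μ s) : ε ∈ Ioc 0 r₀ :=
  ⟨ht.mem.1, ht.mem.2.le.trans ht.le⟩

theorem continuousOn_height (ht : IsHeightTrap X Z p A q₁ ξ r₀ ε μ s) :
    ContinuousOn (height X) (hull p (orbit X q₁)) :=
  ht.window.isCenter.continuousOn_height ht.window.locallyLipschitz ht.window.mem

theorem isCompact_hull (ht : IsHeightTrap X Z p A q₁ ξ r₀ ε μ s) :
    IsCompact (hull p (orbit X q₁)) :=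
  ht.window.isNestedFoliation.isCompact_hull ht.window.mem

theorem mem_ball (ht : IsHeightTrap X Z p A q₁ ξ r₀ ε μ s) (hz : z ∈ hull p (orbit X q₁))
    (hlow : -μ < height X z) (hlt : height X z < ε) (hsnd : z.2 ≤ ε) :
    z ∈ Metric.ball (0 : ℝ × ℝ) s :=
  ht.gap z hz (abs_lt.2 ⟨hlow, hlt.trans ht.mem.2⟩) (hsnd.trans_lt ht.mem.2)

theorem mem_orbit (ht : IsHeightTrap X Z p A q₁ ξ r₀ ε μ s) (hz : z ∈ hull p (orbit X q₁))
    (hzε : height X z = ε) : z ∈ orbit X (ξ ε, ε) :=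
  ht.window.orbit_eq (ht.window.mem_Icc_of_mem_Ioc ht.mem_Ioc) hz hzε ▸
    ht.window.isNestedFoliation.self_mem z (ht.window.hull_subset hz)

theorem exists_solution (ht : IsHeightTrap X Z p A q₁ ξ r₀ ε μ s) (hz : z ∈ hull p (orbit X q₁))
    (hzε : height X z = ε) : ∃ γ : ℝ → ℝ × ℝ, γ 0 = z ∧ (∀ t, HasDerivAt γ (Z (γ t)) t) ∧
      ∀ t, height X (γ t) = ε := by
  have hzA := ht.window.hull_subset hz
  obtain ⟨γ, h0, hγ, -⟩ := ht.window.isCenter.exists_solution ht.window.locallyLipschitz hzA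
  have horb : ∀ t, γ t ∈ orbit X z := fun t =>
    orbit_eq_range ht.window.locallyLipschitz hγ ⟨0, h0⟩ ▸ mem_range_self t
  refine ⟨γ, h0, fun t => ?_, fun t => ?_⟩
  · rw [ht.eq_field _ (hzε ▸ ht.window.isCenter.height_le ht.window.locallyLipschitz hzA (horb t))]
    exact hγ t
  · rw [ht.window.isCenter.height_eq_of_mem ht.window.locallyLipschitz hzA (horb t), hzε]

theorem height_ne (ht : IsHeightTrap X Z p A q₁ ξ r₀ ε μ s) (hab : a ≤ b)
    (hv : IsSolOn Z v (Icc a b)) (hvb : v b ∈ hull p (orbit X q₁)) (ha : height X (v a) ≠ ε) :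
    height X (v b) ≠ ε := fun hb => by
  obtain ⟨γ, h0, hγ, hheight⟩ := ht.exists_solution hvb hb
  have heq := IsSolOn.eqOn_left ht.locallyLipschitz hv
    (isSolOn_of_hasDerivAt (fun t => (hγ (t - b)).comp_sub_const t b) _)
    (by rw [sub_self, h0]) (left_mem_Icc.2 hab)
  exact ha (heq ▸ hheight (a - b))

theorem eventually_height_le (ht : IsHeightTrap X Z p A q₁ ξ r₀ ε μ s) (hab : a < b)
    (hv : IsSolOn Z v (Icc a b)) (hva : v a ∈ hull p (orbit X q₁)) (hlow : -μ < height X (v a))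
    (hlt : height X (v a) < ε) : ∀ᶠ t in 𝓝[≥] a, height X (v a) ≤ height X (v t) := by
  have hcont : Tendsto v (𝓝[≥] a) (𝓝 (v a)) := by
    rw [← nhdsWithin_Icc_eq_nhdsGE hab]
    exact hv.continuousOn a (left_mem_Icc.2 hab.le)
  rcases le_or_gt (v a).2 ε with hsnd | hsnd
  · obtain ⟨u, hu, hball⟩ := mem_nhdsGE_iff_exists_Icc_subset.1 <|
      (hcont.eventually_mem (Metric.isOpen_ball.mem_nhds (ht.mem_ball hva hlow hlt hsnd))).and
        (Icc_mem_nhdsGE hab)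
    filter_upwards [Icc_mem_nhdsGE hu] with t hat
    exact ht.increasing.le v a t hat.1 (hv.mono fun r hr => (hball ⟨hr.1, hr.2.trans hat.2⟩).2)
      fun r hr => Metric.ball_subset_closedBall (hball ⟨hr.1, hr.2.trans hat.2⟩).1
  · obtain ⟨u, hu, habove⟩ := mem_nhdsGE_iff_exists_Icc_subset.1 <|
      ((continuous_snd.tendsto _).comp hcont |>.eventually_const_lt hsnd).and (Icc_mem_nhdsGE hab)
    filter_upwards [Icc_mem_nhdsGE hu] with t hat
    have hvX : IsSolOn X v (Icc a t) :=
      IsSolOn.congr_field (hv.mono fun r hr => (habove ⟨hr.1, hr.2.trans hat.2⟩).2) fun r hr =>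
        ht.eq_field _ (habove ⟨hr.1, hr.2.trans hat.2⟩).1.le
    have hvA := ht.window.hull_subset hva
    exact (ht.window.isCenter.height_eq_of_mem ht.window.locallyLipschitz hvA
      (ht.window.isCenter.mem_orbit_of_isSolOn ht.window.locallyLipschitz hvX hvA
        (right_mem_Icc.2 hat.1))).ge

theorem eventually_mem (ht : IsHeightTrap X Z p A q₁ ξ r₀ ε μ s)
    (hR : hull p (orbit X q₁) ⊆ Metric.closedBall 0 R) (hv : IsCurveIn Z R v)
    (hva : v a ∈ hull p (orbit X q₁)) (hlow : -μ < height X (v a)) (hlt : height X (v a) < ε) :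
    ∀ᶠ t in 𝓝[≥] a, v t ∈ hull p (orbit X q₁) ∧ height X (v t) ∈ Icc (height X (v a)) ε := by
  have hinside : v a ∈ inside p (orbit X q₁) :=
    ht.window.isCenter.mem_inside_of_height_lt ht.window.locallyLipschitz ht.window.mem hva
      (by linarith [ht.window.height_lt, ht.le])
  have hcont : Tendsto v (𝓝[≥] a) (𝓝 (v a)) :=
    hv.continuous.continuousAt.mono_left nhdsWithin_le_nhds
  have hhull : ∀ᶠ t in 𝓝[≥] a, v t ∈ hull p (orbit X q₁) :=
    (hcont.eventually_mem ((ht.window.isNestedFoliation.isOpen_inside ht.window.mem).mem_nhds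
      hinside)).mono fun _ => Or.inl
  have hle : ∀ᶠ t in 𝓝[≥] a, height X (v t) < ε :=
    ((ht.continuousOn_height _ hva).tendsto.comp
      (tendsto_nhdsWithin_iff.2 ⟨hcont, hhull⟩)).eventually_lt_const hlt
  obtain ⟨u, hu, hball⟩ := mem_nhdsGE_iff_exists_Icc_subset.1 hhull
  filter_upwards [hhull, hle, ht.eventually_height_le hu
    (hv.isSolOn fun t hat => hR (hball hat)) hva hlow hlt] with t hmem hε hge
  exact ⟨hmem, hge, hε.le⟩

theorem mem_of_nonneg (ht : IsHeightTrap X Z p A q₁ ξ r₀ ε μ s)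
    (hR : hull p (orbit X q₁) ⊆ Metric.closedBall 0 R) (hv : IsCurveIn Z R v)
    (hv0 : v 0 ∈ hull p (orbit X q₁)) (hlow : -μ < height X (v 0)) (hlt : height X (v 0) < ε)
    {t : ℝ} (ht0 : 0 ≤ t) :
    v t ∈ hull p (orbit X q₁) ∧ height X (v t) ∈ Ico (height X (v 0)) ε := by
  set S := hull p (orbit X q₁) ∩ height X ⁻¹' Icc (height X (v 0)) ε
  have hS : IsClosed S :=
    ht.continuousOn_height.preimage_isClosed_of_isClosed ht.isCompact_hull.isClosed isClosed_Icc
  have hne : ∀ T ≥ 0, (∀ r ∈ Icc 0 T, v r ∈ S) → height X (v T) < ε := fun T hT hvS =>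
    (hvS T (right_mem_Icc.2 hT)).2.2.lt_of_ne (ht.height_ne hT
      (hv.isSolOn fun r hr => hR (hvS r hr).1) (hvS T (right_mem_Icc.2 hT)).1 hlt.ne)
  have hvS : ∀ r ≥ 0, v r ∈ S := by
    by_contra! hexit
    obtain ⟨T, hT0, hT, hleave⟩ :=
      exists_exit_time hv.continuous hS ⟨hv0, le_rfl, hlt.le⟩ hexit
    obtain ⟨hvT, hle, -⟩ := hT T (right_mem_Icc.2 hT0)
    refine hleave (((ht.eventually_mem hR hv hvT (hlow.trans_le hle) (hne T hT0 hT)).filter_mono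
      (nhdsWithin_mono T Ioi_subset_Ici_self)).mono fun r hr => not_not.2 ?_)
    exact ⟨hr.1, hle.trans hr.2.1, hr.2.2⟩
  exact ⟨(hvS t ht0).1, (hvS t ht0).2.1, hne t ht0 fun r hr => hvS r hr.1⟩

theorem exists_climbing_solution (ht : IsHeightTrap X Z p A q₁ ξ r₀ ε μ s)
    (hq : q ∈ hull p (orbit X q₁)) (hlow : -μ < height X q) (hlt : height X q < ε) :
    ∃ v, v 0 = q ∧ IsSolOn Z v (Ici 0) ∧
      (∀ t ≥ 0, v t ∈ hull p (orbit X q₁) ∧ height X (v t) < ε) ∧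
      MonotoneOn (fun t => height X (v t)) (Ici 0) := by
  obtain ⟨R, hR⟩ := ht.isCompact_hull.isBounded.subset_closedBall (0 : ℝ × ℝ)
  obtain ⟨v, rfl, hv⟩ := exists_isCurveIn ht.locallyLipschitz R q
  have hmem : ∀ t ≥ 0, v t ∈ hull p (orbit X q₁) ∧ height X (v t) ∈ Ico (height X (v 0)) ε :=
    fun t => ht.mem_of_nonneg hR hv hq hlow hlt
  refine ⟨v, rfl, hv.isSolOn fun t ht0 => hR (hmem t ht0).1,
    fun t ht0 => ⟨(hmem t ht0).1, (hmem t ht0).2.2⟩, fun a ha b _ hab => ?_⟩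
  obtain ⟨hva, hva_low, hva_lt⟩ := hmem a ha
  have hshift := (ht.mem_of_nonneg hR (hv.shift a) (by rwa [zero_add])
    (by rw [zero_add]; exact hlow.trans_le hva_low) (by rwa [zero_add]) (sub_nonneg.2 hab)).2.1
  rwa [zero_add, sub_add_cancel] at hshift

theorem exists_snd_lt (ht : IsHeightTrap X Z p A q₁ ξ r₀ ε μ s) {z : ℝ → ℝ × ℝ}
    (hz : IsSolOn Z z (Ici 0)) (hz0 : z 0 ∈ hull p (orbit X q₁)) (hlt : height X (z 0) < ε) :
    ∃ t ≥ 0, (z t).2 < ε := by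
  by_contra! habove
  have hzA := ht.window.hull_subset hz0
  obtain ⟨γ, h0, hγ, horb⟩ :=
    ht.window.isCenter.exists_solution ht.window.locallyLipschitz hzA
  obtain ⟨w, hw, hw_snd⟩ :=
    ht.window.isCenter.exists_height_eq ht.window.locallyLipschitz hzA
  rw [horb] at hw
  obtain ⟨τ, hτ, rfl⟩ := hw
  have hzX : IsSolOn X z (Icc 0 τ) := IsSolOn.congr_field (hz.mono Icc_subset_Ici_self) fun t hat =>
    ht.eq_field _ (habove t hat.1)
  have heq := IsSolOn.eqOn_right ht.window.locallyLipschitz hzX (isSolOn_of_hasDerivAt hγ _)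
    h0.symm (right_mem_Icc.2 hτ)
  exact hlt.not_ge (hw_snd ▸ heq ▸ habove τ hτ)

theorem le_of_height_eq (ht : IsHeightTrap X Z p A q₁ ξ r₀ ε μ s) {z : ℝ → ℝ × ℝ} {l : ℝ}
    (hz : IsSolOn Z z (Ici 0)) (hzl : ∀ t ≥ 0, z t ∈ hull p (orbit X q₁) ∧ height X (z t) = l)
    (hl : -μ < l) : ε ≤ l := by
  by_contra! hlt
  obtain ⟨t, ht0, hsnd⟩ := ht.exists_snd_lt hz (hzl 0 le_rfl).1 ((hzl 0 le_rfl).2.trans_lt hlt)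
  have hball : z t ∈ Metric.ball 0 s :=
    ht.mem_ball (hzl t ht0).1 (hl.trans_eq (hzl t ht0).2.symm) ((hzl t ht0).2.trans_lt hlt) hsnd.le
  have hcont : ContinuousWithinAt z (Ici t) t := (hz.continuousOn t ht0).mono (Ici_subset_Ici.2 ht0)
  obtain ⟨u, hu, hstay⟩ := mem_nhdsGE_iff_exists_Icc_subset.1
    (hcont.eventually_mem (Metric.isOpen_ball.mem_nhds hball))
  have hincr := ht.increasing.lt z t u hu (hz.mono fun r hr => ht0.trans hr.1)
    (fun r hr => Metric.ball_subset_closedBall (hstay hr)) hsnd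
  exact hincr.ne ((hzl t ht0).2.trans (hzl u (ht0.trans (le_of_lt hu))).2.symm)

theorem isAttracted (ht : IsHeightTrap X Z p A q₁ ξ r₀ ε μ s) (hq : q ∈ hull p (orbit X q₁))
    (hlow : -μ < height X q) (hlt : height X q < ε) : IsAttracted Z q (orbit X (ξ ε, ε)) := by
  obtain ⟨v, rfl, hv, hmem, hmono⟩ := ht.exists_climbing_solution hq hlow hlt
  set l := ⨆ t : ℝ, height X (v (max t 0))
  have hbdd : BddAbove (range fun t : ℝ => height X (v (max t 0))) :=
    ⟨ε, forall_mem_range.2 fun t => (hmem _ (le_max_right t 0)).2.le⟩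
  have hlim : Tendsto (fun t => height X (v t)) atTop (𝓝 l) := by
    refine (tendsto_atTop_ciSup (fun a b hab => ?_) hbdd).congr' ?_
    · exact hmono (le_max_right a 0) (le_max_right b 0) (max_le_max_right 0 hab)
    · filter_upwards [eventually_ge_atTop 0] with t ht0 using by rw [max_eq_left ht0]
  have hl_le : l ≤ ε := ciSup_le fun t => (hmem _ (le_max_right t 0)).2.le
  have hl_low : -μ < l := hlow.trans_le
    ((congrArg (fun t => height X (v t)) (max_self 0)).symm.trans_le (le_ciSup hbdd 0))
  obtain ⟨z, hz, hzl⟩ := hv.exists_isSolOn_of_tendsto ht.locallyLipschitz ht.isCompact_hull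
    (fun t ht0 => (hmem t ht0).1) ht.continuousOn_height hlim
  have hl : l = ε := hl_le.antisymm (ht.le_of_height_eq hz hzl hl_low)
  refine ⟨v, rfl, fun t ht0 => hv t ht0, ?_⟩
  exact tendsto_infDist_of_tendsto ht.isCompact_hull ht.continuousOn_height
    (fun w hw hwε => ht.mem_orbit hw hwε)
    ((eventually_ge_atTop 0).mono fun t ht0 => (hmem t ht0).1) (hl ▸ hlim)

end IsHeightTrap

theorem IsFoldWindow.exists_isHeightTrap {Xp Xm : ℝ × ℝ → ℝ × ℝ} {p q₁ : ℝ × ℝ} {A : Set (ℝ × ℝ)}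
    {ξ φ : ℝ → ℝ} {r₀ : ℝ} (hw : IsFoldWindow Xp p A q₁ ξ r₀) (hf : IsC1VisibleFold Xp Xm)
    (hφ : IsWeakTransition φ) : ∃ μ > 0, μ ≤ r₀ ∧ ∃ s, ∀ ε ∈ Ioo 0 μ,
      IsHeightTrap Xp (regularized Xp Xm φ ε) p A q₁ ξ r₀ ε μ s := by
  obtain ⟨s, hs, hincr⟩ := hw.exists_isHeightIncreasing hf hφ
  obtain ⟨μ, hμ, hgap⟩ := hw.exists_height_gap hf.tangent hs
  refine ⟨min μ r₀, lt_min hμ hw.pos, min_le_right _ _, s, fun ε hε =>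
    ⟨hw, locallyLipschitz_regularized hw.locallyLipschitz hf.locallyLipschitz_minus hφ ε,
      fun q hq => regularized_of_ge hφ hε.1 hq, hincr ε hε.1, fun q hq hheight hsnd => ?_, hε,
      min_le_right _ _⟩⟩
  exact hgap q hq (hheight.trans_le (min_le_left _ _)) (hsnd.trans_le (min_le_left _ _))

/-! ### The sliding funnel -/

theorem exists_contDiff_fderiv_eq {a b : ℝ → ℝ} (ha : ContDiff ℝ 1 a) (hb : Continuous b) :
    ∃ L : ℝ × ℝ → ℝ, ContDiff ℝ 1 L ∧
      ∀ (x : ℝ) (w : ℝ × ℝ), fderiv ℝ L (x, 0) w = b x * w.1 + a x * w.2 := by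
  have hI : ∀ x, HasDerivAt (fun x => ∫ t in (0 : ℝ)..x, b t) (b x) x := fun x =>
    (hb.integral_hasStrictDerivAt 0 x).hasDerivAt
  have hI_contDiff : ContDiff ℝ 1 fun x => ∫ t in (0 : ℝ)..x, b t := by
    refine contDiff_one_iff_deriv.2 ⟨fun x => (hI x).differentiableAt, ?_⟩
    rwa [show deriv (fun x => ∫ t in (0 : ℝ)..x, b t) = b from funext fun x => (hI x).deriv]
  refine ⟨fun q => (∫ t in (0 : ℝ)..q.1, b t) + a q.1 * q.2,
    (hI_contDiff.comp contDiff_fst).add ((ha.comp contDiff_fst).mul contDiff_snd), fun x w => ?_⟩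
  have hfst : HasFDerivAt Prod.fst (ContinuousLinearMap.fst ℝ ℝ ℝ) (x, (0 : ℝ)) := hasFDerivAt_fst
  have hsnd : HasFDerivAt Prod.snd (ContinuousLinearMap.snd ℝ ℝ ℝ) (x, (0 : ℝ)) := hasFDerivAt_snd
  have ha_deriv : HasDerivAt a (deriv a x) x := (ha.differentiable one_ne_zero x).hasDerivAt
  have hL := ((hI x).comp_hasFDerivAt (x, (0 : ℝ)) hfst).add
    ((ha_deriv.comp_hasFDerivAt (x, (0 : ℝ)) hfst).mul hsnd)
  exact (DFunLike.congr_fun hL.fderiv w).trans (by simp)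

theorem exists_lt_of_fderiv_pos {L : ℝ × ℝ → ℝ} (hL : ContDiff ℝ 1 L) {l m r : ℝ} (hlm : l < m)
    (hmr : m ≤ r) (hpos : ∀ x ∈ Icc l r, 0 < fderiv ℝ L (x, 0) (1, 0)) :
    ∃ κ, L (l, 0) < κ ∧ ∀ x ∈ Icc m r, κ < L (x, 0) := by
  have hderiv : ∀ x, HasDerivAt (fun x => L (x, 0)) (fderiv ℝ L (x, 0) (1, 0)) x := fun x =>
    (hL.differentiable one_ne_zero (x, 0)).hasFDerivAt.comp_hasDerivAt (f := fun x : ℝ => (x, 0)) x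
      ((hasDerivAt_id x).prodMk (hasDerivAt_const x 0))
  have hmono : StrictMonoOn (fun x => L (x, 0)) (Icc l r) :=
    strictMonoOn_of_hasDerivWithinAt_pos (convex_Icc l r)
      (hL.continuous.comp (by fun_prop)).continuousOn
      (fun x _ => (hderiv x).hasDerivWithinAt) fun x hx => hpos x (interior_subset hx)
  obtain ⟨κ, hlκ, hκm⟩ := exists_between (hmono ⟨le_rfl, hlm.le.trans hmr⟩ ⟨hlm.le, hmr⟩ hlm)
  exact ⟨κ, hlκ, fun x hx => hκm.trans_le
    (hmono.monotoneOn ⟨hlm.le, hmr⟩ ⟨hlm.le.trans hx.1, hx.2⟩ hx.1)⟩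

/-- A box around the switching line that the orbits of `Z` can only leave through its right side,
provided that they start in the region `κ ≤ L`: `L` increases along the orbits, they cross the top
and the bottom inwards, and `L < κ` on the left side. -/
structure IsFunnel (Z : ℝ × ℝ → ℝ × ℝ) (L : ℝ × ℝ → ℝ) (l r η κ : ℝ) : Prop where
  contDiff : ContDiff ℝ 1 L
  pos : ∀ q ∈ Icc l r ×ˢ Icc (-η) η, 0 < fderiv ℝ L q (Z q)
  top : ∀ x ∈ Icc l r, (Z (x, η)).2 < 0
  bottom : ∀ x ∈ Icc l r, 0 < (Z (x, -η)).2
  left : ∀ y ∈ Icc (-η) η, L (l, y) < κ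

namespace IsFunnel

variable {Z : ℝ × ℝ → ℝ × ℝ} {L : ℝ × ℝ → ℝ} {l r η κ : ℝ} {v : ℝ → ℝ × ℝ}

theorem hasDerivAt_comp (h : IsFunnel Z L l r η κ) {t : ℝ} (hv : HasDerivAt v (Z (v t)) t) :
    HasDerivAt (fun t => L (v t)) (fderiv ℝ L (v t) (Z (v t))) t :=
  (h.contDiff.differentiable one_ne_zero (v t)).hasFDerivAt.comp_hasDerivAt t hv

theorem exists_notMem (h : IsFunnel Z L l r η κ) (hZ : Continuous Z) {R : ℝ}
    (hR : Icc l r ×ˢ Icc (-η) η ⊆ Metric.closedBall 0 R) (hv : IsCurveIn Z R v) :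
    ∃ t, 0 ≤ t ∧ v t ∉ Icc l r ×ˢ Icc (-η) η := by
  have hcompact : IsCompact (Icc l r ×ˢ Icc (-η) η) := isCompact_Icc.prod isCompact_Icc
  have hcont : Continuous fun q => fderiv ℝ L q (Z q) :=
    (h.contDiff.continuous_fderiv one_ne_zero).clm_apply hZ
  obtain ⟨c, hc, hcle⟩ := hcompact.exists_forall_le' hcont.continuousOn h.pos
  by_contra! hmem
  refine not_bddAbove_image_Ici_of_le_deriv hc
    (fun t ht => h.hasDerivAt_comp (hv.hasDerivAt t (hR (hmem t ht))))
    (fun t ht => hcle _ (hmem t ht)) ?_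
  refine (hcompact.bddAbove_image h.contDiff.continuous.continuousOn).mono ?_
  rintro _ ⟨t, ht, rfl⟩
  exact mem_image_of_mem L (hmem t ht)

theorem eventually_mem (h : IsFunnel Z L l r η κ) {T : ℝ} (hv : HasDerivAt v (Z (v T)) T)
    (hT : (v T).1 ∈ Ioo l r) (hT' : (v T).2 ∈ Icc (-η) η) :
    ∀ᶠ t in 𝓝[>] T, v t ∈ Icc l r ×ˢ Icc (-η) η := by
  have hfst : ∀ᶠ t in 𝓝[>] T, (v t).1 ∈ Ioo l r :=
    mem_nhdsWithin_of_mem_nhds (hv.continuousAt.fst.eventually_mem (isOpen_Ioo.mem_nhds hT))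
  have hv_snd : HasDerivWithinAt (fun t => (v t).2) (Z (v T)).2 (Ioi T) T :=
    hv.hasDerivWithinAt.snd
  have htop : ∀ᶠ t in 𝓝[>] T, (v t).2 ≤ η := by
    rcases hT'.2.lt_or_eq with hlt | heq
    · exact mem_nhdsWithin_of_mem_nhds (hv.continuousAt.snd.eventually_le_const hlt)
    · have hneg := h.top _ (Ioo_subset_Icc_self hT)
      rw [← heq] at hneg
      exact (eventually_lt_of_hasDerivWithinAt_neg hv_snd hneg).mono fun t ht => ht.le.trans heq.le
  have hbottom : ∀ᶠ t in 𝓝[>] T, -η ≤ (v t).2 := by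
    rcases hT'.1.lt_or_eq with hlt | heq
    · exact mem_nhdsWithin_of_mem_nhds (hv.continuousAt.snd.eventually_const_le hlt)
    · have hpos := h.bottom _ (Ioo_subset_Icc_self hT)
      rw [heq] at hpos
      exact (eventually_gt_of_hasDerivWithinAt_pos hv_snd hpos).mono fun t ht => heq.le.trans ht.le
  filter_upwards [hfst, htop, hbottom] with t ht₁ ht₂ ht₃
  exact ⟨Ioo_subset_Icc_self ht₁, ht₃, ht₂⟩

theorem reaches (h : IsFunnel Z L l r η κ) (hZ : LocallyLipschitz Z) {q : ℝ × ℝ}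
    (hq : q ∈ Icc l r ×ˢ Icc (-η) η) (hκ : κ ≤ L q) : Reaches Z q ({r} ×ˢ Icc (-η) η) := by
  have hcompact : IsCompact (Icc l r ×ˢ Icc (-η) η) := isCompact_Icc.prod isCompact_Icc
  obtain ⟨R, hR⟩ := hcompact.isBounded.subset_closedBall 0
  obtain ⟨v, rfl, hv⟩ := exists_isCurveIn hZ R q
  obtain ⟨T, hT0, hT, hexit⟩ := exists_exit_time hv.continuous hcompact.isClosed hq
    (h.exists_notMem hZ.continuous hR hv)
  have hderiv : ∀ t ∈ Icc 0 T, HasDerivAt v (Z (v t)) t := fun t ht =>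
    hv.hasDerivAt t (hR (hT t ht))
  have hTmem : T ∈ Icc 0 T := right_mem_Icc.2 hT0
  have hmono : MonotoneOn (fun t => L (v t)) (Icc 0 T) :=
    monotoneOn_of_hasDerivWithinAt_nonneg (convex_Icc 0 T)
      (h.contDiff.continuous.comp hv.continuous).continuousOn
      (fun t ht => (h.hasDerivAt_comp (hderiv t (interior_subset ht))).hasDerivWithinAt)
      fun t ht => (h.pos _ (hT t (interior_subset ht))).le
  have hleft : (v T).1 ≠ l := fun heq => by
    have hlt := h.left _ (hT T hTmem).2
    rw [← heq] at hlt
    exact hlt.not_ge (hκ.trans (hmono (left_mem_Icc.2 hT0) hTmem hT0))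
  have hright : (v T).1 = r := by
    by_contra hne
    obtain ⟨hfst, hsnd⟩ := hT T hTmem
    exact hexit ((h.eventually_mem (hderiv T hTmem)
      ⟨hfst.1.lt_of_ne' hleft, hfst.2.lt_of_ne hne⟩ hsnd).mono fun t ht => not_not.2 ht)
  exact ⟨T, v, hT0, rfl, fun t ht => (hderiv t ht).hasDerivWithinAt, hright, (hT T hTmem).2⟩

end IsFunnel

namespace IsC1VisibleFold

variable {Xp Xm : ℝ × ℝ → ℝ × ℝ} {φ : ℝ → ℝ} {M N δ : ℝ}

theorem snd_plus_nonpos (hf : IsC1VisibleFold Xp Xm) {x : ℝ} (hx : x ≤ 0) : (Xp (x, 0)).2 ≤ 0 := by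
  rcases hx.lt_or_eq with hlt | rfl
  exacts [(hf.down x hlt).le, hf.tangent.le]

/- On the switching line `dL = (X⁻₂ - X⁺₂) dx - (X⁻₁ - X⁺₁) dy`, which takes on both `X⁺` and `X⁻`
the value of the determinant in the sliding condition. -/
theorem exists_increasing_on_strip (hf : IsC1VisibleFold Xp Xm) (hM : 0 ≤ M)
    (hsl : ∀ x ∈ Icc (-M) 0, SlidesRight Xp Xm x) :
    ∃ L : ℝ × ℝ → ℝ, ContDiff ℝ 1 L ∧ ∃ η > 0, ∀ q ∈ Icc (-M - η) (0 + η) ×ˢ Icc (-η) η,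
      (0 < fderiv ℝ L q (Xp q) ∧ 0 < fderiv ℝ L q (Xm q)) ∧
        0 < fderiv ℝ L q (1, 0) ∧ 0 < (Xm q).2 := by
  have hp := hf.contDiff_plus
  have hm := hf.contDiff_minus
  have hpc := hp.continuous
  have hmc := hm.continuous
  obtain ⟨L, hL, hLd⟩ := exists_contDiff_fderiv_eq
    (a := fun x => (Xp (x, 0)).1 - (Xm (x, 0)).1) (b := fun x => (Xm (x, 0)).2 - (Xp (x, 0)).2)
    (by fun_prop) (by fun_prop)
  have hLc : ∀ X : ℝ × ℝ → ℝ × ℝ, Continuous X → Continuous fun q => fderiv ℝ L q (X q) :=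
    fun X hX => (hL.continuous_fderiv one_ne_zero).clm_apply hX
  refine ⟨L, hL, exists_strip_subset
    (((isOpen_lt continuous_const (hLc Xp hpc)).inter
      (isOpen_lt continuous_const (hLc Xm hmc))).inter
      ((isOpen_lt continuous_const (hLc _ continuous_const)).inter
        (isOpen_lt continuous_const hmc.snd))) (neg_nonpos.2 hM) fun x hx => ?_⟩
  obtain ⟨hpos, hcross⟩ := hsl x hx
  have hnonpos := hf.snd_plus_nonpos hx.2
  refine ⟨⟨?_, ?_⟩, ?_, hpos⟩ <;> refine (hLd x _).symm ▸ ?_ <;> linarith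

theorem exists_isFunnel (hf : IsC1VisibleFold Xp Xm) (hφ : IsWeakTransition φ) (hM : 0 ≤ M)
    (hsl : ∀ x ∈ Icc (-M) 0, SlidesRight Xp Xm x) {r : ℝ} (hr : r < 0) :
    ∃ (L : ℝ × ℝ → ℝ) (l κ : ℝ), l < -M ∧ (∀ x ∈ Icc (-M) 0, κ < L (x, 0)) ∧
      ∀ᶠ η in 𝓝[>] 0, ∀ ε ∈ Ioc 0 η, IsFunnel (regularized Xp Xm φ ε) L l r η κ := by
  obtain ⟨L, hL, η₁, hη₁, hstrip⟩ := hf.exists_increasing_on_strip hM hsl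
  set l := -M - η₁
  have hlM : l < -M := sub_lt_self _ hη₁
  obtain ⟨κ, hlκ, hκ⟩ := exists_lt_of_fderiv_pos hL hlM (neg_nonpos.2 hM) fun x hx =>
    (hstrip (x, 0) ⟨⟨hx.1, by linarith [hx.2]⟩, by simp [hη₁.le]⟩).2.1
  obtain ⟨η₂, hη₂, hdown⟩ := exists_strip_subset (a := min l r) (b := r)
    (isOpen_lt hf.locallyLipschitz_plus.continuous.snd continuous_const) (min_le_right _ _)
    fun x hx => hf.down x (hx.2.trans_lt hr)
  have hleft : ∀ᶠ y in 𝓝 (0 : ℝ), L (l, y) < κ :=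
    (hL.continuous.comp (by fun_prop : Continuous fun y : ℝ => (l, y))).tendsto 0
      |>.eventually_lt_const hlκ
  obtain ⟨η₃, hη₃, hleft⟩ := Metric.nhds_basis_closedBall.mem_iff.1 hleft
  refine ⟨L, l, κ, hlM, hκ, ?_⟩
  filter_upwards [Ioo_mem_nhdsGT (lt_min hη₁ (lt_min hη₂ hη₃))] with η hη ε hε
  obtain ⟨hη0, hη⟩ := hη
  simp only [lt_min_iff] at hη
  have hbox : ∀ q ∈ Icc l r ×ˢ Icc (-η) η, q ∈ Icc (-M - η₁) (0 + η₁) ×ˢ Icc (-η₁) η₁ :=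
    fun q hq => ⟨⟨hq.1.1, by linarith [hq.1.2]⟩, by linarith [hq.2.1], by linarith [hq.2.2]⟩
  refine ⟨hL, fun q hq => ?_, fun x hx => ?_, fun x hx => ?_, fun y hy => hleft ?_⟩
  · obtain ⟨hpos_p, hpos_m⟩ := (hstrip q (hbox q hq)).1
    exact (convex_halfSpace_gt (fderiv ℝ L q).isBoundedLinearMap.toIsLinearMap 0).segment_subset
      hpos_p hpos_m (regularized_mem_segment hφ)
  · rw [regularized_of_ge hφ hε.1 hε.2]
    exact hdown ⟨⟨by linarith [min_le_left l r, hx.1], by linarith [hx.2]⟩,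
      by linarith [hη.2.1], hη.2.1.le⟩
  · rw [regularized_of_le hφ hε.1 (neg_le_neg hε.2)]
    exact (hstrip _ (hbox (x, -η) ⟨hx, le_rfl, by linarith⟩)).2.2
  · rw [Metric.mem_closedBall, Real.dist_0_eq_abs, abs_le]
    exact ⟨by linarith [hy.1, hη.2.2], by linarith [hy.2, hη.2.2]⟩

theorem exists_reaches_of_slidesRight (hf : IsC1VisibleFold Xp Xm) (hφ : IsWeakTransition φ)
    (hM : 0 ≤ M) (hsl : ∀ x ∈ Icc (-M) 0, SlidesRight Xp Xm x) (hδ : 0 < δ) :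
    ∃ G, IsOpen G ∧ Icc (-M) 0 ×ˢ {(0 : ℝ)} ⊆ G ∧ ∀ᶠ ε in 𝓝[>] (0 : ℝ), ∀ q ∈ G,
      Reaches (regularized Xp Xm φ ε) q (Metric.ball 0 δ) := by
  obtain ⟨L, l, κ, hlM, hκ, hfunnel⟩ :=
    hf.exists_isFunnel hφ hM hsl (r := -(δ / 2)) (by linarith)
  obtain ⟨η, hfunnel, hη0, hηδ⟩ := (hfunnel.and (Ioo_mem_nhdsGT hδ)).exists
  have hball : ∀ q : ℝ × ℝ, q.1 ∈ Ico (-(δ / 2)) δ → q.2 ∈ Icc (-η) η → q ∈ Metric.ball 0 δ := by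
    intro q hfst hsnd
    rw [mem_ball_zero_iff, Prod.norm_def, max_lt_iff, Real.norm_eq_abs, Real.norm_eq_abs, abs_lt,
      abs_lt]
    exact ⟨⟨by linarith [hfst.1], hfst.2⟩, by linarith [hsnd.1], by linarith [hsnd.2]⟩
  have hL : IsOpen {q | κ < L q} :=
    isOpen_lt continuous_const (hfunnel η ⟨hη0, le_rfl⟩).contDiff.continuous
  refine ⟨{q | κ < L q} ∩ Ioo l δ ×ˢ Ioo (-η) η, hL.inter (isOpen_Ioo.prod isOpen_Ioo), ?_, ?_⟩
  · rintro ⟨x, y⟩ ⟨hx, rfl⟩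
    exact ⟨hκ x hx, ⟨hlM.trans_le hx.1, hx.2.trans_lt hδ⟩, neg_lt_zero.2 hη0, hη0⟩
  filter_upwards [Ioc_mem_nhdsGT hη0] with ε hε q ⟨hκq, hfst, hsnd⟩
  rcases le_or_gt (-(δ / 2)) q.1 with hright | hleft
  · exact .of_mem (hball q ⟨hright, hfst.2⟩ (Ioo_subset_Icc_self hsnd))
  · refine Reaches.trans ((hfunnel ε hε).reaches (locallyLipschitz_regularized
      hf.locallyLipschitz_plus hf.locallyLipschitz_minus hφ ε)
      ⟨⟨hfst.1.le, hleft.le⟩, Ioo_subset_Icc_self hsnd⟩ hκq.le) fun w hw => ?_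
    have hw_fst : w.1 = -(δ / 2) := hw.1
    exact .of_mem (hball w ⟨hw_fst.ge, by linarith⟩ hw.2)

end IsC1VisibleFold

/-! ### Returning orbits -/

theorem reaches_of_le_snd {Z : ℝ × ℝ → ℝ × ℝ} (hZ : LocallyLipschitz Z) {q : ℝ × ℝ}
    {r B T c h : ℝ} (hB : ∀ w ∈ Metric.closedBall q r, ‖Z w‖ ≤ B)
    (hc : ∀ w ∈ Metric.closedBall q r, c ≤ (Z w).2) (hr : 0 ≤ r) (hT : 0 ≤ T) (hBT : B * T < r)
    (hqh : q.2 ≤ h) (hhq : h ≤ q.2 + c * T) :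
    Reaches Z q (Metric.closedBall q r ∩ {w | w.2 = h}) := by
  obtain ⟨R, hR⟩ := (Metric.isBounded_closedBall (x := q) (r := r)).subset_closedBall 0
  obtain ⟨v, rfl, hv⟩ := exists_isCurveIn hZ R q
  have hB0 : 0 ≤ B := (norm_nonneg _).trans (hB _ (Metric.mem_closedBall_self hr))
  have hstay : ∀ t ∈ Icc 0 T, v t ∈ Metric.closedBall (v 0) r :=
    mem_closedBall_of_norm_deriv_le (v' := fun t => Z (v t)) hB0 hr hv.continuous
      (fun t ht => ⟨hv.hasDerivAt t (hR ht), hB _ ht⟩) hBT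
  have hderiv : ∀ t ∈ Icc 0 T, HasDerivAt v (Z (v t)) t := fun t ht =>
    hv.hasDerivAt t (hR (hstay t ht))
  have hderiv_snd : ∀ t ∈ Icc 0 T, HasDerivAt (fun t => (v t).2) (Z (v t)).2 t := fun t ht =>
    (hderiv t ht).snd
  have hcont : ContinuousOn (fun t => (v t).2) (Icc 0 T) := hv.continuous.snd.continuousOn
  have hgrow : c * (T - 0) ≤ (v T).2 - (v 0).2 := by
    refine (convex_Icc 0 T).mul_sub_le_image_sub_of_le_deriv hcont
      (fun t ht => (hderiv_snd t (interior_subset ht)).differentiableAt.differentiableWithinAt)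
      (fun t ht => ?_) 0 (left_mem_Icc.2 hT) T (right_mem_Icc.2 hT) hT
    rw [(hderiv_snd t (interior_subset ht)).deriv]
    exact hc _ (hstay t (interior_subset ht))
  obtain ⟨t, ht, hth⟩ := intermediate_value_Icc hT hcont ⟨hqh, by linarith⟩
  exact ⟨t, v, ht.1, rfl, fun s hs => (hderiv s ⟨hs.1, hs.2.trans ht.2⟩).hasDerivWithinAt,
    hstay t ht, hth⟩

theorem exists_reaches_strip_top {Xp Xm : ℝ × ℝ → ℝ × ℝ} (hXp : LocallyLipschitz Xp)
    (hXm : LocallyLipschitz Xm) {φ : ℝ → ℝ} (hφ : IsWeakTransition φ) {x₀ : ℝ}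
    (hp : 0 < (Xp (x₀, 0)).2) (hm : 0 < (Xm (x₀, 0)).2) {U : Set (ℝ × ℝ)} (hU : U ∈ 𝓝 (x₀, 0)) :
    ∃ V, IsOpen V ∧ (x₀, 0) ∈ V ∧ ∀ᶠ ε in 𝓝[>] (0 : ℝ), ∀ q ∈ V,
      Reaches (regularized Xp Xm φ ε) q (U ∩ {w | ε ≤ w.2}) := by
  obtain ⟨c, hc, hc_lt⟩ := exists_between (lt_min hp hm)
  obtain ⟨B, hB⟩ := exists_gt (max ‖Xp (x₀, 0)‖ ‖Xm (x₀, 0)‖)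
  rw [lt_min_iff] at hc_lt
  rw [max_lt_iff] at hB
  have hB0 : 0 < B := (norm_nonneg _).trans_lt hB.1
  have hp_tendsto := hXp.continuous.tendsto (x₀, 0)
  have hm_tendsto := hXm.continuous.tendsto (x₀, 0)
  obtain ⟨ρ, hρ, hball⟩ := Metric.nhds_basis_closedBall.mem_iff.1
    ((hp_tendsto.snd_nhds.eventually_const_lt hc_lt.1).and
      ((hm_tendsto.snd_nhds.eventually_const_lt hc_lt.2).and
        ((hp_tendsto.norm.eventually_lt_const hB.1).and
          ((hm_tendsto.norm.eventually_lt_const hB.2).and hU))))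
  set T := ρ / 4 / B
  have hT : 0 < T := by positivity
  have hBT : B * T < ρ / 2 := by
    rw [mul_div_cancel₀ _ hB0.ne']
    linarith
  refine ⟨Metric.ball (x₀, 0) (min (ρ / 2) (c * T / 2)), Metric.isOpen_ball,
    Metric.mem_ball_self (by positivity), ?_⟩
  filter_upwards [Ioo_mem_nhdsGT (by positivity : 0 < c * T / 2)] with ε hε q hq
  rw [Metric.mem_ball, lt_min_iff] at hq
  have hsub : Metric.closedBall q (ρ / 2) ⊆ Metric.closedBall (x₀, 0) ρ :=
    Metric.closedBall_subset_closedBall' (by linarith [hq.1])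
  rcases le_or_gt ε q.2 with hle | hlt
  · exact .of_mem ⟨(hball (Metric.ball_subset_closedBall (hq.1.trans (by linarith)))).2.2.2.2, hle⟩
  have hq2 : |q.2| < c * T / 2 := by
    simpa using (le_max_right _ _).trans_lt (Prod.dist_eq.symm.trans_lt hq.2)
  refine (reaches_of_le_snd (locallyLipschitz_regularized hXp hXm hφ ε) (B := B) (c := c)
    (fun w hw => ?_) (fun w hw => ?_) (by positivity) hT.le hBT hlt.le
    (by linarith [hε.2, (abs_lt.1 hq2).1])).trans
    fun w hw => .of_mem ⟨(hball (hsub hw.1)).2.2.2.2, hw.2.ge⟩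
  · obtain ⟨-, -, hpB, hmB, -⟩ := hball (hsub hw)
    exact norm_regularized_le hφ hpB.le hmB.le
  · obtain ⟨hpc, hmc, -⟩ := hball (hsub hw)
    simpa using le_regularized (a := 0) (b := 1) (ε := ε) hφ (by simpa using hpc.le)
      (by simpa using hmc.le)

theorem exists_first_zero {f : ℝ → ℝ} {a b : ℝ} (hab : a ≤ b) (hf : ContinuousOn f (Icc a b))
    (ha : 0 < f a) (hb : f b ≤ 0) : ∃ c ∈ Ioc a b, f c = 0 ∧ ∀ t ∈ Ico a c, 0 < f t := by
  have hcompact : IsCompact (Icc a b ∩ f ⁻¹' Iic 0) :=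
    isCompact_Icc.of_isClosed_subset (hf.preimage_isClosed_of_isClosed isClosed_Icc isClosed_Iic)
      inter_subset_left
  obtain ⟨c, ⟨hc, hc0⟩, hmin⟩ := hcompact.exists_isLeast ⟨b, right_mem_Icc.2 hab, hb⟩
  have hpos : ∀ t ∈ Ico a c, 0 < f t := fun t ht => lt_of_not_ge fun ht0 =>
    ht.2.not_ge (hmin ⟨⟨ht.1, ht.2.le.trans hc.2⟩, ht0⟩)
  have hac : a < c := hc.1.lt_of_ne fun heq => ha.not_ge (heq ▸ hc0)
  obtain ⟨t, ht, ht0⟩ := intermediate_value_Icc' hc.1 (hf.mono (Icc_subset_Icc_right hc.2))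
    ⟨hc0, ha.le⟩
  have htc : t = c := ht.2.antisymm (hmin ⟨⟨ht.1, ht.2.trans hc.2⟩, ht0.le⟩)
  exact ⟨c, ⟨hac, hc.2⟩, htc ▸ ht0, hpos⟩

theorem le_of_monotone_of_le {f f' : ℝ → ℝ} {t₁ t₂ c : ℝ} (ht : t₁ ≤ t₂)
    (hf : ∀ t ∈ Icc 0 t₂, HasDerivWithinAt f (f' t) (Icc 0 t₂) t) (h0 : c ≤ f 0)
    (hnonneg : ∀ t ∈ Icc 0 t₁, 0 ≤ f' t) (hle : ∀ t ∈ Icc t₁ t₂, c ≤ f t) :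
    ∀ t ∈ Icc 0 t₂, c ≤ f t := by
  intro t htI
  rcases le_total t₁ t with hge | hlt
  · exact hle t ⟨hge, htI.2⟩
  have hsub : Icc 0 t₁ ⊆ Icc 0 t₂ := Icc_subset_Icc_right ht
  have hmono : MonotoneOn f (Icc 0 t₁) :=
    monotoneOn_of_hasDerivWithinAt_nonneg (convex_Icc 0 t₁)
      (fun s hs => (hf s (hsub hs)).continuousWithinAt.mono hsub)
      (fun s hs => (hf s (hsub (interior_subset hs))).mono (interior_subset.trans hsub))
      fun s hs => hnonneg s (interior_subset hs)
  exact h0.trans (hmono ⟨le_rfl, htI.1.trans hlt⟩ ⟨htI.1, hlt⟩ htI.1)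

theorem IsSolOn.exists_rise {X : ℝ × ℝ → ℝ × ℝ} {γ : ℝ → ℝ × ℝ} {τ : ℝ}
    (hγ : IsSolOn X γ (Icc 0 τ)) (hτ : 0 < τ) (h0 : (γ 0).2 = 0) (hup : 0 < (X (γ 0)).2)
    {U : Set (ℝ × ℝ)} (hU : U ∈ 𝓝 (γ 0)) :
    ∃ t₁ ∈ Ioo 0 τ, (∀ t ∈ Icc 0 t₁, γ t ∈ U) ∧ 0 < (γ t₁).2 := by
  have h0τ : (0 : ℝ) ∈ Icc 0 τ := left_mem_Icc.2 hτ.le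
  have hnear : ∀ᶠ t in 𝓝[≥] 0, γ t ∈ U := by
    rw [← nhdsWithin_Icc_eq_nhdsGE hτ]
    exact hγ.continuousOn 0 h0τ hU
  have hderiv : HasDerivWithinAt (fun t => (γ t).2) (X (γ 0)).2 (Ioi 0) 0 :=
    ((hγ 0 h0τ).mono_of_mem_nhdsWithin (Icc_mem_nhdsGT hτ)).snd
  obtain ⟨u, hu, hsub⟩ := mem_nhdsGE_iff_exists_Icc_subset.1 hnear
  obtain ⟨t₁, hpos, ht₁, ht₁u⟩ := ((eventually_gt_of_hasDerivWithinAt_pos hderiv hup).and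
    (Ioo_mem_nhdsGT (lt_min hu hτ))).exists
  rw [lt_min_iff] at ht₁u
  exact ⟨t₁, ⟨ht₁, ht₁u.2⟩, fun t ht => hsub ⟨ht.1, ht.2.trans ht₁u.1.le⟩, h0.symm.trans_lt hpos⟩

namespace IsC1VisibleFold

variable {Xp Xm : ℝ × ℝ → ℝ × ℝ} {φ : ℝ → ℝ} {M N δ : ℝ}

theorem eq_zero_of_isLocalMin_snd (hf : IsC1VisibleFold Xp Xm) {γ : ℝ → ℝ × ℝ} {t : ℝ}
    (hγ : HasDerivAt γ (Xp (γ t)) t) (hmin : IsLocalMin (fun t => (γ t).2) t)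
    (h0 : (γ t).2 = 0) : γ t = 0 := by
  have htangent : (Xp ((γ t).1, 0)).2 = 0 := by
    rw [show ((γ t).1, (0 : ℝ)) = γ t from Prod.ext rfl h0.symm]
    exact hmin.hasDerivAt_eq_zero hγ.snd
  rcases lt_trichotomy (γ t).1 0 with hneg | heq | hpos
  exacts [absurd htangent (hf.down _ hneg).ne, Prod.ext heq h0,
    absurd htangent (hf.up _ hpos).ne']

theorem exists_excursion (hf : IsC1VisibleFold Xp Xm) (hM : 0 ≤ M) {x₀ : ℝ} (hx₀ : 0 < x₀)
    (hret : ReturnsTo Xp x₀ M) {U G : Set (ℝ × ℝ)} (hU : U ∈ 𝓝 (x₀, 0)) (hG : IsOpen G)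
    (hMG : Icc (-M) 0 ×ˢ {(0 : ℝ)} ⊆ G) :
    ∃ (γ : ℝ → ℝ × ℝ) (t₁ t₂ : ℝ), 0 ≤ t₁ ∧ t₁ ≤ t₂ ∧ γ 0 = (x₀, 0) ∧
      IsSolOn Xp γ (Icc 0 t₂) ∧ (∀ t ∈ Icc 0 t₁, γ t ∈ U) ∧
      (∀ t ∈ Icc t₁ t₂, 0 < (γ t).2) ∧ γ t₂ ∈ G := by
  obtain ⟨τ, γ, hτ, hγ0, hγ, hτ_snd, hτM, hτ0⟩ := hret
  have hsol : IsSolOn Xp γ (Icc 0 τ) := fun t ht => (hγ t ht).1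
  have hτ : 0 < τ := hτ.lt_of_ne fun heq => by
    rw [← heq, hγ0] at hτ0
    exact hτ0.not_gt hx₀
  obtain ⟨t₁, ht₁, hγU, hpos⟩ := hsol.exists_rise hτ (by rw [hγ0]) (hγ0 ▸ hf.up x₀ hx₀)
    (hγ0 ▸ hU)
  obtain ⟨c, hc, hc0, hcpos⟩ := exists_first_zero ht₁.2.le
    (hsol.continuousOn.snd.mono (Icc_subset_Icc_left ht₁.1.le)) hpos hτ_snd.le
  have hcτ : c ∈ Icc 0 τ := ⟨ht₁.1.le.trans hc.1.le, hc.2⟩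
  have hcG : γ c ∈ G := hMG <| by
    rcases hc.2.lt_or_eq with hlt | rfl
    · have hnhds : Icc 0 τ ∈ 𝓝 c := Icc_mem_nhds (ht₁.1.trans hc.1) hlt
      rw [hf.eq_zero_of_isLocalMin_snd ((hsol c hcτ).hasDerivAt hnhds)
        (by filter_upwards [hnhds] with t ht using hc0.trans_le (hγ t ht).2) hc0]
      exact ⟨⟨neg_nonpos.2 hM, le_rfl⟩, rfl⟩
    · exact ⟨⟨hτM, hτ0⟩, hc0⟩
  have hleft : ∀ᶠ t in 𝓝[<] c, γ t ∈ G := by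
    rw [← nhdsWithin_Ioo_eq_nhdsLT hc.1]
    exact (hsol.continuousOn c hcτ).mono_left (nhdsWithin_mono _ fun t ht =>
      ⟨(ht₁.1.trans ht.1).le, ht.2.le.trans hc.2⟩) (hG.mem_nhds hcG)
  obtain ⟨t₂, ht₂G, ht₂⟩ := (hleft.and (Ioo_mem_nhdsLT hc.1)).exists
  exact ⟨γ, t₁, t₂, ht₁.1.le, ht₂.1.le, hγ0, hsol.mono (Icc_subset_Icc_right (ht₂.2.le.trans hc.2)),
    hγU, fun t ht => hcpos t ⟨ht.1, ht.2.trans_lt ht₂.2⟩,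
    ht₂G⟩

theorem exists_reaches_of_returnsTo (hf : IsC1VisibleFold Xp Xm) (hφ : IsWeakTransition φ)
    (hM : 0 ≤ M) {x₀ : ℝ} (hx₀ : 0 < x₀) (hm : 0 < (Xm (x₀, 0)).2) (hret : ReturnsTo Xp x₀ M)
    {G : Set (ℝ × ℝ)} (hG : IsOpen G) (hMG : Icc (-M) 0 ×ˢ {(0 : ℝ)} ⊆ G) :
    ∃ V, IsOpen V ∧ (x₀, 0) ∈ V ∧ ∀ᶠ ε in 𝓝[>] (0 : ℝ), ∀ q ∈ V,
      Reaches (regularized Xp Xm φ ε) q G := by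
  have hXp := hf.locallyLipschitz_plus
  obtain ⟨ρ, hρ, hball⟩ := Metric.nhds_basis_ball.mem_iff.1
    ((hXp.continuous.tendsto (x₀, 0)).snd_nhds.eventually_const_lt (hf.up x₀ hx₀))
  obtain ⟨γ, t₁, t₂, ht₁, ht₁₂, hγ0, hγ, hγU, hγpos, hγG⟩ := hf.exists_excursion hM hx₀ hret
    (Metric.ball_mem_nhds (x₀, 0) (half_pos hρ)) hG hMG
  obtain ⟨m, hm0, hle⟩ := isCompact_Icc.exists_forall_le'
    (hγ.continuousOn.snd.mono (Icc_subset_Icc_left ht₁)) hγpos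
  obtain ⟨s, hs, hsG⟩ := Metric.isOpen_iff.1 hG _ hγG
  have hnear := hγ.eventually_exists_dist_lt hXp (δ := min (ρ / 2) (min (m / 2) s)) (by positivity)
  rw [hγ0] at hnear
  obtain ⟨V, hV, hxV, hstrip⟩ :=
    exists_reaches_strip_top hXp hf.locallyLipschitz_minus hφ (hf.up x₀ hx₀) hm hnear
  refine ⟨V, hV, hxV, ?_⟩
  filter_upwards [hstrip, Ioo_mem_nhdsGT (half_pos hm0)] with ε hreach hε q hq
  refine (hreach q hq).trans ?_
  rintro _ ⟨⟨v, rfl, hv, hdist⟩, hεv⟩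
  simp only [lt_min_iff] at hdist
  have hup : ∀ t ∈ Icc 0 t₁, 0 ≤ (Xp (v t)).2 := fun t ht => by
    have hd := (hdist t ⟨ht.1, ht.2.trans ht₁₂⟩).1
    have hγd : dist (γ t) (x₀, 0) < ρ / 2 := hγU t ht
    exact le_of_lt (hball ((dist_triangle _ (γ t) _).trans_lt (by linarith)))
  have hhigh : ∀ t ∈ Icc t₁ t₂, ε ≤ (v t).2 := fun t ht => by
    have hd : |(v t).2 - (γ t).2| < m / 2 :=
      (le_max_right _ _).trans_lt (hdist t ⟨ht₁.trans ht.1, ht.2⟩).2.1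
    linarith [(abs_lt.1 hd).1, hle t ht, hε.2]
  have hstrip_top := le_of_monotone_of_le ht₁₂ (fun t ht => (hv t ht).snd) hεv hup hhigh
  have ht₂ : t₂ ∈ Icc 0 t₂ := right_mem_Icc.2 (ht₁.trans ht₁₂)
  exact ⟨t₂, v, ht₂.1, rfl,
    hv.congr_field fun t ht => (regularized_of_ge hφ hε.1 (hstrip_top t ht)).symm,
    hsG (hdist t₂ ht₂).2.2⟩

theorem exists_reaches_fold (hf : IsC1VisibleFold Xp Xm) (hφ : IsWeakTransition φ) (hM : 0 ≤ M)
    (hsl : ∀ x ∈ Icc (-M) 0, SlidesRight Xp Xm x)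
    (hret : ∀ x ∈ Icc 0 N, 0 < (Xm (x, 0)).2 ∧ ReturnsTo Xp x M) (hδ : 0 < δ) :
    ∃ U, IsOpen U ∧ Icc (-M) N ×ˢ {(0 : ℝ)} ⊆ U ∧ ∀ᶠ ε in 𝓝[>] (0 : ℝ), ∀ q ∈ U,
      Reaches (regularized Xp Xm φ ε) q (Metric.ball 0 δ) := by
  obtain ⟨G, hG, hMG, hGr⟩ := hf.exists_reaches_of_slidesRight hφ hM hsl hδ
  have hcompact : IsCompact (Icc (-M) N ×ˢ ({0} : Set ℝ)) := isCompact_Icc.prod isCompact_singleton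
  refine hcompact.induction_on ⟨∅, isOpen_empty, subset_rfl, .of_forall fun _ _ hq => hq.elim⟩
    ?_ ?_ ?_
  · rintro S S' hS ⟨U, hU, hSU, hreach⟩
    exact ⟨U, hU, hS.trans hSU, hreach⟩
  · rintro S S' ⟨U, hU, hSU, hreach⟩ ⟨U', hU', hSU', hreach'⟩
    refine ⟨U ∪ U', hU.union hU', union_subset_union hSU hSU', ?_⟩
    filter_upwards [hreach, hreach'] with ε hε hε' q hq
    exact hq.elim (hε q) (hε' q)
  rintro ⟨x, y⟩ ⟨hx, rfl⟩
  suffices h : ∃ V, IsOpen V ∧ (x, 0) ∈ V ∧ ∀ᶠ ε in 𝓝[>] (0 : ℝ), ∀ q ∈ V,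
      Reaches (regularized Xp Xm φ ε) q G by
    obtain ⟨V, hV, hxV, hreach⟩ := h
    refine ⟨V, mem_nhdsWithin_of_mem_nhds (hV.mem_nhds hxV), V, hV, subset_rfl, ?_⟩
    filter_upwards [hreach, hGr] with ε hε hε' q hq
    exact (hε q hq).trans hε'
  rcases le_or_gt x 0 with hx0 | hx0
  · exact ⟨G, hG, hMG ⟨⟨hx.1, hx0⟩, rfl⟩, .of_forall fun ε q hq => .of_mem hq⟩
  · obtain ⟨hm, hret⟩ := hret x ⟨hx0.le, hx.2⟩
    exact hf.exists_reaches_of_returnsTo hφ hM hx0 hm hret hG hMG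

end IsC1VisibleFold

/-! ### The exterior of the tangent orbit -/

section ClosedCurve

variable {Γ S : Set (ℝ × ℝ)} {q z : ℝ × ℝ} {a : ℝ}

theorem subset_curveInterior_of_isPreconnected (hS : IsPreconnected S) (hSΓ : S ⊆ Γᶜ)
    (hqS : q ∈ S) (hq : q ∈ curveInterior Γ) : S ⊆ curveInterior Γ := fun _ hz =>
  ⟨hSΓ hz, connectedComponentIn_eq (hS.subset_connectedComponentIn hqS hSΓ hz) ▸ hq.2⟩

theorem subset_curveExterior_of_isPreconnected (hS : IsPreconnected S) (hSΓ : S ⊆ Γᶜ)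
    (hqS : q ∈ S) (hq : q ∈ curveExterior Γ) : S ⊆ curveExterior Γ := fun _ hz =>
  ⟨hSΓ hz, connectedComponentIn_eq (hS.subset_connectedComponentIn hqS hSΓ hz) ▸ hq.2⟩

theorem lt_snd_of_mem_curveInterior (hΓ : ∀ w ∈ Γ, a ≤ w.2) (hz : z ∈ curveInterior Γ) :
    a < z.2 := by
  by_contra! hza
  have hray : {z.1} ×ˢ Iic z.2 ⊆ connectedComponentIn Γᶜ z := by
    refine (isPreconnected_singleton.prod isPreconnected_Iic).subset_connectedComponentIn
      ⟨rfl, mem_Iic.2 le_rfl⟩ ?_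
    rintro ⟨x, y⟩ ⟨rfl, hy⟩ hmem
    obtain rfl : y = z.2 := le_antisymm hy (hza.trans (hΓ _ hmem))
    exact hz.1 hmem
  have hbelow : BddBelow (Prod.snd '' ({z.1} ×ˢ Iic z.2)) :=
    (hz.2.subset hray).image_snd.bddBelow
  rw [snd_image_prod (singleton_nonempty _)] at hbelow
  exact not_bddBelow_Iic z.2 hbelow

theorem IsNestedFoliation.mem_curveInterior {p : ℝ × ℝ} {A : Set (ℝ × ℝ)}
    {O : ℝ × ℝ → Set (ℝ × ℝ)} (h : IsNestedFoliation p A O) (hq : q ∈ A)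
    (hz : z ∈ inside p (O q)) : z ∈ curveInterior (O q) :=
  ⟨connectedComponentIn_subset _ _ hz, connectedComponentIn_eq hz ▸ h.isBounded_inside q hq⟩

end ClosedCurve

theorem Reaches.inter_curveExterior {Z : ℝ × ℝ → ℝ × ℝ} (hZ : LocallyLipschitz Z)
    {γ : ℝ → ℝ × ℝ} (hγ : IsPeriodicSol Z γ) {q : ℝ × ℝ} {B : Set (ℝ × ℝ)} (h : Reaches Z q B)
    (hq : q ∈ curveExterior (range γ)) : Reaches Z q (B ∩ curveExterior (range γ)) := by
  obtain ⟨T, v, hT, rfl, hv, hvB⟩ := h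
  have hdisj : v '' Icc 0 T ⊆ (range γ)ᶜ := by
    rintro _ ⟨t, ht, rfl⟩ ⟨s, hs⟩
    have heq := IsSolOn.eqOn_of_mem hZ hv (isSolOn_of_hasDerivAt (hγ.shift (s - t)).1 _) ht
      (by rw [add_sub_cancel, hs])
    exact hq.1 (heq (left_mem_Icc.2 hT) ▸ mem_range_self _)
  exact ⟨T, v, hT, rfl, hv, hvB, subset_curveExterior_of_isPreconnected
    (isPreconnected_Icc.image v hv.continuousOn) hdisj ⟨0, left_mem_Icc.2 hT, rfl⟩ hq
    ⟨T, right_mem_Icc.2 hT, rfl⟩⟩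

theorem IsPeriodicSol.range_subset_curveInterior {X : ℝ × ℝ → ℝ × ℝ} (hX : LocallyLipschitz X)
    {γ η : ℝ → ℝ × ℝ} (hγ : IsPeriodicSol X γ) (hη : IsPeriodicSol X η) {q : ℝ × ℝ}
    (hqη : q ∈ range η) (hq : q ∈ curveInterior (range γ)) :
    range η ⊆ curveInterior (range γ) := by
  refine subset_curveInterior_of_isPreconnected (isPreconnected_range hη.continuous)
    (fun z hzη hzγ => hq.1 ?_) hqη hq
  rwa [← orbit_eq_range hX hγ.1 hzγ, orbit_eq_range hX hη.1 hzη]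

theorem IsCenter.exists_periodic_regularized {X Y : ℝ × ℝ → ℝ × ℝ} {p q : ℝ × ℝ}
    {A : Set (ℝ × ℝ)} {φ : ℝ → ℝ} {ε : ℝ} {γ : ℝ → ℝ × ℝ} (h : IsCenter X p A)
    (hX : LocallyLipschitz X) (hφ : IsWeakTransition φ) (hε : 0 < ε) (hγ : IsPeriodicSol X γ)
    (hγε : ∀ w ∈ range γ, ε ≤ w.2) (hγA : curveInterior (range γ) ⊆ A)
    (hq : q ∈ curveInterior (range γ)) (hqp : q ≠ p) :
    ∃ η : ℝ → ℝ × ℝ, IsPeriodicSol (regularized X Y φ ε) η ∧ q ∈ range η ∧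
      range η ⊆ curveInterior (range γ) ∧ p ∈ curveInterior (range η) := by
  obtain ⟨η, hη, rfl, -, -, hηp, -⟩ := h.exists_periodic hX (hγA hq) hqp
  have hsub := hγ.range_subset_curveInterior hX hη ⟨0, rfl⟩ hq
  refine ⟨η, ⟨fun t => ?_, hη.2⟩, ⟨0, rfl⟩, hsub, hηp⟩
  rw [regularized_of_ge hφ hε (lt_snd_of_mem_curveInterior hγε (hsub ⟨t, rfl⟩)).le]
  exact hη.1 t

namespace IsFoldWindow

variable {Xp Xm : ℝ × ℝ → ℝ × ℝ} {p q₁ q : ℝ × ℝ} {A : Set (ℝ × ℝ)} {ξ φ : ℝ → ℝ}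
  {r₀ ε M N : ℝ}

theorem le_snd_of_mem_orbit (hw : IsFoldWindow Xp p A q₁ ξ r₀) (hε : ε ∈ Ioc 0 r₀)
    (hq : q ∈ orbit Xp (ξ ε, ε)) : ε ≤ q.2 := by
  obtain ⟨hmem, hheight⟩ := hw.tangency (hw.mem_Icc_of_mem_Ioc hε)
  exact hheight.symm.trans_le
    (hw.isCenter.height_le hw.locallyLipschitz (hw.hull_subset hmem) hq)

theorem height_lt_of_mem_curveExterior (hw : IsFoldWindow Xp p A q₁ ξ r₀) (hε : ε ∈ Ioc 0 r₀)
    (hq : q ∈ hull p (orbit Xp q₁)) (hqe : q ∈ curveExterior (orbit Xp (ξ ε, ε))) :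
    height Xp q < ε := by
  have hF := hw.isNestedFoliation
  have hqA := hw.hull_subset hq
  have htA := hw.hull_subset (hw.tangency (hw.mem_Icc_of_mem_Ioc hε)).1
  have hne : orbit Xp q ≠ orbit Xp (ξ ε, ε) := fun e => hqe.1 (e ▸ hF.self_mem q hqA)
  by_contra! hle
  rcases hF.leaf_subset_inside_or htA hqA hne with hs | hs
  · exact hqe.2 (hF.mem_curveInterior htA (hs (hF.self_mem q hqA))).2
  · exact hle.not_gt (lt_snd_of_mem_curveInterior
      (fun w => hw.isCenter.height_le hw.locallyLipschitz hqA)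
      (hF.mem_curveInterior hqA (hs (hF.self_mem _ htA))))

theorem exists_isOpen_height_lt (hw : IsFoldWindow Xp p A q₁ ξ r₀) {μ : ℝ} (hμ : μ ≤ r₀) :
    ∃ U, IsOpen U ∧ U ⊆ hull p (orbit Xp q₁) ∧ (∀ q ∈ U, -μ < height Xp q) ∧
      ∀ m ∈ Ioc (-μ) r₀, orbit Xp (ξ m, m) ⊆ U := by
  have hF := hw.isNestedFoliation
  have hcont := hw.isCenter.continuousOn_height hw.locallyLipschitz hw.mem
  refine ⟨inside p (orbit Xp q₁) ∩ height Xp ⁻¹' Ioi (-μ),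
    (hcont.mono subset_union_left).isOpen_inter_preimage (hF.isOpen_inside hw.mem) isOpen_Ioi,
    fun q hq => .inl hq.1, fun q hq => hq.2, fun m hm q hq => ?_⟩
  obtain ⟨hmem, hheight⟩ := hw.tangency (m := m) ⟨by linarith [hm.1], hm.2⟩
  have hqm : height Xp q = m := (hw.isCenter.height_eq_of_mem hw.locallyLipschitz
    (hw.hull_subset hmem) hq).trans hheight
  refine ⟨hw.isCenter.mem_inside_of_height_lt hw.locallyLipschitz hw.mem
    (hF.leaf_subset_hull hw.mem hmem hq) ?_, hm.1.trans_eq hqm.symm⟩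
  linarith [hw.height_lt, hm.1]

theorem exists_isOpen_isAttracted (hw : IsFoldWindow Xp p A q₁ ξ r₀) (hf : IsC1VisibleFold Xp Xm)
    (hφ : IsWeakTransition φ) : ∃ U, IsOpen U ∧ (0, 0) ∈ U ∧ ∀ᶠ ε in 𝓝[>] (0 : ℝ),
      orbit Xp (ξ ε, ε) ⊆ U ∧ ∀ q ∈ U ∩ curveExterior (orbit Xp (ξ ε, ε)),
        IsAttracted (regularized Xp Xm φ ε) q (orbit Xp (ξ ε, ε)) := by
  obtain ⟨μ, hμ, hμr, s, htrap⟩ := hw.exists_isHeightTrap hf hφ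
  obtain ⟨U, hU, hUhull, hlow, horb⟩ := hw.exists_isOpen_height_lt hμr
  have h0 : ((0, 0) : ℝ × ℝ) = (ξ 0, 0) := hw.unique 0 hw.zero_mem _
    (hw.ball_subset (Metric.mem_closedBall_self hw.pos.le)) rfl hf.tangent
  refine ⟨U, hU, horb 0 ⟨neg_lt_zero.2 hμ, hw.pos.le⟩ ?_, ?_⟩
  · rw [← h0]
    exact hw.isNestedFoliation.self_mem _
      (hw.hull_subset (hw.ball_subset (Metric.mem_closedBall_self hw.pos.le)))
  filter_upwards [Ioo_mem_nhdsGT hμ] with ε hε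
  have ht := htrap ε hε
  refine ⟨horb ε ⟨by linarith [hε.1], ht.mem_Ioc.2⟩, fun q hq => ?_⟩
  exact ht.isAttracted (hUhull hq.1) (hlow q hq.1)
    (hw.height_lt_of_mem_curveExterior ht.mem_Ioc (hUhull hq.1) hq.2)

theorem exists_isOpen_isAttracted_of_slidesRight (hw : IsFoldWindow Xp p A q₁ ξ r₀)
    (hf : IsC1VisibleFold Xp Xm) (hφ : IsWeakTransition φ) (hM : 0 ≤ M)
    (hsl : ∀ x ∈ Icc (-M) 0, SlidesRight Xp Xm x)
    (hret : ∀ x ∈ Icc 0 N, 0 < (Xm (x, 0)).2 ∧ ReturnsTo Xp x M) :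
    ∃ U, IsOpen U ∧ Icc (-M) N ×ˢ {(0 : ℝ)} ⊆ U ∧ ∀ᶠ ε in 𝓝[>] (0 : ℝ),
      orbit Xp (ξ ε, ε) ⊆ U ∧ ∀ q ∈ U, q ∈ curveExterior (orbit Xp (ξ ε, ε)) →
        IsAttracted (regularized Xp Xm φ ε) q (orbit Xp (ξ ε, ε)) := by
  obtain ⟨V, hV, h0, hattr⟩ := hw.exists_isOpen_isAttracted hf hφ
  obtain ⟨δ, hδ, hδV⟩ := Metric.isOpen_iff.1 hV _ h0
  obtain ⟨U, hU, hsub, hreach⟩ := hf.exists_reaches_fold hφ hM hsl hret hδ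
  refine ⟨U ∪ V, hU.union hV, hsub.trans subset_union_left, ?_⟩
  filter_upwards [hreach, hattr, Ioc_mem_nhdsGT hw.pos] with ε hreach ⟨horb, hattr⟩ hε
  refine ⟨horb.trans subset_union_right, fun q hq hqe => hq.elim (fun hqU => ?_) fun hqV =>
    hattr q ⟨hqV, hqe⟩⟩
  obtain ⟨γ, -, hγ, -, hγZ, -⟩ := hw.exists_periodic (Y := Xm) hφ hε
  rw [hγ] at hattr hqe ⊢
  have hZ := locallyLipschitz_regularized hw.locallyLipschitz hf.locallyLipschitz_minus hφ ε
  exact ((hreach q hqU).inter_curveExterior hZ hγZ hqe).isAttracted fun w hwB =>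
    hattr w ⟨hδV hwB.1, hwB.2⟩

end IsFoldWindow

theorem theorem3_general (Xp Xm : ℝ × ℝ → ℝ × ℝ) (hfold : IsC1VisibleFold Xp Xm)
    (φ : ℝ → ℝ) (hφ : IsWeakTransition φ)
    (p : ℝ × ℝ) (A : Set (ℝ × ℝ)) (hp : 0 < p.2) (hcenter : IsCenter Xp p A)
    (hcross : ∃ q ∈ A, q.2 = 0) :
    ∃ (ξ : ℝ → ℝ) (Γ : ℝ → ℝ → ℝ × ℝ),
      Tendsto ξ (𝓝[>] 0) (𝓝 0) ∧
      (∀ R : ℝ, ∀ᶠ ε in 𝓝[>] (0 : ℝ), ∀ x ∈ Icc (-R) R,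
        (Xp (x, ε)).2 = 0 ↔ x = ξ ε) ∧
      (∀ᶠ ε in 𝓝[>] (0 : ℝ),
        Γ ε 0 = (ξ ε, ε) ∧ IsPeriodicSol Xp (Γ ε) ∧
        IsPeriodicSol (regularized Xp Xm φ ε) (Γ ε) ∧
        p ∈ curveInterior (range (Γ ε)) ∧ regularized Xp Xm φ ε p = 0 ∧
        ∀ q ∈ curveInterior (range (Γ ε)), q ≠ p →
          ∃ η : ℝ → ℝ × ℝ, IsPeriodicSol (regularized Xp Xm φ ε) η ∧ q ∈ range η ∧
            range η ⊆ curveInterior (range (Γ ε)) ∧ p ∈ curveInterior (range η)) ∧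
      (∀ M N : ℝ, 0 ≤ M →
        (∀ x ∈ Icc (-M) 0, SlidesRight Xp Xm x) →
        (∀ x ∈ Icc 0 N, 0 < (Xm (x, 0)).2 ∧ ReturnsTo Xp x M) →
        ∃ U : Set (ℝ × ℝ), IsOpen U ∧ (Icc (-M) N) ×ˢ {(0 : ℝ)} ⊆ U ∧
          ∀ᶠ ε in 𝓝[>] (0 : ℝ), range (Γ ε) ⊆ U ∧
            ∀ q ∈ U, q ∈ curveExterior (range (Γ ε)) →
              IsAttracted (regularized Xp Xm φ ε) q (range (Γ ε))) := by
  obtain ⟨ξ, hξ0, hξ⟩ := hfold.exists_tangency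
  obtain ⟨q₁, r₀, hw⟩ :=
    hcenter.exists_foldWindow hfold.locallyLipschitz_plus hp hcross hfold.tangent hξ
  choose! Γ h0 horb hΓ hΓZ hpΓ hΓA using
    fun ε (hε : ε ∈ Ioc 0 r₀) => hw.exists_periodic (Y := Xm) hφ hε
  refine ⟨ξ, Γ, hξ0.mono_left nhdsWithin_le_nhds,
    fun R => (hξ R).filter_mono nhdsWithin_le_nhds, ?_, fun M N hM hsl hret => ?_⟩
  · filter_upwards [Ioc_mem_nhdsGT hw.pos] with ε hε
    refine ⟨h0 ε hε, hΓ ε hε, hΓZ ε hε, hpΓ ε hε, ?_, fun q hq hqp => ?_⟩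
    · rw [regularized_of_ge hφ hε.1 (hε.2.trans hw.lt_center.le), hcenter.equilibrium]
    · exact hcenter.exists_periodic_regularized hw.locallyLipschitz hφ hε.1 (hΓ ε hε)
        (fun w hwΓ => hw.le_snd_of_mem_orbit hε (horb ε hε ▸ hwΓ)) (hΓA ε hε) hq hqp
  · obtain ⟨U, hU, hsub, hattr⟩ :=
      hw.exists_isOpen_isAttracted_of_slidesRight hfold hφ hM hsl hret
    refine ⟨U, hU, hsub, ?_⟩
    filter_upwards [hattr, Ioc_mem_nhdsGT hw.pos] with ε hattr hε
    exact horb ε hε ▸ hattr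

theorem theorem3 (Xp Xm : ℝ × ℝ → ℝ × ℝ) (hfold : IsVisibleFold Xp Xm)
    (φ : ℝ → ℝ) (hφ : IsTransition φ)
    (p : ℝ × ℝ) (A : Set (ℝ × ℝ)) (hp : 0 < p.2) (hcenter : IsCenter Xp p A)
    (hcross : ∃ q ∈ A, q.2 = 0) :
    ∃ (ξ : ℝ → ℝ) (Γ : ℝ → ℝ → ℝ × ℝ),
      -- the unique tangency of `X⁺` with the line `y = ε` near the switching line is at `(ξ ε, ε)`
      Tendsto ξ (𝓝[>] 0) (𝓝 0) ∧
      (∀ R : ℝ, 0 < R → ∀ᶠ ε in 𝓝[>] (0 : ℝ), ∀ x ∈ Icc (-R) R,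
        (Xp (x, ε)).2 = 0 ↔ x = ξ ε) ∧
      -- the orbit of `X⁺` through it is a periodic orbit of both `X⁺` and `Z_ε`,
      -- and its interior consists of the center and of periodic orbits of `Z_ε` around it
      (∀ᶠ ε in 𝓝[>] (0 : ℝ),
        Γ ε 0 = (ξ ε, ε) ∧ IsPeriodicSol Xp (Γ ε) ∧
        IsPeriodicSol (regularized Xp Xm φ ε) (Γ ε) ∧
        p ∈ curveInterior (range (Γ ε)) ∧ regularized Xp Xm φ ε p = 0 ∧
        ∀ q ∈ curveInterior (range (Γ ε)), q ≠ p →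
          ∃ η : ℝ → ℝ × ℝ, IsPeriodicSol (regularized Xp Xm φ ε) η ∧ q ∈ range η ∧
            range η ⊆ curveInterior (range (Γ ε)) ∧ p ∈ curveInterior (range η)) ∧
      -- it attracts all exterior orbits in a neighbourhood, independent of `ε`, of the
      -- orbit and of the regularized segment of the switching line
      (∀ M N : ℝ, 0 ≤ M → 0 ≤ N →
        (∀ x ∈ Icc (-M) 0, SlidesRight Xp Xm x) →
        (∀ x ∈ Icc 0 N, 0 < (Xm (x, 0)).2 ∧ ReturnsTo Xp x M) →
        ∃ U : Set (ℝ × ℝ), IsOpen U ∧ (Icc (-M) N) ×ˢ {(0 : ℝ)} ⊆ U ∧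
          ∀ᶠ ε in 𝓝[>] (0 : ℝ), range (Γ ε) ⊆ U ∧
            ∀ q ∈ U, q ∈ curveExterior (range (Γ ε)) →
              IsAttracted (regularized Xp Xm φ ε) q (range (Γ ε))) := by
  obtain ⟨ξ, Γ, hξ, htan, hper, hattr⟩ := theorem3_general Xp Xm hfold.isC1VisibleFold φ
    hφ.isWeakTransition p A hp hcenter hcross
  exact ⟨ξ, Γ, hξ, fun R _ => htan R, hper, fun M N hM _ => hattr M N hM⟩
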